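/- Let $(p_k)_{k\ge 0}$ be a probability distribution on $\{0,1,2,\dots\}$ with generating function $\mathbf f(z)=\sum_k p_kz^k$, $p_0>0$, mean $\sum_k kp_k>1$ and $\sum_k k^2p_k<\infty$. Let $q\in(0,1)$ be the extinction probability of the Galton–Watson tree with offspring law $(p_k)$, and let $\mathbf P$ be the law of this tree $T$ conditioned on non-extinction. Let $\beta>1/\mathbf f'(q)$ (so $\beta>1$), $p_\infty=1-\beta^{-1}$, and fix $\epsilon\in(0,1)$. Given $T$, let $(X_m)_{m\ge0}$ be the $\beta$-biased random walk started at the root $0$: from a vertex $u\ne 0$ with $k$ children it moves to its parent with probability $\frac1{1+\beta k}$ and to each child with probability $\frac{\beta}{1+\beta k}$; from the root it moves to a uniformly chosen child. The backbone is the set of vertices with an infinite line of descent. A bud is a child $y$ outside the backbone of a backbone vertex $x$; it carries a trap rooted at $x$, consisting of the edge $[x,y]$ and the finite tree of descendants of $y$, and the height of the trap is the height of that tree counted from $y$. An $h_n$-trap is a trap of height at least $$h_n=\Bigl\lceil (1-\epsilon)\frac{\ln n}{-\ln \mathbf f'(q)}\Bigr\rceil .$$ Let $(Y_i)_{i\ge0}$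 be the embedded walk on the backbone, i.e. $X$ observed at time $0$ and after each step it makes along an edge between two backbone vertices. It is generated by i.i.d. variables $U_i$, uniform on $[0,1]$: if $Y_i=w\neq 0$ has $k$ children in the backbone, then $Y_{i+1}$ is the parent of $w$ if $U_i\in[0,\frac1{k\beta+1}]$, and the $j$-th of these children if $U_i\in(1-\frac{j\beta}{k\beta+1},1-\frac{(j-1)\beta}{k\beta+1}]$; if $w=0$, it is the $j$-th of these children if $U_i\in(1-\frac jk,1-\frac{j-1}k]$. The choices of whether and which bud to enter, and the moves inside the traps, use randomness independent of $(U_i)$. Let $\widetilde Y_0=0$, $\widetilde Y_{i+1}=\widetilde Y_i-1$ if $U_i\le\frac1{\beta+1}$ and $\widetilde Y_{i+1}=\widetilde Y_i+1$ otherwise. A time $t$ is a super-regeneration time if $\widetilde Y_s<\widetilde Y_t$ for all $s<t$ and $\widetilde Y_s>\widetilde Y_t$ for all $s>t$; let $0\text{-SR}$ be the event that $0$ is a super-regeneration time. Let $K(n)$ be the first $i\ge0$ such that an $h_n$-trap is rooted at $Y_i$, let $\mathbf b(n)$ be the bud of the leftmost $h_n$-trap rooted at $Y_{K(n)}$, and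 let $$W_n=\operatorname{card}\{i\ge 0:\ X_i=Y_{K(n)},\ X_{i+1}=\mathbf b(n)\},$$ where $T$ is chosen under $\mathbf P$ and, given $T$, the walk is chosen under its law conditioned on $0\text{-SR}$. Then this conditional law is well defined; for every $n\ge 1$, almost surely $K(n)<\infty$ and $W_n<\infty$; and there is a random variable $W_\infty$ with values in $\{0,1,2,\dots\}$ such that $W_n\to W_\infty$ in distribution as $n\to\infty$. Moreover $W_\infty$ is stochastically dominated by a geometric variable of parameter $p_\infty/3$: $$P[W_\infty\ge k]\le \Bigl(1-\frac{p_\infty}{3}\Bigr)^{k-1}\qquad\text{for all integers }k\ge1.$$ -/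

import Mathlib

open MeasureTheory ProbabilityTheory Filter Topology

noncomputable section

namespace BiasedGW

/-! ### Galton-Watson trees -/

/-- Vertices in Ulam-Harris notation, last letter first: `i :: v` is the `i`-th child of `v`
(counted from `0`), `[]` is the root, `v.tail` is the parent of `v ≠ []`, and the descendants of
`v` (including `v`) are the words having `v` as a suffix. -/
abbrev Vertex := List ℕ

/-- An environment: the number of children `ω v` of every potential vertex `v`. -/
abbrev Env := Vertex → ℕ

/-- `InTree ω v`: the word `v` is a vertex of the tree `T(ω)`. -/
def InTree (ω : Env) : Vertex → Prop
  | [] => True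
  | i :: v => InTree ω v ∧ i < ω v

/-- The subtree of `T(ω)` formed by `v` and its descendants. -/
def subtree (ω : Env) (v : Vertex) : Set Vertex := {w | InTree ω w ∧ v <:+ w}

/-- The vertices with an infinite line of descent, that is (trees being locally finite) with an
infinite subtree. -/
def backbone (ω : Env) : Set Vertex := {v | InTree ω v ∧ (subtree ω v).Infinite}

/-- Non-extinction: the tree is infinite. -/
def survival : Set Env := {ω | {v | InTree ω v}.Infinite}

/-- The law of the offspring numbers: independent, all with law `p`. -/
def offspringLaw (p : PMF ℕ) : Measure Env := Measure.infinitePi fun _ : Vertex => p.toMeasure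

/-- The law `𝐏` of the Galton-Watson tree conditioned on non-extinction. -/
def treeLaw (p : PMF ℕ) : Measure Env := (offspringLaw p)[|survival]

/-- The extinction probability `q`. -/
def extinctionProb (p : PMF ℕ) : ℝ := (offspringLaw p).real survivalᶜ

/-- The generating function `𝐟(z) = ∑ p_k z^k` of the offspring law. -/
def genFun (p : PMF ℕ) (z : ℝ) : ℝ := ∑' k, (p k).toReal * z ^ k

/-- `𝐟'(q)`. -/
def derivAtExtinction (p : PMF ℕ) : ℝ := deriv (genFun p) (extinctionProb p)

/-! ### Backbone, buds and traps -/

open Classical in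
/-- The (indices of the) children of `x` in the backbone, from left to right. -/
def backboneChildren (ω : Env) (x : Vertex) : List ℕ :=
  (List.range (ω x)).filter fun i => i :: x ∈ backbone ω

open Classical in
/-- The (indices of the) children of `x` outside the backbone, from left to right. For `x` in the
backbone they are the buds adjacent to `x`, and each is the top of one trap rooted at `x`. -/
def buds (ω : Env) (x : Vertex) : List ℕ :=
  (List.range (ω x)).filter fun i => i :: x ∉ backbone ω

/-- Height of the (finite) tree of the descendants of the bud `y`, counted from `y`. -/
def trapHeight (ω : Env) (y : Vertex) : ℕ :=
  sSup {d | ∃ w ∈ subtree ω y, w.length = y.length + d}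

/-- `h_n = ⌈(1 - ε) ln n / (- ln 𝐟'(q))⌉`. -/
def bigHeight (p : PMF ℕ) (ε : ℝ) (n : ℕ) : ℕ :=
  ⌈(1 - ε) * Real.log n / (-Real.log (derivAtExtinction p))⌉₊

/-- The indices of the buds at `x` carrying a trap of height at least `h`. -/
def bigBuds (ω : Env) (h : ℕ) (x : Vertex) : Set ℕ :=
  {i | i ∈ buds ω x ∧ h ≤ trapHeight ω (i :: x)}

/-! ### The walk -/

/-- Weight of the edge from `x` to its parent, relative to weight `β` for the edges to the
children: the root has no parent. -/
def parentWeight (x : Vertex) : ℝ := if x = [] then 0 else 1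

/-- The `β`-biased step from `x` with admissible children `L`, driven by `u ∈ [0,1]`. For `x` not
the root and `k = L.length`, the `j`-th child (`1 ≤ j ≤ k`) is chosen iff
`1 - j β / (k β + 1) < u ≤ 1 - (j - 1) β / (k β + 1)`, and the parent iff `u ≤ 1 / (k β + 1)`.
At the root, the `j`-th child is chosen iff `1 - j / k < u ≤ 1 - (j - 1) / k`. -/
def biasedStep (β : ℝ) (x : Vertex) (L : List ℕ) (u : ℝ) : Vertex :=
  let j := ⌊(1 - u) * (L.length * β + parentWeight x) / β⌋₊
  if hj : j < L.length then L[j] :: x else x.tail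

/-- The walk `Y` on the backbone driven by `U`. -/
def walkY (β : ℝ) (ω : Env) (U : ℕ → unitInterval) : ℕ → Vertex
  | 0 => []
  | i + 1 => biasedStep β (walkY β ω U i) (backboneChildren ω (walkY β ω U i)) (U i)

/-- The `β`-biased walk on the whole tree, together with the number `c` of steps made so far along
edges of the backbone. On the backbone, `V m` decides whether the next step leads to a bud (each
with its probability `β / (β d + 1)`, or `1 / d` at the root, where `d` is the number of children)
and to which one; if not, the step is made along the backbone and is driven by `U c`. In the traps
the step is driven by `V m`. -/
def walkState (β : ℝ) (ω : Env) (U V : ℕ → unitInterval) : ℕ → Vertex × ℕ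
  | 0 => ([], 0)
  | m + 1 =>
    let x := (walkState β ω U V m).1
    let c := (walkState β ω U V m).2
    open Classical in
    if x ∈ backbone ω then
      let j := ⌊(V m : ℝ) * (ω x * β + parentWeight x) / β⌋₊
      if hj : j < (buds ω x).length then ((buds ω x)[j] :: x, c)
      else (biasedStep β x (backboneChildren ω x) (U c), c + 1)
    else (biasedStep β x (List.range (ω x)) (V m), c)

/-- The `β`-biased walk `X` on the tree. -/
def walkX (β : ℝ) (ω : Env) (U V : ℕ → unitInterval) (m : ℕ) : Vertex :=
  (walkState β ω U V m).1

/-! Consistency: on the backbone `X` is `Y` in the clock `c`, and `c` counts the steps of `X` along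
edges of the backbone; so `Y` is `X` observed at its steps along the backbone. -/

lemma suffix_antisymm {x y : Vertex} (h : x <:+ y) (h' : y <:+ x) : x = y :=
  h.eq_of_length_le h'.length_le

lemma backbone_tail {ω : Env} {x : Vertex} (hx : x ∈ backbone ω) : x.tail ∈ backbone ω := by
  cases x with
  | nil => simpa using hx
  | cons i v =>
    refine ⟨hx.1.1, hx.2.mono fun w hw => ⟨hw.1, ?_⟩⟩
    exact (List.suffix_cons i v).trans hw.2

lemma backbone_of_cons {ω : Env} {i : ℕ} {x : Vertex} (hx : i :: x ∈ backbone ω) :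
    x ∈ backbone ω := backbone_tail hx

lemma biasedStep_eq (β : ℝ) (x : Vertex) (L : List ℕ) (u : ℝ) :
    (∃ i ∈ L, biasedStep β x L u = i :: x) ∨ biasedStep β x L u = x.tail := by
  unfold biasedStep
  dsimp only
  split_ifs with h
  · exact Or.inl ⟨_, List.getElem_mem h, rfl⟩
  · exact Or.inr rfl

lemma biasedStep_mem_backbone (β : ℝ) {ω : Env} {x : Vertex} (hx : x ∈ backbone ω) (u : ℝ) :
    biasedStep β x (backboneChildren ω x) u ∈ backbone ω := by
  rcases biasedStep_eq β x (backboneChildren ω x) u with ⟨i, hi, h⟩ | h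
  · rw [h]
    simpa using (List.mem_filter.1 hi).2
  · rw [h]
    exact backbone_tail hx

/-- The position `X m` is a descendant of `Y c` without backbone vertices strictly below `Y c` on
the way. -/
lemma walkState_invariant (β : ℝ) {ω : Env} (h0 : [] ∈ backbone ω) (U V : ℕ → unitInterval)
    (m : ℕ) :
    walkY β ω U (walkState β ω U V m).2 ∈ backbone ω ∧
    walkY β ω U (walkState β ω U V m).2 <:+ (walkState β ω U V m).1 ∧
    ∀ v, v <:+ (walkState β ω U V m).1 → v ∈ backbone ω →
      v <:+ walkY β ω U (walkState β ω U V m).2 := by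
  induction m with
  | zero => exact ⟨h0, List.suffix_rfl, fun v hv _ => hv⟩
  | succ m ih =>
    obtain ⟨hb, hs, hl⟩ := ih
    rw [walkState]
    dsimp only
    generalize walkState β ω U V m = s at hb hs hl ⊢
    obtain ⟨x, c⟩ := s
    dsimp only at hb hs hl ⊢
    split_ifs with hx hj
    · have hxe : x = walkY β ω U c := suffix_antisymm (hl x List.suffix_rfl hx) hs
      refine ⟨hb, hs.trans (List.suffix_cons _ _), fun v hv hvb => ?_⟩
      rcases List.suffix_cons_iff.1 hv with h | h
      · exfalso
        have hm := List.mem_filter.1 (List.getElem_mem hj)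
        rw [h] at hvb
        simpa [hvb] using hm.2
      · exact hl v h hvb
    · have hxe : x = walkY β ω U c := suffix_antisymm (hl x List.suffix_rfl hx) hs
      subst hxe
      exact ⟨biasedStep_mem_backbone β hb _, List.suffix_rfl, fun v hv _ => hv⟩
    · have hne : walkY β ω U c ≠ x := fun h => hx (h ▸ hb)
      rcases biasedStep_eq β x (List.range (ω x)) (V m) with ⟨i, -, h⟩ | h
      · rw [h]
        refine ⟨hb, hs.trans (List.suffix_cons _ _), fun v hv hvb => ?_⟩
        rcases List.suffix_cons_iff.1 hv with h | h
        · exact absurd (backbone_of_cons (h ▸ hvb)) hx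
        · exact hl v h hvb
      · rw [h]
        refine ⟨hb, ?_, fun v hv hvb => hl v (hv.trans (List.tail_suffix x)) hvb⟩
        cases x with
        | nil => exact absurd h0 hx
        | cons i y =>
          rcases List.suffix_cons_iff.1 hs with h | h
          · exact absurd h hne
          · exact h

theorem walkX_eq_walkY (β : ℝ) {ω : Env} (h0 : [] ∈ backbone ω) (U V : ℕ → unitInterval) (m : ℕ)
    (hm : walkX β ω U V m ∈ backbone ω) :
    walkX β ω U V m = walkY β ω U (walkState β ω U V m).2 :=
  have h := walkState_invariant β h0 U V m
  suffix_antisymm (h.2.2 _ List.suffix_rfl hm) h.2.1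

open Classical in
theorem walkState_snd_succ (β : ℝ) {ω : Env} (U V : ℕ → unitInterval) (m : ℕ) :
    (walkState β ω U V (m + 1)).2 = (walkState β ω U V m).2 +
      if walkX β ω U V m ∈ backbone ω ∧ walkX β ω U V (m + 1) ∈ backbone ω then 1 else 0 := by
  unfold walkX
  rw [walkState]
  dsimp only
  generalize walkState β ω U V m = s
  obtain ⟨x, c⟩ := s
  dsimp only
  by_cases hx : x ∈ backbone ω
  · rw [if_pos hx]
    split_ifs with hj h h
    · exfalso
      have hm := List.mem_filter.1 (List.getElem_mem hj)
      simpa [h.2] using hm.2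
    · rfl
    · rfl
    · exact absurd ⟨hx, biasedStep_mem_backbone β hx _⟩ h
  · simp [hx]

/-! ### Super-regeneration times -/

/-- The `β`-biased walk on `ℤ` driven by the same variables `U`. -/
def walkZ (β : ℝ) (U : ℕ → unitInterval) : ℕ → ℤ
  | 0 => 0
  | i + 1 => if (U i : ℝ) ≤ 1 / (β + 1) then walkZ β U i - 1 else walkZ β U i + 1

/-- `t` is a super-regeneration time. -/
def IsSuperRegen (β : ℝ) (U : ℕ → unitInterval) (t : ℕ) : Prop :=
  (∀ s < t, walkZ β U s < walkZ β U t) ∧ ∀ s > t, walkZ β U t < walkZ β U s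

/-! ### The law conditioned on `0` being a super-regeneration time -/

/-- A sequence of independent variables, uniform on `[0,1]`. -/
def uniformLaw : Measure (ℕ → unitInterval) := Measure.infinitePi fun _ : ℕ => volume

/-- The variables `(U, V)` driving the walk, conditioned on `0` being a super-regeneration time. -/
def drivingLaw (β : ℝ) : Measure ((ℕ → unitInterval) × (ℕ → unitInterval)) :=
  (uniformLaw.prod uniformLaw)[|{d | IsSuperRegen β d.1 0}]

/-- The environment has law `𝐏` and, given the environment, the walk is conditioned on `0` being a
super-regeneration time. -/
def condLaw (p : PMF ℕ) (β : ℝ) :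
    Measure (Env × (ℕ → unitInterval) × (ℕ → unitInterval)) :=
  (treeLaw p).prod (drivingLaw β)

/-! ### Visits to the first big trap -/

/-- The walk `Y` meets at time `i` the root of a trap of height at least `h`. -/
def MeetsBigTrap (β : ℝ) (h : ℕ) (ω : Env) (U : ℕ → unitInterval) (i : ℕ) : Prop :=
  (bigBuds ω h (walkY β ω U i)).Nonempty

/-- First time, in the clock of `Y`, at which the root of a trap of height at least `h` is met. -/
def meetTime (β : ℝ) (h : ℕ) (ω : Env) (U : ℕ → unitInterval) : ℕ :=
  sInf {i | MeetsBigTrap β h ω U i}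

/-- The root of the first trap of height at least `h` met. -/
def trapRoot (β : ℝ) (h : ℕ) (ω : Env) (U : ℕ → unitInterval) : Vertex :=
  walkY β ω U (meetTime β h ω U)

/-- The bud of the first trap of height at least `h` met (the leftmost such trap at its root). -/
def trapBud (β : ℝ) (h : ℕ) (ω : Env) (U : ℕ → unitInterval) : Vertex :=
  sInf (bigBuds ω h (trapRoot β h ω U)) :: trapRoot β h ω U

/-- The times at which the walk `X` enters the first trap of height at least `h` met. -/
def visitTimes (β : ℝ) (h : ℕ) (d : Env × (ℕ → unitInterval) × (ℕ → unitInterval)) : Set ℕ :=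
  {i | walkX β d.1 d.2.1 d.2.2 i = trapRoot β h d.1 d.2.1 ∧
    walkX β d.1 d.2.1 d.2.2 (i + 1) = trapBud β h d.1 d.2.1}

/-- `W_n`, as a function of the environment and of the driving variables, with `h = h_n`. -/
def visits (β : ℝ) (h : ℕ) (d : Env × (ℕ → unitInterval) × (ℕ → unitInterval)) : ℕ :=
  (visitTimes β h d).ncard

end BiasedGW

end

/-!
The proof splits the walk into its backbone part `Y`, driven by `U`, and the excursions into the
traps, driven by `V`.

*Excursions.* Fix the environment and `U`, and let `x` be a backbone vertex with `κ` backbone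
children and parent weight `w`, visited `N` times by `Y`. Each time the walk decides at `x`
whether to enter a given bud or to move along the backbone, it chooses the bud with probability `r
= β / ((κ + 1) β + w)`. So the number of entries into the bud is a sum of `N` independent
geometric variables, whose tail is `nbTail r k N`. This is proved by a martingale argument
(`lintegral_entryMart`, `uniformLaw_entries_ge`); the clock of the backbone walk goes to infinity
because every trap is left (`ae_tendsto_clock`). Hence the tail `P[W_n ≥ k]` is the mean of a
function `Ψ` of the local picture `(N, κ, w)` at the root of the first big trap (`trapObs`,
`condLaw_visits_ge`).

*Convergence.* The walk `Y` moves away from the root at least as fast as the walk on `ℤ`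
(`walkZ_sub_le`), so a super-regeneration time `τ > 0` separates the past of `Y` from a fresh
copy, started at the root of a tree whose root has a parent edge. Giving this edge the weight `ρ`
(`0` for the original walk, `1` after a regeneration; `walkG`), the renewal equation at the first
such time (`trapObs_renewal`, `measure_good_renewal`) expresses the mean of `Ψ` by its mean over
the event that a big trap is met before `τ`. Summing over the time, the place and the index of the
big bud, and exchanging the tree of its descendants for an independent one, this mean equals `e_h`
times a sum over the trees in which the bud is replaced by a leaf, where `e_h` is the probability
that a Galton-Watson tree is finite of height at least `h`. The factor `e_h` cancels in the
renewal equation, and the sum converges as `h → ∞` by monotone convergence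
(`tendsto_tsum_trapTerm`); its limit is finite by `tsum_noRegen_ne_top`. The limit of the tails
does not depend on the parent weight at the root of the original tree, since the first block
contains a high trap with vanishing probability (`tendsto_trapObs_zero`). The same renewal
equation for `Ψ = 1` shows that a big trap is met almost surely (`baseLaw_good_not_meet`).

*Domination.* At each visit to the root `x` of the first big trap, the future of the walk on `ℤ`
stays above its present with probability at least `(β - 1) / (β + 1)` (`le_regenProb`),
independently of the past, and then `Y` does not return to `x`. So `N` is dominated by a geometric
variable (`uniformLaw_manyVisits_le`), and `W_n` by a geometric variable of parameter `(1 - β⁻¹) /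
3`, because `r ≤ 1 / 2` (`entryProb_le`, `condLaw_visits_ge_le`). This also makes the limits of
the tails the tails of a probability measure on `ℕ`.
-/

noncomputable section

namespace BiasedGW

/-! ### Splicing independent families -/

section Splice

variable {ι κ X : Type*} [MeasurableSpace X]

open Classical in
/-- The family that agrees with `ω` on `S` and is read off `ω'` along `e` outside `S`. -/
def splice (S : Set ι) (e : ι → κ) (ω : ι → X) (ω' : κ → X) : ι → X :=
  fun i => if i ∈ S then ω i else ω' (e i)

lemma measurable_splice (S : Set ι) (e : ι → κ) :
    Measurable fun z : (ι → X) × (κ → X) => splice S e z.1 z.2 := by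
  refine measurable_pi_lambda _ fun i => ?_
  unfold splice
  by_cases h : i ∈ S
  · simp only [h, if_true]; fun_prop
  · simp only [h, if_false]; fun_prop

/-- Splicing two independent families of i.i.d. variables gives a family of i.i.d. variables, if no
variable of the second family is used twice. Shifting time, grafting trees, reversing time and
resampling one variable are all of this form. -/
theorem map_splice (m : Measure X) [IsProbabilityMeasure m] (S : Set ι) (e : ι → κ)
    (he : Set.InjOn e Sᶜ) :
    ((Measure.infinitePi fun _ : ι => m).prod (Measure.infinitePi fun _ : κ => m)).map
      (fun z => splice S e z.1 z.2) = Measure.infinitePi fun _ : ι => m := by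
  classical
  refine Measure.eq_infinitePi _ fun s t ht => ?_
  rw [Measure.map_apply (measurable_splice S e)
    (MeasurableSet.pi s.countable_toSet fun i _ => ht i)]
  set s1 := s.filter (· ∈ S)
  set s2 := s.filter (· ∉ S)
  have hinj : Set.InjOn e s2 := he.mono fun i hi => (Finset.mem_filter.1 hi).2
  -- the box of the second family: the constraint on the variable `e i` is the one on `i`
  let t' : κ → Set X := fun k => ⋂ i ∈ s2.filter (e · = k), t i
  have ht' : ∀ i ∈ s2, t' (e i) = t i := by
    intro i hi
    ext x
    simp only [t', Set.mem_iInter, Finset.mem_filter]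
    refine ⟨fun h => h i ⟨hi, rfl⟩, fun h j hj => ?_⟩
    rwa [hinj hj.1 hi hj.2]
  have hset : (fun z : (ι → X) × (κ → X) => splice S e z.1 z.2) ⁻¹' Set.pi s t =
      (Set.pi s1 t) ×ˢ (Set.pi (s2.image e) t') := by
    ext ⟨a, b⟩
    simp only [Set.mem_preimage, Set.mem_pi, Set.mem_prod, splice, s1, Finset.coe_filter,
      Set.mem_ofPred_eq, Finset.coe_image, Set.forall_mem_image]
    constructor
    · intro h
      refine ⟨fun i hi => by simpa [hi.2] using h i hi.1, fun i hi => ?_⟩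
      rw [ht' i hi]
      have hi' := Finset.mem_filter.1 hi
      simpa [hi'.2] using h i hi'.1
    · rintro ⟨h1, h2⟩ i hi
      by_cases hS : i ∈ S
      · simpa [hS] using h1 i ⟨hi, hS⟩
      · have hi2 : i ∈ s2 := Finset.mem_filter.2 ⟨hi, hS⟩
        have := h2 hi2
        rw [ht' i hi2] at this
        simpa [hS] using this
  rw [hset, Measure.prod_prod, Measure.infinitePi_pi _ (fun i _ => ht i),
    Measure.infinitePi_pi _ (fun k _ => Finset.measurableSet_biInter _ fun i _ => ht i),
    Finset.prod_image (fun i hi j hj h => hinj hi hj h),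
    ← Finset.prod_filter_mul_prod_filter_not s (· ∈ S)]
  congr 1
  exact Finset.prod_congr rfl fun i hi => congrArg m (ht' i hi)

theorem lintegral_splice (m : Measure X) [IsProbabilityMeasure m] (S : Set ι) (e : ι → κ)
    (he : Set.InjOn e Sᶜ) {f : (ι → X) → ENNReal} (hf : Measurable f) :
    ∫⁻ ω, f ω ∂(Measure.infinitePi fun _ : ι => m) =
      ∫⁻ ω, ∫⁻ ω', f (splice S e ω ω') ∂(Measure.infinitePi fun _ : κ => m)
        ∂(Measure.infinitePi fun _ : ι => m) := by
  conv_lhs => rw [← map_splice m S e he]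
  rw [lintegral_map hf (measurable_splice S e), lintegral_prod]
  exact (hf.comp (measurable_splice S e)).aemeasurable

end Splice

/-! ### Time shift, time reversal and resampling for the driving variables -/

instance : IsProbabilityMeasure uniformLaw := by unfold uniformLaw; infer_instance

instance (p : PMF ℕ) : IsProbabilityMeasure (offspringLaw p) := by
  unfold offspringLaw; infer_instance

/-- The driving variables from time `t` on. -/
def shift (t : ℕ) (U : ℕ → unitInterval) : ℕ → unitInterval := fun i => U (t + i)

/-- The driving variables `U` before time `t`, followed by `U'`. -/
def concat (t : ℕ) (U U' : ℕ → unitInterval) : ℕ → unitInterval :=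
  splice {i | i < t} (fun i => i - t) U U'

lemma concat_of_lt {t i : ℕ} (h : i < t) (U U' : ℕ → unitInterval) : concat t U U' i = U i := by
  simp [concat, splice, h]

lemma shift_concat (t : ℕ) (U U' : ℕ → unitInterval) : shift t (concat t U U') = U' := by
  ext i; simp [shift, concat, splice]

lemma measurable_shift (t : ℕ) : Measurable (shift t) :=
  measurable_pi_lambda _ fun _ => measurable_pi_apply _

theorem lintegral_uniformLaw_concat (t : ℕ) {f : (ℕ → unitInterval) → ENNReal}
    (hf : Measurable f) :
    ∫⁻ U, f U ∂uniformLaw = ∫⁻ U, ∫⁻ U', f (concat t U U') ∂uniformLaw ∂uniformLaw := by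
  refine lintegral_splice volume _ _ ?_ hf
  intro i hi j hj h
  simp only [Set.mem_compl_iff, Set.mem_ofPred_eq, not_lt] at hi hj
  dsimp only at h
  omega

/-- Independence of the past and the future of time `t`. -/
theorem uniformLaw_past_inter_future (t : ℕ) {A B : Set (ℕ → unitInterval)} (hA : MeasurableSet A)
    (hB : MeasurableSet B) (hpast : ∀ U U', concat t U U' ∈ A ↔ U ∈ A) :
    uniformLaw (A ∩ shift t ⁻¹' B) = uniformLaw A * uniformLaw B := by
  have hm : MeasurableSet (A ∩ shift t ⁻¹' B) := hA.inter (measurable_shift t hB)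
  rw [← lintegral_indicator_one hm, lintegral_uniformLaw_concat t (measurable_one.indicator hm)]
  have : ∀ U U', (A ∩ shift t ⁻¹' B).indicator
      (1 : (ℕ → unitInterval) → ENNReal) (concat t U U') =
      A.indicator 1 U * B.indicator 1 U' := by
    intro U U'
    have hiff : concat t U U' ∈ A ∩ shift t ⁻¹' B ↔ U ∈ A ∧ U' ∈ B := by
      rw [Set.mem_inter_iff, hpast, Set.mem_preimage, shift_concat]
    by_cases h1 : U ∈ A <;> by_cases h2 : U' ∈ B <;> simp [hiff, h1, h2]
  rw [lintegral_congr fun U => lintegral_congr fun U' => this U U']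
  rw [lintegral_congr fun U => lintegral_const_mul _ (measurable_one.indicator hB),
    lintegral_mul_const _ (measurable_one.indicator hA), lintegral_indicator_one hA,
    lintegral_indicator_one hB]

/-- The first `t` driving variables in reversed order. -/
def reversed (t : ℕ) (U : ℕ → unitInterval) : ℕ → unitInterval :=
  fun i => U (if i < t then t - 1 - i else i)

lemma measurable_reversed (t : ℕ) : Measurable (reversed t) :=
  measurable_pi_lambda _ fun _ => measurable_pi_apply _

theorem uniformLaw_reversed (t : ℕ) {A : Set (ℕ → unitInterval)} (hA : MeasurableSet A) :
    uniformLaw (reversed t ⁻¹' A) = uniformLaw A := by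
  rw [← lintegral_indicator_one hA, uniformLaw, lintegral_splice volume ∅
    (fun i => if i < t then t - 1 - i else i) ?_ (measurable_one.indicator hA)]
  · have : ∀ (U U' : ℕ → unitInterval), splice ∅ (fun i => if i < t then t - 1 - i else i) U U' =
        reversed t U' := by
      intro U U'; ext i; simp [splice, reversed]
    simp_rw [this]
    rw [lintegral_const, measure_univ, mul_one,
      ← lintegral_indicator_one (measurable_reversed t hA)]
    rfl
  · intro i _ j _ h
    dsimp only at h
    split_ifs at h <;> omega

/-- The variable at time `m` may be resampled. -/
theorem lintegral_uniformLaw_update (m : ℕ) {f : (ℕ → unitInterval) → ENNReal}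
    (hf : Measurable f) :
    ∫⁻ V, f V ∂uniformLaw =
      ∫⁻ V, (∫⁻ v : unitInterval, f (Function.update V m v)) ∂uniformLaw := by
  have h := lintegral_splice (volume : Measure unitInterval) {i : ℕ | i ≠ m} (fun _ => 0)
    (by intro i hi j hj _; simp only [Set.mem_compl_iff, Set.mem_ofPred_eq, not_not] at hi hj
        rw [hi, hj]) hf
  refine h.trans (lintegral_congr fun V => ?_)
  have h2 : ∀ V' : ℕ → unitInterval, splice {i : ℕ | i ≠ m} (fun _ => 0) V V' =
      Function.update V m (V' 0) := by
    intro V'; ext i; by_cases hi : i = m <;> simp [splice, hi]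
  simp_rw [h2]
  have h3 := (measurePreserving_eval_infinitePi (fun _ : ℕ => (volume : Measure unitInterval)) 0)
  exact h3.lintegral_comp (hf.comp (measurable_update V))

/-! ### Subtrees and grafting -/

/-- The environment seen from `y`: its tree is the tree of the descendants of `y`. -/
def sub (ω : Env) (y : Vertex) : Env := fun v => ω (v ++ y)

/-- The environment `ω` with its values at the descendants of `y` replaced by `η`. A word `w ++ y` is
sent to `w`, that is, to its first letters. -/
def graft (y : Vertex) (ω η : Env) : Env :=
  splice {v | ¬ y <:+ v} (fun v => v.take (v.length - y.length)) ω η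

lemma graft_append (y v : Vertex) (ω η : Env) : graft y ω η (v ++ y) = η v := by
  simp [graft, splice]

lemma graft_of_not_suffix {y v : Vertex} (h : ¬ y <:+ v) (ω η : Env) : graft y ω η v = ω v := by
  simp [graft, splice, h]

lemma sub_graft (y : Vertex) (ω η : Env) : sub (graft y ω η) y = η := by
  ext v; exact graft_append y v ω η

lemma sub_sub (ω : Env) (y v : Vertex) : sub (sub ω y) v = sub ω (v ++ y) := by
  ext w; simp [sub]

lemma measurable_graft (y : Vertex) : Measurable fun z : Env × Env => graft y z.1 z.2 :=
  measurable_splice _ _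

lemma measurable_sub (y : Vertex) : Measurable fun ω : Env => sub ω y :=
  measurable_pi_lambda _ fun _ => measurable_pi_apply _

theorem lintegral_offspringLaw_graft (p : PMF ℕ) (y : Vertex) {f : Env → ENNReal}
    (hf : Measurable f) :
    ∫⁻ ω, f ω ∂offspringLaw p =
      ∫⁻ ω, ∫⁻ η, f (graft y ω η) ∂offspringLaw p ∂offspringLaw p := by
  refine lintegral_splice p.toMeasure _ _ ?_ hf
  intro v hv w hw h
  simp only [Set.mem_compl_iff, Set.mem_ofPred_eq, not_not] at hv hw
  obtain ⟨a, rfl⟩ := hv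
  obtain ⟨b, rfl⟩ := hw
  simp at h
  rw [h]

/-- Two environments agree outside the descendants of `y`. -/
def AgreeOff (y : Vertex) (ω ω' : Env) : Prop := ∀ v, ¬ y <:+ v → ω v = ω' v

lemma agreeOff_graft (y : Vertex) (ω η : Env) : AgreeOff y (graft y ω η) ω :=
  fun _ h => graft_of_not_suffix h ω η

lemma AgreeOff.symm {y : Vertex} {ω ω' : Env} (h : AgreeOff y ω ω') : AgreeOff y ω' ω :=
  fun v hv => (h v hv).symm

lemma graft_congr {y : Vertex} {ω ω' : Env} (h : AgreeOff y ω ω') (η : Env) :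
    graft y ω η = graft y ω' η := by
  ext v
  by_cases hv : y <:+ v
  · obtain ⟨w, rfl⟩ := hv
    rw [graft_append, graft_append]
  · rw [graft_of_not_suffix hv, graft_of_not_suffix hv, h v hv]

lemma graft_graft (y : Vertex) (ω η η' : Env) : graft y (graft y ω η) η' = graft y ω η' :=
  graft_congr (agreeOff_graft y ω η) η'

lemma not_cons_suffix_self (i : ℕ) (v : Vertex) : ¬ (i :: v) <:+ v := fun h => by
  simpa using h.length_le

lemma suffix_of_suffix_cons {y v : Vertex} {i : ℕ} (h : y <:+ i :: v) (hne : y ≠ i :: v) :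
    y <:+ v := by
  rcases List.suffix_cons_iff.1 h with h | h
  · exact absurd h hne
  · exact h

lemma suffix_total {a b w : Vertex} (ha : a <:+ w) (hb : b <:+ w) : a <:+ b ∨ b <:+ a :=
  List.suffix_or_suffix_of_suffix ha hb

lemma inTree_append (ω : Env) (v y : Vertex) :
    InTree ω (v ++ y) ↔ InTree ω y ∧ InTree (sub ω y) v := by
  induction v with
  | nil => simp [InTree]
  | cons i v ih => simp [InTree, ih, sub, and_assoc]

lemma InTree.of_suffix {ω : Env} {v w : Vertex} (h : InTree ω w) (hs : v <:+ w) : InTree ω v := by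
  obtain ⟨a, rfl⟩ := hs
  exact ((inTree_append ω a v).1 h).1

lemma inTree_congr {y : Vertex} {ω ω' : Env} (h : AgreeOff y ω ω') {v : Vertex}
    (hv : ¬ y <:+ v ∨ v = y) : InTree ω v ↔ InTree ω' v := by
  induction v with
  | nil => simp [InTree]
  | cons i v ih =>
    have hv' : ¬ y <:+ v := by
      rcases hv with hv | hv
      · exact fun h => hv (h.trans (List.suffix_cons i v))
      · rw [← hv]; exact not_cons_suffix_self i v
    simp [InTree, ih (Or.inl hv'), h v hv']

lemma subtree_append {ω : Env} {y : Vertex} (hy : InTree ω y) (v : Vertex) :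
    subtree ω (v ++ y) = (fun w => w ++ y) '' subtree (sub ω y) v := by
  ext w
  simp only [subtree, Set.mem_ofPred_eq, Set.mem_image]
  constructor
  · rintro ⟨hw, a, rfl⟩
    refine ⟨a ++ v, ⟨?_, List.suffix_append a v⟩, by simp⟩
    rw [← List.append_assoc] at hw
    exact ((inTree_append ω (a ++ v) y).1 hw).2
  · rintro ⟨a, ⟨ha, b, rfl⟩, rfl⟩
    exact ⟨(inTree_append ω _ y).2 ⟨hy, ha⟩, b, by simp⟩

lemma append_right_injective' (y : Vertex) : Function.Injective fun w : Vertex => w ++ y :=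
  List.append_left_injective y

lemma append_mem_backbone {ω : Env} {v y : Vertex} :
    v ++ y ∈ backbone ω ↔ InTree ω y ∧ v ∈ backbone (sub ω y) := by
  simp only [backbone, Set.mem_ofPred_eq, inTree_append]
  constructor
  · rintro ⟨⟨h1, h2⟩, h3⟩
    rw [subtree_append h1] at h3
    exact ⟨h1, h2, h3.of_image _⟩
  · rintro ⟨h1, h2, h3⟩
    refine ⟨⟨h1, h2⟩, ?_⟩
    rw [subtree_append h1]
    exact h3.image (append_right_injective' y).injOn

lemma nil_mem_backbone {ω : Env} : [] ∈ backbone ω ↔ ω ∈ survival := by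
  simp [backbone, survival, subtree, InTree]

lemma mem_backbone_iff {ω : Env} {y : Vertex} :
    y ∈ backbone ω ↔ InTree ω y ∧ sub ω y ∈ survival := by
  have := append_mem_backbone (ω := ω) (v := []) (y := y)
  simpa [nil_mem_backbone] using this

lemma mem_backbone_of_suffix {ω : Env} {v w : Vertex} (hw : w ∈ backbone ω) (hs : v <:+ w) :
    v ∈ backbone ω := by
  induction w with
  | nil => rwa [List.suffix_nil.1 hs]
  | cons i w ih =>
    rcases List.suffix_cons_iff.1 hs with h | h
    · rwa [h]
    · exact ih (backbone_of_cons hw) h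

/-- Membership in the backbone, outside the descendants of `y`, depends on the environment there
and on whether `y` is in the backbone. -/
lemma backbone_congr {y : Vertex} {ω ω' : Env} (h : AgreeOff y ω ω')
    (hy : y ∈ backbone ω ↔ y ∈ backbone ω') {v : Vertex} (hv : ¬ y <:+ v) :
    v ∈ backbone ω ↔ v ∈ backbone ω' := by
  have hsplit : ∀ ω : Env, subtree ω v = {w ∈ subtree ω v | ¬ y <:+ w} ∪
      {w ∈ subtree ω v | y <:+ w} := by
    intro ω; ext w
    by_cases hw : y <:+ w <;> simp [hw]
  have h1 : {w ∈ subtree ω v | ¬ y <:+ w} = {w ∈ subtree ω' v | ¬ y <:+ w} := by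
    ext w
    simp only [subtree, Set.mem_ofPred_eq]
    constructor <;> rintro ⟨⟨a, b⟩, c⟩
    · exact ⟨⟨(inTree_congr h (Or.inl c)).1 a, b⟩, c⟩
    · exact ⟨⟨(inTree_congr h (Or.inl c)).2 a, b⟩, c⟩
  by_cases hs : v <:+ y
  · by_cases hyb : y ∈ backbone ω
    · exact ⟨fun _ => mem_backbone_of_suffix (hy.1 hyb) hs, fun _ => mem_backbone_of_suffix hyb hs⟩
    · have h2 : ∀ ω : Env, y ∉ backbone ω → {w ∈ subtree ω v | y <:+ w}.Finite := by
        intro ω hb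
        by_cases hT : InTree ω y
        · have : (subtree ω y).Finite := by
            by_contra hinf; exact hb ⟨hT, hinf⟩
          exact this.subset fun w hw => ⟨hw.1.1, hw.2⟩
        · convert Set.finite_empty
          ext w
          simp only [Set.mem_ofPred_eq, Set.mem_empty_iff_false, iff_false]
          exact fun hw => hT (hw.1.1.of_suffix hw.2)
      have hyb' : y ∉ backbone ω' := fun hh => hyb (hy.2 hh)
      simp only [backbone, Set.mem_ofPred_eq, inTree_congr h (Or.inl hv)]
      rw [hsplit ω, hsplit ω', Set.infinite_union, Set.infinite_union, h1]
      simp [(h2 ω hyb).not_infinite, (h2 ω' hyb').not_infinite]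
  · have h2 : ∀ ω : Env, {w ∈ subtree ω v | y <:+ w} = ∅ := by
      intro ω; ext w
      simp only [Set.mem_ofPred_eq, Set.mem_empty_iff_false, iff_false]
      rintro ⟨⟨-, hw⟩, hw'⟩
      rcases suffix_total hw hw' with h | h
      · exact hs h
      · exact hv h
    simp only [backbone, Set.mem_ofPred_eq, inTree_congr h (Or.inl hv)]
    rw [hsplit ω, hsplit ω', h1, h2, h2]

lemma backbone_congr' {y : Vertex} {ω ω' : Env} (h : AgreeOff y ω ω')
    (hy : y ∈ backbone ω ↔ y ∈ backbone ω') {v : Vertex} (hv : ¬ y <:+ v) (i : ℕ) :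
    i :: v ∈ backbone ω ↔ i :: v ∈ backbone ω' := by
  by_cases hyi : y = i :: v
  · rwa [← hyi]
  · exact backbone_congr h hy fun hs => hv (suffix_of_suffix_cons hs hyi)

lemma backboneChildren_congr {y : Vertex} {ω ω' : Env} (h : AgreeOff y ω ω')
    (hy : y ∈ backbone ω ↔ y ∈ backbone ω') {v : Vertex} (hv : ¬ y <:+ v) :
    backboneChildren ω v = backboneChildren ω' v := by
  simp only [backboneChildren, h v hv]
  exact List.filter_congr fun i _ => decide_eq_decide.2 (backbone_congr' h hy hv i)

lemma backboneChildren_append {ω : Env} {y : Vertex} (hy : InTree ω y) (v : Vertex) :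
    backboneChildren ω (v ++ y) = backboneChildren (sub ω y) v := by
  have (i : ℕ) : i :: (v ++ y) ∈ backbone ω ↔ i :: v ∈ backbone (sub ω y) := by
    rw [← List.cons_append, append_mem_backbone]; simp [hy]
  exact List.filter_congr fun i _ => decide_eq_decide.2 (this i)

lemma buds_congr {y : Vertex} {ω ω' : Env} (h : AgreeOff y ω ω')
    (hy : y ∈ backbone ω ↔ y ∈ backbone ω') {v : Vertex} (hv : ¬ y <:+ v) :
    buds ω v = buds ω' v := by
  simp only [buds, h v hv]
  exact List.filter_congr fun i _ => decide_eq_decide.2 (not_congr (backbone_congr' h hy hv i))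

lemma buds_append {ω : Env} {y : Vertex} (hy : InTree ω y) (v : Vertex) :
    buds ω (v ++ y) = buds (sub ω y) v := by
  have (i : ℕ) : i :: (v ++ y) ∈ backbone ω ↔ i :: v ∈ backbone (sub ω y) := by
    rw [← List.cons_append, append_mem_backbone]; simp [hy]
  exact List.filter_congr fun i _ => decide_eq_decide.2 (not_congr (this i))

lemma mem_buds {ω : Env} {x : Vertex} {i : ℕ} :
    i ∈ buds ω x ↔ i < ω x ∧ i :: x ∉ backbone ω := by
  simp [buds]

lemma mem_backboneChildren {ω : Env} {x : Vertex} {i : ℕ} :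
    i ∈ backboneChildren ω x ↔ i < ω x ∧ i :: x ∈ backbone ω := by
  simp [backboneChildren]

lemma mem_backboneChildren' {ω : Env} {x : Vertex} {i : ℕ} :
    i ∈ backboneChildren ω x ↔ i :: x ∈ backbone ω := by
  rw [mem_backboneChildren]
  exact ⟨fun h => h.2, fun h => ⟨h.1.2, h⟩⟩

lemma length_buds_add (ω : Env) (x : Vertex) :
    (backboneChildren ω x).length + (buds ω x).length = ω x := by
  classical
  have h := List.length_eq_length_filter_add (l := List.range (ω x))
    (fun i => decide (i :: x ∈ backbone ω))
  simp only [List.length_range] at h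
  rw [backboneChildren, buds]
  convert h.symm using 3
  ext; simp

/-- A vertex of the backbone has a child in the backbone, as its number of children is finite. -/
lemma backboneChildren_length_pos {ω : Env} {x : Vertex} (hx : x ∈ backbone ω) :
    0 < (backboneChildren ω x).length := by
  rw [List.length_pos_iff_exists_mem]
  by_contra hno
  push Not at hno
  refine hx.2 ?_
  have hsub : subtree ω x ⊆ {x} ∪ ⋃ i ∈ Finset.range (ω x), subtree ω (i :: x) := by
    rintro w ⟨hw, a, rfl⟩
    rcases List.eq_nil_or_concat' a with rfl | ⟨b, i, rfl⟩
    · simp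
    · right
      simp only [Set.mem_iUnion]
      have hs : (i :: x) <:+ (b ++ [i] ++ x) := ⟨b, by simp⟩
      exact ⟨i, Finset.mem_range.2 (hw.of_suffix hs).2, hw, hs⟩
  refine Set.Finite.subset ((Set.finite_singleton x).union
    (Set.Finite.biUnion (Finset.finite_toSet _) fun i hi => ?_)) hsub
  by_contra hinf
  refine hno i (mem_backboneChildren'.2 ⟨⟨hx.1, by simpa using hi⟩, hinf⟩)

/-! ### Traps -/

lemma subtree_congr {y z : Vertex} {ω ω' : Env} (h : AgreeOff y ω ω') (h1 : ¬ y <:+ z)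
    (h2 : ¬ z <:+ y) : subtree ω z = subtree ω' z := by
  ext w
  simp only [subtree, Set.mem_ofPred_eq]
  refine and_congr_left fun hw => inTree_congr h (Or.inl fun hy => ?_)
  rcases suffix_total hw hy with h | h
  · exact h2 h
  · exact h1 h

lemma trapHeight_congr {y z : Vertex} {ω ω' : Env} (h : AgreeOff y ω ω') (h1 : ¬ y <:+ z)
    (h2 : ¬ z <:+ y) : trapHeight ω z = trapHeight ω' z := by
  simp only [trapHeight, subtree_congr h h1 h2]

/-- The height of the whole tree. -/
def height (ω : Env) : ℕ := sSup {d | ∃ w, InTree ω w ∧ w.length = d}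

lemma trapHeight_eq {ω : Env} {y : Vertex} (hy : InTree ω y) :
    trapHeight ω y = height (sub ω y) := by
  have h := subtree_append hy []
  simp only [List.nil_append] at h
  unfold trapHeight height
  rw [h]
  congr 1
  ext d
  constructor
  · rintro ⟨_, ⟨w, hw, rfl⟩, hd⟩
    refine ⟨w, hw.1, ?_⟩
    simp at hd; omega
  · rintro ⟨w, hw, hd⟩
    exact ⟨_, ⟨w, ⟨hw, List.nil_suffix⟩, rfl⟩, by simp; omega⟩

lemma trapHeight_append {ω : Env} {y : Vertex} (v : Vertex) (hv : InTree ω (v ++ y)) :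
    trapHeight ω (v ++ y) = trapHeight (sub ω y) v := by
  rw [trapHeight_eq hv, trapHeight_eq ((inTree_append ω v y).1 hv).2, sub_sub]

lemma bigBuds_append {ω : Env} {y : Vertex} {v : Vertex} (hv : InTree ω (v ++ y)) (h : ℕ) :
    bigBuds ω h (v ++ y) = bigBuds (sub ω y) h v := by
  ext i
  simp only [bigBuds, Set.mem_ofPred_eq]
  rw [buds_append ((inTree_append ω v y).1 hv).1]
  refine and_congr_right fun hi => ?_
  rw [← List.cons_append, trapHeight_append]
  exact ⟨hv, (mem_buds.1 hi).1⟩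

/-- Outside the descendants of a backbone vertex `y` the traps depend on the environment there. -/
lemma bigBuds_congr {y : Vertex} {ω ω' : Env} (h : AgreeOff y ω ω') (hy : y ∈ backbone ω)
    (hy' : y ∈ backbone ω') {v : Vertex} (hv : ¬ y <:+ v) (n : ℕ) :
    bigBuds ω n v = bigBuds ω' n v := by
  ext i
  simp only [bigBuds, Set.mem_ofPred_eq]
  rw [buds_congr h (iff_of_true hy hy') hv]
  refine and_congr_right fun hi => ?_
  have hb : i :: v ∉ backbone ω' := (mem_buds.1 hi).2
  have hne : y ≠ i :: v := fun e => hb (e ▸ hy')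
  rw [trapHeight_congr h]
  · exact fun hs => hv (suffix_of_suffix_cons hs hne)
  · exact fun hs => hb (mem_backbone_of_suffix hy' hs)

/-- Changing the tree above a child `j` of the backbone vertex `y` that stays outside the backbone
changes no other trap. -/
lemma mem_bigBuds_congr {y : Vertex} {j : ℕ} {ω ω' : Env} (h : AgreeOff (j :: y) ω ω')
    (hy : y ∈ backbone ω) (hj : j :: y ∉ backbone ω) (hj' : j :: y ∉ backbone ω')
    {v : Vertex} (hv : ¬ (j :: y) <:+ v) {i : ℕ} (hi : i :: v ≠ j :: y) (n : ℕ) :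
    i ∈ bigBuds ω n v ↔ i ∈ bigBuds ω' n v := by
  simp only [bigBuds, Set.mem_ofPred_eq]
  rw [← buds_congr h (iff_of_false hj hj') hv]
  refine and_congr_right fun hib => ?_
  have hb : i :: v ∉ backbone ω := (mem_buds.1 hib).2
  rw [trapHeight_congr h]
  · exact fun hs => hv (suffix_of_suffix_cons hs hi.symm)
  · exact fun hs => hb (mem_backbone_of_suffix hy (suffix_of_suffix_cons hs hi))

/-! ### Measurability -/

instance : MeasurableSpace Vertex := ⊤

instance : DiscreteMeasurableSpace Vertex := ⟨fun _ => trivial⟩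

lemma measurableSet_exists {α ι : Type*} [MeasurableSpace α] [Countable ι] {P : ι → α → Prop}
    (h : ∀ i, MeasurableSet {a | P i a}) : MeasurableSet {a | ∃ i, P i a} := by
  rw [Set.ofPred_exists]
  exact MeasurableSet.iUnion h

lemma measurableSet_forall {α : Type*} {ι : Sort*} [MeasurableSpace α] [Countable ι]
    {P : ι → α → Prop} (h : ∀ i, MeasurableSet {a | P i a}) : MeasurableSet {a | ∀ i, P i a} := by
  rw [Set.ofPred_forall]
  exact MeasurableSet.iInter h

lemma measurableSet_and {α : Type*} [MeasurableSpace α] {P Q : α → Prop}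
    (hP : MeasurableSet {a | P a}) (hQ : MeasurableSet {a | Q a}) :
    MeasurableSet {a | P a ∧ Q a} := hP.inter hQ

lemma measurableSet_not {α : Type*} [MeasurableSpace α] {P : α → Prop}
    (hP : MeasurableSet {a | P a}) : MeasurableSet {a | ¬ P a} := hP.compl

lemma measurable_apply_countable {α ι β : Type*} [MeasurableSpace α] [MeasurableSpace β]
    [MeasurableSpace ι] [Countable ι] [DiscreteMeasurableSpace ι] {f : α → ι → β}
    (hf : ∀ i, Measurable fun a => f a i) {g : α → ι} (hg : Measurable g) :
    Measurable fun a => f a (g a) := by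
  have : Measurable fun z : α × ι => f z.1 z.2 := measurable_from_prod_countable_left hf
  exact this.comp (measurable_id.prodMk hg)

lemma measurableSet_infinite {α ι : Type*} [MeasurableSpace α] [Countable ι] {P : α → ι → Prop}
    (hP : ∀ i, MeasurableSet {a | P a i}) : MeasurableSet {a | {i | P a i}.Infinite} := by
  have : {a | {i | P a i}.Infinite} = ⋂ F : Finset ι, ⋃ i : ι, {a | i ∉ F ∧ P a i} := by
    ext a
    simp only [Set.mem_ofPred_eq, Set.mem_iInter, Set.mem_iUnion]
    constructor
    · intro h F
      obtain ⟨i, hi, hF⟩ := h.exists_notMem_finset F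
      exact ⟨i, hF, hi⟩
    · intro h hfin
      obtain ⟨i, hi, hP⟩ := h hfin.toFinset
      exact hi (by simpa using hP)
  rw [this]
  refine MeasurableSet.iInter fun F => MeasurableSet.iUnion fun i => ?_
  by_cases hi : i ∈ F
  · simp [hi]
  · simpa [hi] using hP i

lemma measurable_ncard {α : Type*} [MeasurableSpace α] {P : α → ℕ → Prop}
    (hP : ∀ i, MeasurableSet {a | P a i}) : Measurable fun a => {i | P a i}.ncard := by
  classical
  have hc : ∀ m, Measurable fun a => ((Finset.range m).filter fun i => P a i).card := by
    intro m
    simp only [Finset.card_filter]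
    exact Finset.measurable_sum _ fun i _ => Measurable.ite (hP i) measurable_const measurable_const
  have hfin : ∀ a, {i | P a i}.Finite →
      ∃ m0, ∀ m, m0 ≤ m → ((Finset.range m).filter fun i => P a i).card = {i | P a i}.ncard := by
    intro a hf
    obtain ⟨b, hb⟩ := hf.bddAbove
    refine ⟨b + 1, fun m hm => ?_⟩
    rw [← Set.ncard_coe_finset]
    congr 1
    ext i
    simp only [Finset.coe_filter, Finset.mem_range, Set.mem_ofPred_eq, and_iff_right_iff_imp]
    intro hi
    have := hb hi
    omega
  refine measurable_to_countable' fun n => ?_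
  have hset : (fun a => {i | P a i}.ncard) ⁻¹' {n} =
      ({a | {i | P a i}.Infinite}ᶜ ∩
        {a | ∃ m0, ∀ m, m0 ≤ m → ((Finset.range m).filter fun i => P a i).card = n}) ∪
      ({a | {i | P a i}.Infinite} ∩ {_a | n = 0}) := by
    ext a
    simp only [Set.mem_preimage, Set.mem_singleton_iff, Set.mem_union, Set.mem_inter_iff,
      Set.mem_compl_iff, Set.mem_ofPred_eq]
    by_cases hf : {i | P a i}.Infinite
    · simp [hf, hf.ncard, eq_comm]
    · simp only [hf, not_false_eq_true, true_and, false_and, or_false]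
      obtain ⟨m0, h0⟩ := hfin a (Set.not_infinite.1 hf)
      constructor
      · intro h
        exact ⟨m0, fun m hm => (h0 m hm).trans h⟩
      · rintro ⟨m1, h1⟩
        rw [← h0 (max m0 m1) (le_max_left _ _), h1 _ (le_max_right _ _)]
  rw [hset]
  refine MeasurableSet.union (MeasurableSet.inter (measurableSet_infinite hP).compl ?_)
    ((measurableSet_infinite hP).inter (MeasurableSet.const _))
  exact measurableSet_exists fun m0 => measurableSet_forall fun m => measurableSet_forall fun _ =>
    hc m (measurableSet_singleton n)

lemma measurableSet_inTree (v : Vertex) : MeasurableSet {ω : Env | InTree ω v} := by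
  induction v with
  | nil => simp [InTree]
  | cons i v ih =>
    exact ih.inter (measurableSet_lt measurable_const (measurable_pi_apply v))

lemma measurableSet_mem_backbone (v : Vertex) : MeasurableSet {ω : Env | v ∈ backbone ω} := by
  refine (measurableSet_inTree v).inter (measurableSet_infinite fun w => ?_)
  exact (measurableSet_inTree w).inter (MeasurableSet.const _)

lemma measurableSet_survival : MeasurableSet survival := by
  convert measurableSet_mem_backbone [] using 1
  ext ω; exact nil_mem_backbone.symm

open Classical in
lemma measurable_filter_range {P : Env → ℕ → Prop} (hP : ∀ i, MeasurableSet {ω | P ω i})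
    (x : Vertex) : Measurable fun ω : Env => (List.range (ω x)).filter fun i => P ω i := by
  have h : ∀ l : List ℕ, Measurable fun ω : Env => l.filter fun i => P ω i := by
    intro l
    induction l with
    | nil => simp
    | cons a l ih =>
      simp only [List.filter_cons, decide_eq_true_eq]
      exact Measurable.ite (hP a)
        ((Measurable.of_discrete (f := fun l : Vertex => (a :: l : Vertex))).comp ih) ih
  exact measurable_apply_countable (f := fun ω n => (List.range n).filter fun i => P ω i)
    (fun n => h _) (measurable_pi_apply x)

lemma measurable_backboneChildren (x : Vertex) :
    Measurable fun ω : Env => (backboneChildren ω x : Vertex) :=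
  measurable_filter_range (fun i => measurableSet_mem_backbone (i :: x)) x

lemma measurable_buds (x : Vertex) : Measurable fun ω : Env => (buds ω x : Vertex) := by
  have h := measurable_filter_range
    (fun i => measurableSet_not (measurableSet_mem_backbone (i :: x))) x
  unfold buds
  convert h

/-! ### Galton-Watson trees: extinction -/

/-- The finite trees of height at least `h`. -/
def tall (h : ℕ) : Set Env := {ω | ω ∉ survival ∧ ∃ v, InTree ω v ∧ h ≤ v.length}

lemma measurableSet_tall (h : ℕ) : MeasurableSet (tall h) := by
  exact measurableSet_and measurableSet_survival.compl (measurableSet_exists fun v =>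
    measurableSet_and (measurableSet_inTree v) (MeasurableSet.const _))

lemma tall_antitone : Antitone tall := fun _ _ hab _ hω =>
  ⟨hω.1, hω.2.imp fun _ hv => ⟨hv.1, hab.trans hv.2⟩⟩

lemma finite_lengths {ω : Env} (hω : ω ∉ survival) : {d | ∃ w, InTree ω w ∧ w.length = d}.Finite :=
  (Set.not_infinite.1 hω).image List.length

lemma mem_tall_iff {ω : Env} {h : ℕ} (hω : ω ∉ survival) : ω ∈ tall h ↔ h ≤ height ω := by
  have hne : {d | ∃ w, InTree ω w ∧ w.length = d}.Nonempty := ⟨0, [], trivial, rfl⟩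
  constructor
  · rintro ⟨-, v, hv, hl⟩
    exact hl.trans (le_csSup (finite_lengths hω).bddAbove ⟨v, hv, rfl⟩)
  · intro hh
    obtain ⟨w, hw, hl⟩ := Nat.sSup_mem hne (finite_lengths hω).bddAbove
    exact ⟨hω, w, hw, hh.trans hl.ge⟩

lemma mem_bigBuds_iff {ω : Env} {x : Vertex} (hx : InTree ω x) {h i : ℕ} :
    i ∈ bigBuds ω h x ↔ i < ω x ∧ sub ω (i :: x) ∈ tall h := by
  simp only [bigBuds, Set.mem_ofPred_eq, mem_buds, mem_backbone_iff]
  constructor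
  · rintro ⟨⟨h1, h2⟩, h3⟩
    have hT : InTree ω (i :: x) := ⟨hx, h1⟩
    rw [trapHeight_eq hT] at h3
    have h4 : sub ω (i :: x) ∉ survival := fun h4 => h2 ⟨hT, h4⟩
    exact ⟨h1, (mem_tall_iff h4).2 h3⟩
  · rintro ⟨h1, h2⟩
    have hT : InTree ω (i :: x) := ⟨hx, h1⟩
    rw [trapHeight_eq hT]
    exact ⟨⟨h1, fun h4 => h2.1 h4.2⟩, (mem_tall_iff h2.1).1 h2⟩

/-- Independence of the tree of the descendants of `y` and of the rest of the environment. -/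
theorem lintegral_offspringLaw_mul_sub (p : PMF ℕ) (y : Vertex) {f g : Env → ENNReal}
    (hf : Measurable f) (hg : Measurable g) (hfy : ∀ ω η, f (graft y ω η) = f ω) :
    ∫⁻ ω, f ω * g (sub ω y) ∂offspringLaw p =
      (∫⁻ ω, f ω ∂offspringLaw p) * ∫⁻ ω, g ω ∂offspringLaw p := by
  rw [lintegral_offspringLaw_graft p y (f := fun ω => f ω * g (sub ω y))
    (hf.mul (hg.comp (measurable_sub y)))]
  simp only [hfy, sub_graft]
  rw [lintegral_congr fun ω => lintegral_const_mul _ hg, lintegral_mul_const _ hf]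

theorem offspringLaw_outside_inter_sub (p : PMF ℕ) (y : Vertex) {A B : Set Env}
    (hA : MeasurableSet A) (hB : MeasurableSet B) (hAy : ∀ ω η, graft y ω η ∈ A ↔ ω ∈ A) :
    offspringLaw p (A ∩ (fun ω => sub ω y) ⁻¹' B) = offspringLaw p A * offspringLaw p B := by
  have h := lintegral_offspringLaw_mul_sub p y (measurable_one.indicator hA)
    (measurable_one.indicator hB) (fun ω η => by
      by_cases h : ω ∈ A
      · simp [h, (hAy ω η).2 h]
      · simp [h, mt (hAy ω η).1 h])
  rw [lintegral_indicator_one hA, lintegral_indicator_one hB] at h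
  rw [← h, ← lintegral_indicator_one (hA.inter (measurable_sub y hB))]
  refine lintegral_congr fun ω => ?_
  by_cases h1 : ω ∈ A <;> by_cases h2 : sub ω y ∈ B <;> simp [h1, h2]

lemma measurableSet_root (k : ℕ) : MeasurableSet {ω : Env | ω [] = k} :=
  measurableSet_eq_fun (measurable_pi_apply []) measurable_const

/-- The children of the root carry independent trees. -/
theorem offspringLaw_branching (p : PMF ℕ) (k : ℕ) {A : ℕ → Set Env}
    (hA : ∀ i, MeasurableSet (A i)) (j : ℕ) :
    offspringLaw p {ω | ω [] = k ∧ ∀ i < j, sub ω [i] ∈ A i} =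
      p k * ∏ i ∈ Finset.range j, offspringLaw p (A i) := by
  induction j with
  | zero =>
    have h : {ω : Env | ω [] = k ∧ ∀ i < 0, sub ω [i] ∈ A i} =
        (Function.eval [] : Env → ℕ) ⁻¹' ({k} : Set ℕ) := by
      ext ω; simp
    rw [h, offspringLaw, (measurePreserving_eval_infinitePi _ []).measure_preimage
      (measurableSet_singleton k).nullMeasurableSet]
    simp [PMF.toMeasure_apply_singleton]
  | succ j ih =>
    have hset : {ω : Env | ω [] = k ∧ ∀ i < j + 1, sub ω [i] ∈ A i} =
        {ω | ω [] = k ∧ ∀ i < j, sub ω [i] ∈ A i} ∩ (fun ω => sub ω [j]) ⁻¹' A j := by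
      ext ω
      simp only [Set.mem_inter_iff, Set.mem_ofPred_eq, Set.mem_preimage, Nat.forall_lt_succ_right,
        and_assoc]
    rw [hset, offspringLaw_outside_inter_sub p [j] _ (hA j), ih, Finset.prod_range_succ, mul_assoc]
    · intro ω η
      have h1 : graft [j] ω η [] = ω [] := graft_of_not_suffix (by simp) ω η
      have h2 : ∀ i < j, sub (graft [j] ω η) [i] = sub ω [i] := by
        intro i hi
        ext v
        refine graft_of_not_suffix (fun hs => ?_) ω η
        rcases suffix_total hs (List.suffix_append v [i]) with h | h
        · have := h.eq_of_length rfl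
          simp at this
          omega
        · have := h.eq_of_length rfl
          simp at this
          omega
      change (_ = k ∧ ∀ i < j, _ ∈ _) ↔ (_ = k ∧ ∀ i < j, _ ∈ _)
      rw [h1]
      exact and_congr_right fun _ => forall₂_congr fun i hi => by rw [h2 i hi]
    · exact measurableSet_and (measurableSet_root k) (measurableSet_forall fun i =>
        measurableSet_forall fun _ => measurable_sub [i] (hA i))

lemma offspringLaw_all_children (p : PMF ℕ) {A : Set Env} (hA : MeasurableSet A) :
    offspringLaw p {ω | ∀ i < ω [], sub ω [i] ∈ A} = ∑' k, p k * offspringLaw p A ^ k := by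
  have hset : {ω : Env | ∀ i < ω [], sub ω [i] ∈ A} =
      ⋃ k, {ω : Env | ω [] = k ∧ ∀ i < k, sub ω [i] ∈ A} := by
    ext ω; simp
  rw [hset, measure_iUnion]
  · refine tsum_congr fun k => ?_
    rw [offspringLaw_branching p k (fun _ => hA) k]
    simp
  · intro k l hkl
    refine Set.disjoint_left.2 ?_
    rintro ω ⟨h1, -⟩ ⟨h2, -⟩
    exact hkl (h1.symm.trans h2)
  · intro k
    exact measurableSet_and (measurableSet_root k) (measurableSet_forall fun i =>
      measurableSet_forall fun _ => measurable_sub [i] hA)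

lemma not_survival_iff {ω : Env} : ω ∉ survival ↔ ∀ i < ω [], sub ω [i] ∉ survival := by
  constructor
  · intro h i hi hs
    have : [i] ∈ backbone ω := mem_backbone_iff.2 ⟨⟨trivial, hi⟩, hs⟩
    exact h (nil_mem_backbone.1 (backbone_of_cons this))
  · intro h hs
    obtain ⟨i, hi⟩ := List.length_pos_iff_exists_mem.1
      (backboneChildren_length_pos (nil_mem_backbone.2 hs))
    have hi := mem_backboneChildren.1 hi
    exact h i hi.1 (mem_backbone_iff.1 hi.2).2

/-- By the branching property, the extinction probability is a fixed point of the generating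
function. -/
lemma offspringLaw_extinct_fixed (p : PMF ℕ) :
    offspringLaw p survivalᶜ = ∑' k, p k * offspringLaw p survivalᶜ ^ k := by
  rw [← offspringLaw_all_children p measurableSet_survival.compl]
  congr 1
  ext ω
  exact not_survival_iff

/-- The trees without vertices at level `n`. -/
def extinctBy (n : ℕ) : Set Env := {ω | ∀ v, InTree ω v → v.length < n}

lemma measurableSet_extinctBy (n : ℕ) : MeasurableSet (extinctBy n) := by
  have : extinctBy n = ⋂ v : Vertex, {ω | InTree ω v}ᶜ ∪ {_ω | v.length < n} := by
    ext ω; simp [extinctBy, imp_iff_not_or]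
  rw [this]
  exact MeasurableSet.iInter fun v => (measurableSet_inTree v).compl.union (MeasurableSet.const _)

lemma extinctBy_succ (n : ℕ) :
    extinctBy (n + 1) = {ω | ∀ i < ω [], sub ω [i] ∈ extinctBy n} := by
  ext ω
  simp only [extinctBy, Set.mem_ofPred_eq]
  constructor
  · intro h i hi v hv
    have := h (v ++ [i]) ((inTree_append ω v [i]).2 ⟨⟨trivial, hi⟩, hv⟩)
    simp at this
    omega
  · intro h v hv
    rcases List.eq_nil_or_concat' v with rfl | ⟨w, i, rfl⟩
    · simp
    · have hw := (inTree_append ω w [i]).1 hv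
      have := h i hw.1.2 w hw.2
      simp
      omega

lemma extinct_eq_iUnion : survivalᶜ = ⋃ n, extinctBy n := by
  ext ω
  simp only [Set.mem_compl_iff, Set.mem_iUnion]
  constructor
  · intro h
    obtain ⟨b, hb⟩ := (finite_lengths h).bddAbove
    exact ⟨b + 1, fun v hv => Nat.lt_succ_of_le (hb ⟨v, hv, rfl⟩)⟩
  · rintro ⟨n, hn⟩
    induction n generalizing ω with
    | zero => exact absurd (hn [] trivial) (by simp)
    | succ n ih =>
      have h2 : ω ∈ extinctBy (n + 1) := hn
      rw [extinctBy_succ] at h2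
      exact not_survival_iff.2 fun i hi => ih _ (h2 i hi)

lemma extinctBy_mono : Monotone extinctBy := fun _ _ h _ hω v hv => (hω v hv).trans_le h

/-- The extinction probability is at most every `r` with `𝐟(r) ≤ r`. -/
lemma offspringLaw_extinct_le (p : PMF ℕ) {r : ENNReal} (hr : ∑' k, p k * r ^ k ≤ r) :
    offspringLaw p survivalᶜ ≤ r := by
  have h : ∀ n, offspringLaw p (extinctBy n) ≤ r := by
    intro n
    induction n with
    | zero =>
      have : extinctBy 0 = ∅ := by
        ext ω
        simp only [Set.mem_empty_iff_false, iff_false]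
        exact fun h => absurd (h [] trivial) (by simp)
      simp [this]
    | succ n ih =>
      rw [extinctBy_succ, offspringLaw_all_children p (measurableSet_extinctBy n)]
      refine le_trans (ENNReal.tsum_le_tsum fun k => ?_) hr
      gcongr
  rw [extinct_eq_iUnion, extinctBy_mono.measure_iUnion]
  exact iSup_le h

/-! ### The offspring law and its generating function -/

section Offspring

variable (p : PMF ℕ)

lemma summable_pmf : Summable fun k => (p k).toReal :=
  ENNReal.summable_toReal (by simp [p.tsum_coe])

lemma tsum_pmf : ∑' k, (p k).toReal = 1 := by
  rw [← ENNReal.tsum_toReal_eq (fun k => p.apply_ne_top k), p.tsum_coe]; simp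

lemma summable_genFun {z : ℝ} (h0 : 0 ≤ z) (h1 : z ≤ 1) :
    Summable fun k => (p k).toReal * z ^ k :=
  (summable_pmf p).of_nonneg_of_le (fun _ => by positivity)
    fun k => mul_le_of_le_one_right (by positivity) (pow_le_one₀ h0 h1)

lemma tsum_pmf_mul_pow {z : ENNReal} (hz : z ≤ 1) :
    ∑' k, p k * z ^ k = ENNReal.ofReal (genFun p z.toReal) := by
  have hzt : z ≠ ⊤ := (hz.trans_lt ENNReal.one_lt_top).ne
  have h1 : z.toReal ≤ 1 := by simpa using ENNReal.toReal_mono ENNReal.one_ne_top hz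
  rw [genFun, ENNReal.ofReal_tsum_of_nonneg (fun k => by positivity)
    (summable_genFun p ENNReal.toReal_nonneg h1)]
  refine tsum_congr fun k => ?_
  rw [ENNReal.ofReal_mul (by positivity), ENNReal.ofReal_pow (by positivity),
    ENNReal.ofReal_toReal (p.apply_ne_top k), ENNReal.ofReal_toReal hzt]

lemma extinctionProb_nonneg : 0 ≤ extinctionProb p := measureReal_nonneg

lemma extinctionProb_le_one : extinctionProb p ≤ 1 := measureReal_le_one

lemma genFun_extinctionProb : genFun p (extinctionProb p) = extinctionProb p := by
  have h := offspringLaw_extinct_fixed p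
  rw [tsum_pmf_mul_pow p prob_le_one] at h
  have h2 := congrArg ENNReal.toReal h
  rw [ENNReal.toReal_ofReal (by unfold genFun; exact tsum_nonneg fun k => by positivity)] at h2
  exact h2.symm

lemma extinctionProb_pos (hp0 : p 0 ≠ 0) : 0 < extinctionProb p := by
  rw [← genFun_extinctionProb]
  refine (summable_genFun p (extinctionProb_nonneg p) (extinctionProb_le_one p)).tsum_pos
    (fun k => by have := extinctionProb_nonneg p; positivity) 0 ?_
  simp [ENNReal.toReal_pos hp0 (p.apply_ne_top 0)]

variable (hm : 1 < ∑' k : ℕ, (k : ℝ) * (p k).toReal)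
include hm

lemma summable_mean : Summable fun k : ℕ => (k : ℝ) * (p k).toReal := by
  by_contra h
  rw [tsum_eq_zero_of_not_summable h] at hm
  linarith

/-- Supercriticality: near `1` the generating function lies below the diagonal. -/
lemma exists_genFun_le : ∃ r : ℝ, 0 < r ∧ r < 1 ∧ genFun p r ≤ r := by
  obtain ⟨s, hs⟩ := ((summable_mean p hm).hasSum.eventually (lt_mem_nhds hm)).exists
  have hcont : Continuous fun r : ℝ => ∑ k ∈ s, (p k).toReal * ∑ j ∈ Finset.range k, r ^ j := by
    fun_prop
  have h1 : 1 < ∑ k ∈ s, (p k).toReal * ∑ j ∈ Finset.range k, (1 : ℝ) ^ j := by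
    simpa [mul_comm] using hs
  have hev : ∀ᶠ r in 𝓝[<] (1 : ℝ), 0 < r ∧ r < 1 ∧
      1 < ∑ k ∈ s, (p k).toReal * ∑ j ∈ Finset.range k, r ^ j := by
    have h2 : ∀ᶠ r in 𝓝[<] (1 : ℝ), 0 < r :=
      eventually_nhdsWithin_of_eventually_nhds (lt_mem_nhds one_pos)
    have h3 : ∀ᶠ r in 𝓝[<] (1 : ℝ), r < 1 := self_mem_nhdsWithin
    have h4 := eventually_nhdsWithin_of_eventually_nhds (s := Set.Iio (1 : ℝ))
      (hcont.continuousAt.eventually (lt_mem_nhds h1))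
    filter_upwards [h2, h3, h4] with r a b c using ⟨a, b, c⟩
  obtain ⟨r, hr0, hr1, hr⟩ := hev.exists
  refine ⟨r, hr0, hr1, ?_⟩
  have hsum := summable_genFun p hr0.le hr1.le
  have h5 : ∑ k ∈ s, ((p k).toReal - (p k).toReal * r ^ k) ≤ 1 - genFun p r := by
    rw [← tsum_pmf p, genFun, ← (summable_pmf p).tsum_sub hsum]
    refine ((summable_pmf p).sub hsum).sum_le_tsum s fun k _ => ?_
    have : (p k).toReal * r ^ k ≤ (p k).toReal :=
      mul_le_of_le_one_right (by positivity) (pow_le_one₀ hr0.le hr1.le)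
    linarith
  have h6 : ∑ k ∈ s, ((p k).toReal - (p k).toReal * r ^ k) =
      (1 - r) * ∑ k ∈ s, (p k).toReal * ∑ j ∈ Finset.range k, r ^ j := by
    rw [Finset.mul_sum]
    refine Finset.sum_congr rfl fun k _ => ?_
    have := mul_neg_geom_sum r k
    linear_combination -(p k).toReal * this
  nlinarith

lemma extinctionProb_lt_one : extinctionProb p < 1 := by
  obtain ⟨r, hr0, hr1, hr⟩ := exists_genFun_le p hm
  have h1 : ENNReal.ofReal r ≤ 1 := by simpa using hr1.le
  have h := offspringLaw_extinct_le p (r := ENNReal.ofReal r) (by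
    rw [tsum_pmf_mul_pow p h1, ENNReal.toReal_ofReal hr0.le]
    exact ENNReal.ofReal_le_ofReal hr)
  have h2 := ENNReal.toReal_mono ENNReal.ofReal_ne_top h
  rw [ENNReal.toReal_ofReal hr0.le] at h2
  exact lt_of_le_of_lt h2 hr1

lemma exists_two_le : ∃ k, 2 ≤ k ∧ 0 < (p k).toReal := by
  by_contra hno
  push Not at hno
  have h : ∑' k : ℕ, (k : ℝ) * (p k).toReal ≤ ∑' k, (p k).toReal := by
    refine (summable_mean p hm).tsum_le_tsum (fun k => ?_) (summable_pmf p)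
    rcases Nat.lt_or_ge k 2 with hk | hk
    · have : (k : ℝ) ≤ 1 := by exact_mod_cast Nat.le_of_lt_succ hk
      exact mul_le_of_le_one_left (by positivity) this
    · have := le_antisymm (hno k hk) ENNReal.toReal_nonneg
      simp [this]
  rw [tsum_pmf] at h
  linarith

lemma hasDerivAt_genFun {z : ℝ} (h0 : -1 < z) (h1 : z < 1) :
    HasDerivAt (genFun p) (∑' k : ℕ, (p k).toReal * (k * z ^ (k - 1))) z := by
  refine hasDerivAt_tsum_of_isPreconnected (summable_mean p hm) (t := Set.Ioo (-1 : ℝ) 1)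
    isOpen_Ioo isPreconnected_Ioo (g := fun k z => (p k).toReal * z ^ k)
    (fun k y _ => (hasDerivAt_pow k y).const_mul _) (fun k y hy => ?_)
    (y₀ := 0) (by simp) (summable_genFun p le_rfl zero_le_one) ⟨h0, h1⟩
  rw [Real.norm_eq_abs, abs_mul, abs_mul, abs_pow, abs_of_nonneg ENNReal.toReal_nonneg,
    abs_of_nonneg (Nat.cast_nonneg k), mul_comm]
  refine mul_le_mul_of_nonneg_right (mul_le_of_le_one_right (by positivity) ?_) (by positivity)
  exact pow_le_one₀ (abs_nonneg y) (abs_le.2 ⟨hy.1.le, hy.2.le⟩)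

lemma derivAtExtinction_eq :
    derivAtExtinction p = ∑' k : ℕ, (p k).toReal * (k * extinctionProb p ^ (k - 1)) :=
  (hasDerivAt_genFun p hm (by linarith [extinctionProb_nonneg p])
    (extinctionProb_lt_one p hm)).deriv

lemma summable_deriv :
    Summable fun k : ℕ => (p k).toReal * (k * extinctionProb p ^ (k - 1)) := by
  have h0 := extinctionProb_nonneg p
  refine (summable_mean p hm).of_nonneg_of_le (fun k => by positivity) fun k => ?_
  rw [mul_comm]
  exact mul_le_mul_of_nonneg_right (mul_le_of_le_one_right (by positivity)
    (pow_le_one₀ h0 (extinctionProb_le_one p))) (by positivity)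

lemma derivAtExtinction_pos (hp0 : p 0 ≠ 0) : 0 < derivAtExtinction p := by
  have h0 := extinctionProb_pos p hp0
  obtain ⟨k, hk, hpk⟩ := exists_two_le p hm
  rw [derivAtExtinction_eq p hm]
  refine (summable_deriv p hm).tsum_pos (fun k => by positivity) k ?_
  positivity

/-- `𝐟'(q) < 1`, by strict convexity of `𝐟` between its fixed points `q` and `1`. -/
lemma derivAtExtinction_lt_one : derivAtExtinction p < 1 := by
  have h0 := extinctionProb_nonneg p
  have h1 := extinctionProb_lt_one p hm
  set q := extinctionProb p with hq
  have hsum := summable_genFun p h0 h1.le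
  have hle : ∀ k : ℕ, (k : ℝ) * q ^ (k - 1) ≤ ∑ j ∈ Finset.range k, q ^ j := by
    intro k
    have : ∑ j ∈ Finset.range k, q ^ (k - 1) ≤ ∑ j ∈ Finset.range k, q ^ j :=
      Finset.sum_le_sum fun j hj => pow_le_pow_of_le_one h0 h1.le (by
        have := Finset.mem_range.1 hj; omega)
    simpa using this
  have hkey : ∀ k : ℕ, (1 - q) * ((p k).toReal * (k * q ^ (k - 1))) ≤
      (p k).toReal - (p k).toReal * q ^ k := by
    intro k
    have h3 : (p k).toReal - (p k).toReal * q ^ k =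
        (1 - q) * ((p k).toReal * ∑ j ∈ Finset.range k, q ^ j) := by
      have := mul_neg_geom_sum q k
      linear_combination -(p k).toReal * this
    rw [h3]
    refine mul_le_mul_of_nonneg_left (mul_le_mul_of_nonneg_left (hle k) (by positivity)) ?_
    linarith
  obtain ⟨k, hk, hpk⟩ := exists_two_le p hm
  have hlt : (1 - q) * ((p k).toReal * (k * q ^ (k - 1))) <
      (p k).toReal - (p k).toReal * q ^ k := by
    have h3 : (p k).toReal - (p k).toReal * q ^ k =
        (1 - q) * ((p k).toReal * ∑ j ∈ Finset.range k, q ^ j) := by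
      have := mul_neg_geom_sum q k
      linear_combination -(p k).toReal * this
    rw [h3]
    refine mul_lt_mul_of_pos_left (mul_lt_mul_of_pos_left ?_ hpk) (by linarith)
    have : ∑ j ∈ Finset.range k, q ^ (k - 1) < ∑ j ∈ Finset.range k, q ^ j := by
      refine Finset.sum_lt_sum (fun j hj => pow_le_pow_of_le_one h0 h1.le (by
        have := Finset.mem_range.1 hj; omega)) ⟨0, by simp; omega, ?_⟩
      rw [pow_zero]
      exact pow_lt_one₀ h0 h1 (by omega)
    simpa using this
  have hfin := Summable.tsum_lt_tsum hkey hlt ((summable_deriv p hm).mul_left (1 - q))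
    ((summable_pmf p).sub hsum)
  rw [tsum_mul_left, ← derivAtExtinction_eq p hm, (summable_pmf p).tsum_sub hsum, tsum_pmf] at hfin
  have hfix : ∑' k, (p k).toReal * q ^ k = q := genFun_extinctionProb p
  rw [hfix] at hfin
  have : 0 < 1 - q := by linarith
  nlinarith

omit hm in
lemma tendsto_bigHeight (h0 : 0 < derivAtExtinction p) (h1 : derivAtExtinction p < 1) {ε : ℝ}
    (hε : ε < 1) : Tendsto (bigHeight p ε) atTop atTop := by
  have hlog : 0 < -Real.log (derivAtExtinction p) := by
    have := Real.log_neg h0 h1; linarith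
  unfold bigHeight
  refine tendsto_nat_ceil_atTop.comp ?_
  refine Tendsto.atTop_div_const hlog (Tendsto.const_mul_atTop (by linarith) ?_)
  exact Real.tendsto_log_atTop.comp tendsto_natCast_atTop_atTop

lemma offspringLaw_survival_ne_zero : offspringLaw p survival ≠ 0 := by
  intro h
  have h2 := prob_compl_eq_one_sub (μ := offspringLaw p) measurableSet_survival
  rw [h, tsub_zero] at h2
  have h3 := extinctionProb_lt_one p hm
  unfold extinctionProb Measure.real at h3
  rw [h2] at h3
  simp at h3

/-- By induction on `h`: the root has at least two children with positive probability, the first of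
which may carry a high tree while the other trees are finite. -/
lemma offspringLaw_tall_ne_zero (hp0 : p 0 ≠ 0) (h : ℕ) : offspringLaw p (tall h) ≠ 0 := by
  have hq : offspringLaw p survivalᶜ ≠ 0 := by
    intro h0
    have := extinctionProb_pos p hp0
    simp [extinctionProb, Measure.real, h0] at this
  obtain ⟨k, hk, hpk⟩ := exists_two_le p hm
  have hpk' : p k ≠ 0 := fun h0 => by simp [h0] at hpk
  induction h with
  | zero =>
    convert hq using 2
    ext ω
    exact ⟨fun hω => hω.1, fun hω => ⟨hω, [], trivial, by simp⟩⟩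
  | succ h ih =>
    have hb := offspringLaw_branching p k (A := fun i => if i = 0 then tall h else survivalᶜ)
      (fun i => by split_ifs
                   · exact measurableSet_tall h
                   · exact measurableSet_survival.compl) k
    have hpos : p k * ∏ i ∈ Finset.range k,
        offspringLaw p (if i = 0 then tall h else survivalᶜ) ≠ 0 := by
      refine mul_ne_zero hpk' (Finset.prod_ne_zero_iff.2 fun i _ => ?_)
      split_ifs
      · exact ih
      · exact hq
    rw [← hb] at hpos
    refine fun h0 => hpos (measure_mono_null ?_ h0)
    rintro ω ⟨hk', hω⟩
    have h1 := hω 0 (by omega)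
    simp only [if_true] at h1
    obtain ⟨h2, v, hv, hl⟩ := h1
    refine ⟨not_survival_iff.2 fun i hi => ?_, v ++ [0], (inTree_append ω v [0]).2
      ⟨⟨trivial, by omega⟩, hv⟩, by simpa using hl⟩
    have h3 := hω i (by omega)
    by_cases hi0 : i = 0
    · rw [hi0]; exact h2
    · simpa [hi0] using h3

omit hm in
lemma tendsto_offspringLaw_tall :
    Tendsto (fun h => offspringLaw p (tall h)) atTop (𝓝 0) := by
  have h := tendsto_measure_iInter_atTop (μ := offspringLaw p)
    (fun h => (measurableSet_tall h).nullMeasurableSet) tall_antitone ⟨0, measure_ne_top _ _⟩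
  have he : ⋂ h, tall h = ∅ := by
    ext ω
    simp only [Set.mem_iInter, Set.mem_empty_iff_false, iff_false, not_forall]
    by_cases hs : ω ∈ survival
    · exact ⟨0, fun h => h.1 hs⟩
    · obtain ⟨b, hb⟩ := (finite_lengths hs).bddAbove
      refine ⟨b + 1, fun h => ?_⟩
      obtain ⟨-, v, hv, hl⟩ := h
      have := hb ⟨v, hv, rfl⟩
      omega
  rwa [he, measure_empty] at h

/-- The mean number of children of a vertex is finite. -/
lemma lintegral_children_ne_top (y : Vertex) :
    ∫⁻ ω, (ω y : ENNReal) ∂offspringLaw p ≠ ⊤ := by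
  have h := (measurePreserving_eval_infinitePi (fun _ : Vertex => p.toMeasure) y)
  have h1 : ∫⁻ ω, (ω y : ENNReal) ∂offspringLaw p = ∫⁻ n, (n : ENNReal) ∂p.toMeasure :=
    h.lintegral_comp (f := fun n : ℕ => (n : ENNReal)) (Measurable.of_discrete)
  rw [h1, lintegral_countable']
  have h2 : ∀ k : ℕ, (k : ENNReal) * p.toMeasure {k} =
      ENNReal.ofReal ((k : ℝ) * (p k).toReal) := by
    intro k
    rw [p.toMeasure_apply_singleton k (measurableSet_singleton k),
      ENNReal.ofReal_mul (by positivity), ENNReal.ofReal_toReal (p.apply_ne_top k),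
      ENNReal.ofReal_natCast]
  simp_rw [h2]
  rw [← ENNReal.ofReal_tsum_of_nonneg (fun k => by positivity) (summable_mean p hm)]
  exact ENNReal.ofReal_ne_top

end Offspring

/-! ### Super-regeneration times -/

lemma walkZ_congr {β : ℝ} {U U' : ℕ → unitInterval} {n : ℕ} (h : ∀ i < n, U i = U' i) :
    walkZ β U n = walkZ β U' n := by
  induction n with
  | zero => rfl
  | succ n ih =>
    simp only [walkZ, ih fun i hi => h i (by omega), h n (by omega)]

lemma walkZ_concat {β : ℝ} {t s : ℕ} (hs : s ≤ t) (U U' : ℕ → unitInterval) :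
    walkZ β (concat t U U') s = walkZ β U s :=
  walkZ_congr fun i hi => concat_of_lt (by omega) U U'

lemma walkZ_add (β : ℝ) (U : ℕ → unitInterval) (t s : ℕ) :
    walkZ β U (t + s) = walkZ β U t + walkZ β (shift t U) s := by
  induction s with
  | zero => simp [walkZ]
  | succ s ih =>
    have h : (shift t U s : ℝ) = U (t + s) := rfl
    rw [← add_assoc, walkZ, walkZ, ih, h]
    by_cases hd : (U (t + s) : ℝ) ≤ 1 / (β + 1)
    · rw [if_pos hd, if_pos hd]; ring
    · rw [if_neg hd, if_neg hd]; ring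

lemma measurableSet_down (β : ℝ) (i : ℕ) :
    MeasurableSet {U : ℕ → unitInterval | (U i : ℝ) ≤ 1 / (β + 1)} :=
  measurableSet_le (measurable_subtype_coe.comp (measurable_pi_apply i)) measurable_const

lemma measurable_walkZ (β : ℝ) (n : ℕ) : Measurable fun U => walkZ β U n := by
  induction n with
  | zero => exact measurable_const
  | succ n ih =>
    simp only [walkZ]
    exact Measurable.ite (measurableSet_down β n) (ih.sub measurable_const)
      (ih.add measurable_const)

lemma measurableSet_walkZ_lt (β : ℝ) (s t : ℕ) :
    MeasurableSet {U : ℕ → unitInterval | walkZ β U s < walkZ β U t} :=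
  measurableSet_lt (measurable_walkZ β s) (measurable_walkZ β t)

lemma measurableSet_isSuperRegen (β : ℝ) (t : ℕ) :
    MeasurableSet {U : ℕ → unitInterval | IsSuperRegen β U t} :=
  measurableSet_and
    (measurableSet_forall fun s => measurableSet_forall fun _ => measurableSet_walkZ_lt β s t)
    (measurableSet_forall fun s => measurableSet_forall fun _ => measurableSet_walkZ_lt β t s)

/-- The walk on `ℤ` is at time `t` strictly above its past. -/
def IsLadder (β : ℝ) (U : ℕ → unitInterval) (t : ℕ) : Prop :=
  ∀ s < t, walkZ β U s < walkZ β U t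

lemma isSuperRegen_iff (β : ℝ) (U : ℕ → unitInterval) (t : ℕ) :
    IsSuperRegen β U t ↔ IsLadder β U t ∧ IsSuperRegen β (shift t U) 0 := by
  refine and_congr_right fun _ => ?_
  constructor
  · refine fun h => ⟨fun s hs => absurd hs (by omega), fun s hs => ?_⟩
    have := h (t + s) (by omega)
    rw [walkZ_add] at this
    simpa [walkZ] using this
  · intro h s hs
    obtain ⟨r, rfl⟩ := Nat.exists_eq_add_of_le hs.le
    have := h.2 r (by omega)
    rw [walkZ_add]
    simpa [walkZ] using this

lemma shift_shift (t s : ℕ) (U : ℕ → unitInterval) : shift s (shift t U) = shift (t + s) U := by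
  ext i; simp [shift, add_assoc]

/-- After a super-regeneration time `t`, the super-regeneration times are those of the walk started
afresh at time `t`. -/
lemma IsSuperRegen.add_iff {β : ℝ} {U : ℕ → unitInterval} {t : ℕ} (ht : IsSuperRegen β U t)
    (s : ℕ) : IsSuperRegen β U (t + s) ↔ IsSuperRegen β (shift t U) s := by
  rw [isSuperRegen_iff β U, isSuperRegen_iff β (shift t U), shift_shift]
  refine and_congr_left fun _ => ?_
  constructor
  · intro h r hr
    have := h (t + r) (by omega)
    rw [walkZ_add, walkZ_add] at this
    linarith
  · intro h r hr
    rcases lt_or_ge r t with hrt | hrt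
    · have h1 := ht.1 r hrt
      rcases Nat.eq_zero_or_pos s with rfl | hs
      · simpa using h1
      · exact h1.trans (ht.2 (t + s) (by omega))
    · obtain ⟨r, rfl⟩ := Nat.exists_eq_add_of_le hrt
      rw [walkZ_add, walkZ_add]
      have := h r (by omega)
      linarith

lemma isLadder_concat {β : ℝ} (t : ℕ) (U U' : ℕ → unitInterval) :
    IsLadder β (concat t U U') t ↔ IsLadder β U t := by
  refine forall₂_congr fun s hs => ?_
  rw [walkZ_concat hs.le, walkZ_concat le_rfl]

lemma measurableSet_isLadder (β : ℝ) (t : ℕ) :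
    MeasurableSet {U : ℕ → unitInterval | IsLadder β U t} :=
  measurableSet_forall fun s => measurableSet_forall fun _ => measurableSet_walkZ_lt β s t

lemma uniformLaw_shift (t : ℕ) {B : Set (ℕ → unitInterval)} (hB : MeasurableSet B) :
    uniformLaw (shift t ⁻¹' B) = uniformLaw B := by
  have := uniformLaw_past_inter_future t MeasurableSet.univ hB (by simp)
  simpa using this

/-! ### The probability that `0` is a super-regeneration time -/

lemma uniformLaw_down {β : ℝ} (hβ : 1 < β) :
    uniformLaw {U | (U 0 : ℝ) ≤ 1 / (β + 1)} = ENNReal.ofReal (1 / (β + 1)) := by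
  have h0 : (0 : ℝ) ≤ 1 / (β + 1) := by positivity
  have h1 : 1 / (β + 1) ≤ 1 := by rw [div_le_one (by linarith)]; linarith
  have h := (measurePreserving_eval_infinitePi
    (fun _ : ℕ => (volume : Measure unitInterval)) 0).measure_preimage
    (s := Set.Iic ⟨1 / (β + 1), h0, h1⟩) measurableSet_Iic.nullMeasurableSet
  rw [unitInterval.volume_Iic] at h
  exact h

lemma uniformLaw_up {β : ℝ} (hβ : 1 < β) :
    uniformLaw {U | (U 0 : ℝ) ≤ 1 / (β + 1)}ᶜ = ENNReal.ofReal (β / (β + 1)) := by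
  rw [prob_compl_eq_one_sub (measurableSet_down β 0), uniformLaw_down hβ, ← ENNReal.ofReal_one,
    ← ENNReal.ofReal_sub _ (by positivity)]
  congr 1
  field_simp
  ring

lemma walkZ_one_add (β : ℝ) (U : ℕ → unitInterval) (s : ℕ) :
    walkZ β U (s + 1) = (if (U 0 : ℝ) ≤ 1 / (β + 1) then -1 else 1) + walkZ β (shift 1 U) s := by
  rw [add_comm s 1, walkZ_add]
  congr 1

lemma measurableSet_stays (β : ℝ) (n : ℕ) (z : ℤ) :
    MeasurableSet {U : ℕ → unitInterval | ∀ s ≤ n, 0 < z + walkZ β U s} :=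
  measurableSet_forall fun s => measurableSet_forall fun _ =>
    measurableSet_lt measurable_const (measurable_const.add (measurable_walkZ β s))

/-- The gambler's ruin bound: from height `z` the walk stays positive with probability at least
`1 - β^{-z}`, as `β^{-z}` is harmonic. -/
lemma le_uniformLaw_stays {β : ℝ} (hβ : 1 < β) (n : ℕ) (z : ℕ) :
    ENNReal.ofReal (1 - β⁻¹ ^ z) ≤
      uniformLaw {U : ℕ → unitInterval | ∀ s ≤ n, 0 < (z : ℤ) + walkZ β U s} := by
  induction n generalizing z with
  | zero =>
    rcases Nat.eq_zero_or_pos z with rfl | hz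
    · simp
    · have : {U : ℕ → unitInterval | ∀ s ≤ 0, 0 < (z : ℤ) + walkZ β U s} = Set.univ := by
        ext U
        simp [walkZ, hz]
      rw [this, measure_univ, ← ENNReal.ofReal_one]
      refine ENNReal.ofReal_le_ofReal ?_
      have : 0 ≤ β⁻¹ ^ z := by positivity
      linarith
  | succ n ih =>
    rcases Nat.eq_zero_or_pos z with rfl | hz
    · simp
    obtain ⟨z, rfl⟩ := Nat.exists_eq_add_of_le' hz
    set D := {U : ℕ → unitInterval | (U 0 : ℝ) ≤ 1 / (β + 1)} with hD
    have hsub : (D ∩ shift 1 ⁻¹' {U | ∀ s ≤ n, 0 < (z : ℤ) + walkZ β U s}) ∪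
        (Dᶜ ∩ shift 1 ⁻¹' {U | ∀ s ≤ n, 0 < ((z + 2 : ℕ) : ℤ) + walkZ β U s}) ⊆
        {U | ∀ s ≤ n + 1, 0 < ((z + 1 : ℕ) : ℤ) + walkZ β U s} := by
      rintro U (⟨h1, h2⟩ | ⟨h1, h2⟩) s hs
      · rcases Nat.eq_zero_or_pos s with rfl | hs0
        · simp [walkZ]
        · obtain ⟨s, rfl⟩ := Nat.exists_eq_add_of_le' hs0
          have h3 : 0 < (z : ℤ) + walkZ β (shift 1 U) s := h2 s (by omega)
          have h4 : (U 0 : ℝ) ≤ 1 / (β + 1) := h1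
          rw [walkZ_one_add, if_pos h4]
          push_cast
          linarith
      · rcases Nat.eq_zero_or_pos s with rfl | hs0
        · simp [walkZ]
        · obtain ⟨s, rfl⟩ := Nat.exists_eq_add_of_le' hs0
          have h3 : 0 < ((z + 2 : ℕ) : ℤ) + walkZ β (shift 1 U) s := h2 s (by omega)
          have h4 : ¬ (U 0 : ℝ) ≤ 1 / (β + 1) := h1
          rw [walkZ_one_add, if_neg h4]
          push_cast at h3 ⊢
          linarith
    have hpast : ∀ U U', concat 1 U U' ∈ D ↔ U ∈ D := by
      intro U U'
      simp only [hD, Set.mem_ofPred_eq, concat_of_lt Nat.one_pos]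
    have hDm : MeasurableSet D := measurableSet_down β 0
    refine le_trans ?_ (measure_mono hsub)
    rw [measure_union (Set.disjoint_left.2 fun U h1 h2 => h2.1 h1.1)
      (hDm.compl.inter (measurable_shift 1 (measurableSet_stays β n _))),
      uniformLaw_past_inter_future 1 hDm (measurableSet_stays β n _) hpast,
      uniformLaw_past_inter_future 1 hDm.compl (measurableSet_stays β n _)
        (fun U U' => not_congr (hpast U U')), uniformLaw_up hβ, uniformLaw_down hβ]
    refine le_trans ?_ (add_le_add (mul_le_mul_right (ih z) _) (mul_le_mul_right (ih (z + 2)) _))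
    have hp : ∀ k : ℕ, 0 ≤ 1 - β⁻¹ ^ k := fun k => by
      have : β⁻¹ ^ k ≤ 1 := pow_le_one₀ (by positivity) (inv_le_one_of_one_le₀ hβ.le)
      linarith
    rw [← ENNReal.ofReal_mul (by positivity), ← ENNReal.ofReal_mul (by positivity),
      ← ENNReal.ofReal_add (mul_nonneg (by positivity) (hp _)) (mul_nonneg (by positivity) (hp _))]
    refine ENNReal.ofReal_le_ofReal (le_of_eq ?_)
    have : β ≠ 0 := by positivity
    have : β + 1 ≠ 0 := by positivity
    have hz : β * β⁻¹ ^ (z + 1) = β⁻¹ ^ z := by rw [pow_succ']; field_simp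
    have hz2 : β⁻¹ ^ (z + 2) * β = β⁻¹ ^ (z + 1) := by rw [pow_succ _ (z + 1)]; field_simp
    field_simp
    linear_combination hz2 - hz

/-- The probability that `0` is a super-regeneration time. -/
def regenProb (β : ℝ) : ENNReal := uniformLaw {U | IsSuperRegen β U 0}

lemma regenProb_ne_top (β : ℝ) : regenProb β ≠ ⊤ := measure_ne_top _ _

/-- The walk steps up with probability `β / (β + 1)`, and from `1` it then stays positive with
probability at least `1 - β⁻¹`. -/
lemma le_regenProb {β : ℝ} (hβ : 1 < β) :
    ENNReal.ofReal ((β - 1) / (β + 1)) ≤ regenProb β := by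
  set D := {U : ℕ → unitInterval | (U 0 : ℝ) ≤ 1 / (β + 1)} with hD
  have hDm : MeasurableSet D := measurableSet_down β 0
  have hpast : ∀ U U', concat 1 U U' ∈ D ↔ U ∈ D := by
    intro U U'
    simp only [hD, Set.mem_ofPred_eq, concat_of_lt Nat.one_pos]
  set S : ℕ → Set (ℕ → unitInterval) :=
    fun n => {U | ∀ s ≤ n, 0 < ((1 : ℕ) : ℤ) + walkZ β U s} with hS
  have hSm : ∀ n, MeasurableSet (S n) := fun n => measurableSet_stays β n _
  have hanti : Antitone S := fun m n hmn U hU s hs => hU s (hs.trans hmn)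
  have h1 : ENNReal.ofReal (1 - β⁻¹ ^ 1) ≤ uniformLaw (⋂ n, S n) := by
    rw [hanti.measure_iInter (fun n => (hSm n).nullMeasurableSet) ⟨0, measure_ne_top _ _⟩]
    exact le_iInf fun n => le_uniformLaw_stays hβ n 1
  have hsub : Dᶜ ∩ shift 1 ⁻¹' (⋂ n, S n) ⊆ {U | IsSuperRegen β U 0} := by
    rintro U ⟨hd, hu⟩
    refine ⟨fun s hs => absurd hs (by omega), fun s hs => ?_⟩
    obtain ⟨s, rfl⟩ := Nat.exists_eq_add_of_le' hs
    have h3 : 0 < ((1 : ℕ) : ℤ) + walkZ β (shift 1 U) s := Set.mem_iInter.1 hu s s le_rfl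
    have h4 : ¬ (U 0 : ℝ) ≤ 1 / (β + 1) := hd
    rw [walkZ_one_add, if_neg h4]
    simpa [walkZ] using h3
  refine le_trans ?_ (measure_mono hsub)
  rw [uniformLaw_past_inter_future 1 hDm.compl (MeasurableSet.iInter hSm)
    (fun U U' => not_congr (hpast U U')), uniformLaw_up hβ]
  refine le_trans ?_ (mul_le_mul_right h1 _)
  rw [← ENNReal.ofReal_mul (by positivity)]
  refine ENNReal.ofReal_le_ofReal (le_of_eq ?_)
  have : β ≠ 0 := by positivity
  field_simp

lemma regenProb_ne_zero {β : ℝ} (hβ : 1 < β) : regenProb β ≠ 0 := by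
  have h := le_regenProb hβ
  have h2 : 0 < ENNReal.ofReal ((β - 1) / (β + 1)) :=
    ENNReal.ofReal_pos.2 (div_pos (by linarith) (by linarith))
  exact (h2.trans_le h).ne'

/-! ### The first super-regeneration time -/

/-- There is no super-regeneration time in `(0, n]`. -/
def NoRegen (β : ℝ) (U : ℕ → unitInterval) (n : ℕ) : Prop :=
  ∀ s, 0 < s → s ≤ n → ¬ IsSuperRegen β U s

lemma measurableSet_noRegen (β : ℝ) (n : ℕ) :
    MeasurableSet {U : ℕ → unitInterval | NoRegen β U n} :=
  measurableSet_forall fun s => measurableSet_forall fun _ => measurableSet_forall fun _ =>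
    measurableSet_not (measurableSet_isSuperRegen β s)

lemma walkZ_reversed (β : ℝ) (U : ℕ → unitInterval) {t s : ℕ} (hs : s ≤ t) :
    walkZ β (reversed t U) s = walkZ β U t - walkZ β U (t - s) := by
  induction s with
  | zero => simp [walkZ]
  | succ s ih =>
    obtain ⟨r, hr⟩ := Nat.exists_eq_add_of_le hs
    have h1 : t - s = (t - (s + 1)) + 1 := by omega
    have h2 : reversed t U s = U (t - (s + 1)) := by
      simp only [reversed, show s < t by omega, if_true]
      congr 1
      omega
    rw [walkZ, ih (by omega), h2, h1, walkZ]
    split_ifs <;> ring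

/-- By time reversal, each time is a ladder time with probability at least `regenProb β`. -/
lemma regenProb_le_ladder (β : ℝ) (t : ℕ) :
    regenProb β ≤ uniformLaw {U | IsLadder β U t} := by
  rw [← uniformLaw_reversed t (measurableSet_isLadder β t)]
  refine measure_mono fun U hU s hs => ?_
  rw [walkZ_reversed β U hs.le, walkZ_reversed β U le_rfl]
  have := hU.2 (t - s) (by omega)
  simp only [walkZ, Nat.sub_self] at this ⊢
  linarith

/-- The mean of the first super-regeneration time is finite: the events that `t` is the last
super-regeneration time up to `n` are disjoint for `t ≤ n`. -/
theorem tsum_noRegen_le (β : ℝ) :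
    regenProb β * ∑' n, uniformLaw {U | IsSuperRegen β U 0 ∧ NoRegen β U n} ≤ 1 := by
  rw [← ENNReal.tsum_mul_left]
  refine ENNReal.tsum_le_of_sum_range_le fun N => ?_
  rcases Nat.eq_zero_or_pos N with rfl | hN
  · simp
  obtain ⟨n, rfl⟩ := Nat.exists_eq_add_of_le' hN
  set B : ℕ → Set (ℕ → unitInterval) := fun t =>
    {U | IsLadder β U t} ∩ shift t ⁻¹' {U | IsSuperRegen β U 0 ∧ NoRegen β U (n - t)} with hB
  have hm : ∀ k, MeasurableSet {U | IsSuperRegen β U 0 ∧ NoRegen β U k} := fun k =>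
    measurableSet_and (measurableSet_isSuperRegen β 0) (measurableSet_noRegen β k)
  have hBm : ∀ t, MeasurableSet (B t) := fun t =>
    (measurableSet_isLadder β t).inter (measurable_shift t (hm _))
  have hBr : ∀ t U, U ∈ B t → IsSuperRegen β U t := fun t U hU =>
    (isSuperRegen_iff β U t).2 ⟨hU.1, hU.2.1⟩
  have hdisj : ∀ s t, s < t → t ≤ n → Disjoint (B s) (B t) := by
    intro s t hst htn
    refine Set.disjoint_left.2 fun U h1 h2 => ?_
    obtain ⟨r, rfl⟩ := Nat.exists_eq_add_of_le hst.le
    exact h1.2.2 r (by omega) (by omega) (((hBr s U h1).add_iff r).1 (hBr _ U h2))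
  have hsum : ∑ t ∈ Finset.range (n + 1), uniformLaw (B t) ≤ 1 := by
    rw [← measure_biUnion_finset _ fun t _ => hBm t]
    · exact prob_le_one
    · intro s hs t ht hne
      simp only [Finset.coe_range, Set.mem_Iio] at hs ht
      rcases lt_or_gt_of_ne hne with h | h
      · exact hdisj s t h (by omega)
      · exact (hdisj t s h (by omega)).symm
  refine le_trans ?_ hsum
  rw [← Finset.sum_range_reflect]
  refine Finset.sum_le_sum fun t ht => ?_
  have htn : n + 1 - 1 - t = n - t := by omega
  rw [htn, hB]
  dsimp only
  rw [uniformLaw_past_inter_future t (measurableSet_isLadder β t) (hm _)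
    (fun U U' => isLadder_concat t U U')]
  gcongr
  exact regenProb_le_ladder β t

lemma tsum_noRegen_ne_top {β : ℝ} (hβ : 1 < β) :
    ∑' n, uniformLaw {U | IsSuperRegen β U 0 ∧ NoRegen β U n} ≠ ⊤ := by
  intro h
  have := tsum_noRegen_le β
  rw [h, ENNReal.mul_top (regenProb_ne_zero hβ)] at this
  simp at this

lemma uniformLaw_noRegen_eq_zero {β : ℝ} (hβ : 1 < β) :
    uniformLaw {U | IsSuperRegen β U 0 ∧ ∀ n, NoRegen β U n} = 0 := by
  have h := ENNReal.tendsto_atTop_zero_of_tsum_ne_top (tsum_noRegen_ne_top hβ)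
  refine le_antisymm (ge_of_tendsto' h fun n => measure_mono fun U hU => ⟨hU.1, hU.2 n⟩) zero_le

/-- Almost surely every super-regeneration time is followed by another one. -/
lemma ae_exists_regen_gt {β : ℝ} (hβ : 1 < β) :
    ∀ᵐ U ∂uniformLaw, ∀ t, IsSuperRegen β U t → ∃ s, t < s ∧ IsSuperRegen β U s := by
  rw [ae_all_iff]
  intro t
  have hm : MeasurableSet {U | IsSuperRegen β U 0 ∧ ∀ n, NoRegen β U n} :=
    measurableSet_and (measurableSet_isSuperRegen β 0)
      (measurableSet_forall fun n => measurableSet_noRegen β n)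
  have h := uniformLaw_shift t hm
  rw [uniformLaw_noRegen_eq_zero hβ] at h
  refine measure_mono_null (fun U hU => ?_) h
  simp only [Set.mem_compl_iff, Set.mem_ofPred_eq, not_forall, not_exists, not_and] at hU
  obtain ⟨ht, hno⟩ := hU
  refine ⟨((isSuperRegen_iff β U t).1 ht).2, fun n s hs _ hr => ?_⟩
  exact hno (t + s) (by omega) ((ht.add_iff s).2 hr)

lemma ae_exists_regen_ge {β : ℝ} (hβ : 1 < β) :
    ∀ᵐ U ∂uniformLaw, IsSuperRegen β U 0 → ∀ n, ∃ s, n ≤ s ∧ IsSuperRegen β U s := by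
  filter_upwards [ae_exists_regen_gt hβ] with U hU h0 n
  induction n with
  | zero => exact ⟨0, le_rfl, h0⟩
  | succ n ih =>
    obtain ⟨s, hs, hr⟩ := ih
    obtain ⟨s', hs', hr'⟩ := hU s hr
    exact ⟨s', by omega, hr'⟩

/-- What `s` being a super-regeneration time says about the times up to `t`. -/
def RegenUpTo (β : ℝ) (U : ℕ → unitInterval) (t s : ℕ) : Prop :=
  IsLadder β U s ∧ ∀ r, s < r → r ≤ t → walkZ β U s < walkZ β U r

lemma IsSuperRegen.iff_regenUpTo {β : ℝ} {U : ℕ → unitInterval} {t s : ℕ}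
    (ht : IsSuperRegen β U t) (hs : s ≤ t) : IsSuperRegen β U s ↔ RegenUpTo β U t s := by
  refine and_congr_right fun _ => ⟨fun h r hr _ => h r hr, fun h r hr => ?_⟩
  rcases le_or_gt r t with hrt | hrt
  · exact h r hr hrt
  · rcases hs.eq_or_lt with rfl | hst
    · exact ht.2 r hrt
    · exact (ht.1 s hst).trans (ht.2 r hrt)

/-- The part of the event that `t` is the first super-regeneration time after the
super-regeneration time `0` which concerns the times up to `t`. -/
def FirstRegenPast (β : ℝ) (t : ℕ) : Set (ℕ → unitInterval) :=
  {U | 0 < t ∧ RegenUpTo β U t 0 ∧ IsLadder β U t ∧ ∀ s, 0 < s → s < t → ¬ RegenUpTo β U t s}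

lemma measurableSet_firstRegenPast (β : ℝ) (t : ℕ) : MeasurableSet (FirstRegenPast β t) := by
  have h : ∀ s, MeasurableSet {U | RegenUpTo β U t s} := fun s =>
    measurableSet_and (measurableSet_isLadder β s) (measurableSet_forall fun r =>
      measurableSet_forall fun _ => measurableSet_forall fun _ => measurableSet_walkZ_lt β s r)
  exact measurableSet_and (MeasurableSet.const _) (measurableSet_and (h 0) (measurableSet_and
    (measurableSet_isLadder β t) (measurableSet_forall fun s => measurableSet_forall fun _ =>
      measurableSet_forall fun _ => measurableSet_not (h s))))

lemma concat_mem_firstRegenPast {β : ℝ} (t : ℕ) (U U' : ℕ → unitInterval) :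
    concat t U U' ∈ FirstRegenPast β t ↔ U ∈ FirstRegenPast β t := by
  have h1 : ∀ s ≤ t, IsLadder β (concat t U U') s ↔ IsLadder β U s := by
    intro s hs
    refine forall₂_congr fun r hr => ?_
    rw [walkZ_concat (by omega), walkZ_concat hs]
  have h : ∀ s ≤ t, RegenUpTo β (concat t U U') t s ↔ RegenUpTo β U t s := by
    intro s hs
    refine and_congr (h1 s hs) (forall₃_congr fun r _ hr => ?_)
    rw [walkZ_concat hs, walkZ_concat hr]
  refine and_congr_right fun _ => and_congr (h 0 (by omega)) (and_congr (h1 t le_rfl) ?_)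
  exact forall₃_congr fun s _ hs => not_congr (h s hs.le)

/-- `t` is the first super-regeneration time after the super-regeneration time `0`. -/
def IsFirstRegen (β : ℝ) (U : ℕ → unitInterval) (t : ℕ) : Prop :=
  IsSuperRegen β U 0 ∧ 0 < t ∧ IsSuperRegen β U t ∧ ∀ s, 0 < s → s < t → ¬ IsSuperRegen β U s

lemma isFirstRegen_iff (β : ℝ) (U : ℕ → unitInterval) (t : ℕ) :
    IsFirstRegen β U t ↔ U ∈ FirstRegenPast β t ∧ IsSuperRegen β (shift t U) 0 := by
  constructor
  · rintro ⟨h0, ht, hr, hs⟩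
    refine ⟨⟨ht, (hr.iff_regenUpTo ht.le).1 h0, hr.1, fun s hs0 hst h => ?_⟩,
      ((isSuperRegen_iff β U t).1 hr).2⟩
    exact hs s hs0 hst ((hr.iff_regenUpTo hst.le).2 h)
  · rintro ⟨⟨ht, h0, hl, hs⟩, hr⟩
    have hr' : IsSuperRegen β U t := (isSuperRegen_iff β U t).2 ⟨hl, hr⟩
    exact ⟨(hr'.iff_regenUpTo ht.le).2 h0, ht, hr', fun s hs0 hst h =>
      hs s hs0 hst ((hr'.iff_regenUpTo hst.le).1 h)⟩

lemma measurableSet_isFirstRegen (β : ℝ) (t : ℕ) :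
    MeasurableSet {U : ℕ → unitInterval | IsFirstRegen β U t} :=
  measurableSet_and (measurableSet_isSuperRegen β 0) (measurableSet_and (MeasurableSet.const _)
    (measurableSet_and (measurableSet_isSuperRegen β t) (measurableSet_forall fun s =>
      measurableSet_forall fun _ => measurableSet_forall fun _ =>
        measurableSet_not (measurableSet_isSuperRegen β s))))

lemma exists_isFirstRegen {β : ℝ} {U : ℕ → unitInterval} (h0 : IsSuperRegen β U 0)
    (h : ∃ s, 0 < s ∧ IsSuperRegen β U s) : ∃ t, IsFirstRegen β U t := by
  classical
  refine ⟨Nat.find h, h0, (Nat.find_spec h).1, (Nat.find_spec h).2, fun s hs hst hr => ?_⟩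
  exact Nat.find_min h hst ⟨hs, hr⟩

lemma IsFirstRegen.unique {β : ℝ} {U : ℕ → unitInterval} {s t : ℕ} (hs : IsFirstRegen β U s)
    (ht : IsFirstRegen β U t) : s = t := by
  rcases lt_trichotomy s t with h | h | h
  · exact absurd hs.2.2.1 (ht.2.2.2 s hs.2.1 h)
  · exact h
  · exact absurd ht.2.2.1 (hs.2.2.2 t ht.2.1 h)

lemma IsFirstRegen.noRegen_iff {β : ℝ} {U : ℕ → unitInterval} {t : ℕ} (ht : IsFirstRegen β U t)
    (i : ℕ) : NoRegen β U i ↔ i < t := by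
  refine ⟨fun h => ?_, fun h s hs hsi => ht.2.2.2 s hs (by omega)⟩
  by_contra hi
  exact h t ht.2.1 (by omega) ht.2.2.1

/-! ### The walk on the backbone, with a parent edge at the root -/

/-- Weight of the edge from `x` to its parent, if the root has an edge of weight `ρ` towards a
ghost parent. -/
def rootWeight (ρ : ℝ) (x : Vertex) : ℝ := if x = [] then ρ else 1

lemma rootWeight_zero (x : Vertex) : rootWeight 0 x = parentWeight x := rfl

lemma rootWeight_one (x : Vertex) : rootWeight 1 x = 1 := by simp [rootWeight]

lemma rootWeight_of_ne_nil (ρ : ℝ) {x : Vertex} (hx : x ≠ []) : rootWeight ρ x = 1 := by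
  simp [rootWeight, hx]

lemma rootWeight_le_one {ρ : ℝ} (hρ : ρ ≤ 1) (x : Vertex) : rootWeight ρ x ≤ 1 := by
  unfold rootWeight; split_ifs <;> simp [hρ]

/-- The biased step, for parent weight `ρ` at the root; a step to the ghost parent is a stay. -/
def stepG (β ρ : ℝ) (x : Vertex) (L : List ℕ) (u : ℝ) : Vertex :=
  let j := ⌊(1 - u) * (L.length * β + rootWeight ρ x) / β⌋₊
  if hj : j < L.length then L[j] :: x else x.tail

/-- The walk on the backbone for parent weight `ρ` at the root. Weight `0` gives the walk `Y`;
weight `1` describes the walk `Y` after a regeneration, seen from the regeneration vertex. -/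
def walkG (β ρ : ℝ) (ω : Env) (U : ℕ → unitInterval) : ℕ → Vertex
  | 0 => []
  | i + 1 => stepG β ρ (walkG β ρ ω U i) (backboneChildren ω (walkG β ρ ω U i)) (U i)

lemma walkG_zero_eq_walkY (β : ℝ) (ω : Env) (U : ℕ → unitInterval) (i : ℕ) :
    walkG β 0 ω U i = walkY β ω U i := by
  induction i with
  | zero => rfl
  | succ i ih => rw [walkG, walkY, ih]; rfl

lemma stepG_eq (β ρ : ℝ) (x : Vertex) (L : List ℕ) (u : ℝ) :
    (∃ i ∈ L, stepG β ρ x L u = i :: x) ∨ stepG β ρ x L u = x.tail := by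
  unfold stepG
  dsimp only
  split_ifs with h
  · exact Or.inl ⟨_, List.getElem_mem h, rfl⟩
  · exact Or.inr rfl

lemma stepG_mem_backbone (β ρ : ℝ) {ω : Env} {x : Vertex} (hx : x ∈ backbone ω) (u : ℝ) :
    stepG β ρ x (backboneChildren ω x) u ∈ backbone ω := by
  rcases stepG_eq β ρ x (backboneChildren ω x) u with ⟨i, hi, h⟩ | h
  · rw [h]
    exact mem_backboneChildren'.1 hi
  · rw [h]
    exact backbone_tail hx

/-- Whenever the walk on `ℤ` moves up, so does the walk on the backbone. -/
lemma stepG_up {β ρ : ℝ} (hβ : 1 < β) (hρ : ρ ≤ 1) {x : Vertex} {L : List ℕ} (hL : 0 < L.length)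
    {u : ℝ} (hu1 : u ≤ 1) (hu : ¬ u ≤ 1 / (β + 1)) : ∃ i ∈ L, stepG β ρ x L u = i :: x := by
  have hj : ⌊(1 - u) * (L.length * β + rootWeight ρ x) / β⌋₊ < L.length := by
    rw [Nat.floor_lt']
    · have hw := rootWeight_le_one hρ x
      have hk : (1 : ℝ) ≤ L.length := by exact_mod_cast hL
      push Not at hu
      rw [div_lt_iff₀ (by linarith)] at hu
      rw [div_lt_iff₀ (by linarith)]
      have h1 : (1 - u) * (L.length * β + rootWeight ρ x) ≤ (1 - u) * (L.length * (β + 1)) := by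
        refine mul_le_mul_of_nonneg_left ?_ (by linarith)
        nlinarith
      have h2 : (1 - u) * (β + 1) < β := by linarith
      nlinarith
    · omega
  refine ⟨_, List.getElem_mem hj, ?_⟩
  simp only [stepG, hj, dif_pos]

lemma walkG_mem_backbone (β ρ : ℝ) {ω : Env} (h0 : ω ∈ survival) (U : ℕ → unitInterval) (i : ℕ) :
    walkG β ρ ω U i ∈ backbone ω := by
  induction i with
  | zero => exact nil_mem_backbone.2 h0
  | succ i ih => exact stepG_mem_backbone β ρ ih _

/-- The walk on the backbone moves away from the root at least as fast as the walk on `ℤ`. -/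
lemma walkZ_sub_le {β ρ : ℝ} (hβ : 1 < β) (hρ : ρ ≤ 1) {ω : Env} (h0 : ω ∈ survival)
    (U : ℕ → unitInterval) {s t : ℕ} (hst : s ≤ t) :
    walkZ β U t - walkZ β U s ≤ ((walkG β ρ ω U t).length : ℤ) - (walkG β ρ ω U s).length := by
  induction t, hst using Nat.le_induction with
  | base => simp
  | succ t hst ih =>
    have hstep : walkZ β U (t + 1) - walkZ β U t ≤
        ((walkG β ρ ω U (t + 1)).length : ℤ) - (walkG β ρ ω U t).length := by
      rw [walkZ, walkG]
      split_ifs with hu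
      · rcases stepG_eq β ρ (walkG β ρ ω U t) (backboneChildren ω (walkG β ρ ω U t)) (U t)
          with ⟨i, -, h⟩ | h
        · rw [h]; simp only [List.length_cons]; push_cast; linarith
        · rw [h]; simp only [List.length_tail]; omega
      · obtain ⟨i, -, h⟩ := stepG_up hβ hρ (x := walkG β ρ ω U t)
          (backboneChildren_length_pos (walkG_mem_backbone β ρ h0 U t)) (U t).2.2 hu
        rw [h]; simp only [List.length_cons]; push_cast; linarith
    linarith

lemma length_lt_of_walkZ_lt {β ρ : ℝ} (hβ : 1 < β) (hρ : ρ ≤ 1) {ω : Env} (h0 : ω ∈ survival)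
    (U : ℕ → unitInterval) {s t : ℕ} (hst : s ≤ t) (h : walkZ β U s < walkZ β U t) :
    (walkG β ρ ω U s).length < (walkG β ρ ω U t).length := by
  have := walkZ_sub_le hβ hρ h0 U hst
  omega

lemma not_suffix_of_ladder {β ρ : ℝ} (hβ : 1 < β) (hρ : ρ ≤ 1) {ω : Env} (h0 : ω ∈ survival)
    {U : ℕ → unitInterval} {s t : ℕ} (ht : IsLadder β U t) (hst : s < t) :
    ¬ walkG β ρ ω U t <:+ walkG β ρ ω U s := by
  intro h
  have h1 := h.length_le
  have h2 := length_lt_of_walkZ_lt (ρ := ρ) hβ hρ h0 U hst.le (ht s hst)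
  omega

/-- The path up to its first visit to `y` does not depend on the environment at and above `y`. -/
lemma walkG_congr {β ρ : ℝ} {y : Vertex} {ω ω' : Env} (h : AgreeOff y ω ω')
    (hy : y ∈ backbone ω ↔ y ∈ backbone ω') {U U' : ℕ → unitInterval} {t : ℕ}
    (hU : ∀ s < t, U s = U' s) (ht : ∀ s < t, ¬ y <:+ walkG β ρ ω U s) :
    ∀ s ≤ t, walkG β ρ ω' U' s = walkG β ρ ω U s := by
  intro s hs
  induction s with
  | zero => rfl
  | succ s ih =>
    rw [walkG, walkG, ih (by omega), backboneChildren_congr h hy (ht s (by omega)),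
      hU s (by omega)]

/-- The walk on the backbone does not see the descendants of a vertex outside the backbone. -/
lemma walkG_congr_bud {β ρ : ℝ} {b : Vertex} {ω ω' : Env} (h : AgreeOff b ω ω')
    (h0 : ω ∈ survival) (hb : b ∉ backbone ω) (hb' : b ∉ backbone ω') (U : ℕ → unitInterval)
    (i : ℕ) : walkG β ρ ω' U i = walkG β ρ ω U i :=
  walkG_congr h (iff_of_false hb hb') (fun _ _ => rfl)
    (fun s _ hs => hb (mem_backbone_of_suffix (walkG_mem_backbone β ρ h0 U s) hs)) i le_rfl

/-- If the walk on the backbone has not yet visited descendants of `y`, its first visit of a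
descendant of `y` is a visit of `y`. -/
lemma not_suffix_of_not_visited {β ρ : ℝ} {ω : Env} {U : ℕ → unitInterval} {y : Vertex} {t : ℕ}
    (hy : y ≠ []) (ht : ∀ s < t, walkG β ρ ω U s ≠ y) : ∀ s < t, ¬ y <:+ walkG β ρ ω U s := by
  intro s hs
  induction s with
  | zero => intro h; exact hy (List.suffix_nil.1 h)
  | succ s ih =>
    intro h
    have h1 := ih (by omega)
    have h2 := ht (s + 1) hs
    rw [walkG] at h h2
    rcases stepG_eq β ρ (walkG β ρ ω U s) (backboneChildren ω (walkG β ρ ω U s)) (U s)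
      with ⟨i, -, h3⟩ | h3
    · rw [h3] at h h2
      exact h1 (suffix_of_suffix_cons h h2.symm)
    · rw [h3] at h
      exact h1 (h.trans (List.tail_suffix _))

/-- The walk after a super-regeneration time. -/
lemma walkG_regen {β ρ : ℝ} (hβ : 1 < β) {ω : Env} {U : ℕ → unitInterval} {t : ℕ} {y : Vertex}
    (hr : IsSuperRegen β (shift t U) 0) (hy : y ∈ backbone ω) (hne : y ≠ [])
    (hty : walkG β ρ ω U t = y) (s : ℕ) :
    walkG β ρ ω U (t + s) = walkG β 1 (sub ω y) (shift t U) s ++ y := by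
  have hy' := mem_backbone_iff.1 hy
  induction s with
  | zero => simpa [walkG] using hty
  | succ s ih =>
    rw [← add_assoc, walkG, ih, walkG]
    set v := walkG β 1 (sub ω y) (shift t U) s with hv
    have hw1 : rootWeight ρ (v ++ y) = 1 := rootWeight_of_ne_nil ρ (by simp [hne])
    rw [backboneChildren_append hy'.1]
    set L := backboneChildren (sub ω y) v with hL
    have hu : shift t U s = U (t + s) := rfl
    rcases List.eq_nil_or_concat' v with hv0 | ⟨w, i, hvi⟩
    · -- the walk seen from `y` is at its root only at time `0`, and then it moves up
      have hs0 : s = 0 := by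
        by_contra hs
        have := length_lt_of_walkZ_lt (ρ := 1) hβ le_rfl hy'.2 (shift t U) (Nat.zero_le s)
          (hr.2 s (by omega))
        rw [← hv, hv0] at this
        simp at this
      subst hs0
      have hup : ¬ ((U (t + 0) : ℝ) ≤ 1 / (β + 1)) := by
        intro hd
        have h1 := hr.2 1 one_pos
        have h2 : (shift t U 0 : ℝ) ≤ 1 / (β + 1) := hd
        simp only [walkZ, if_pos h2] at h1
        omega
      have hlen : 0 < L.length := backboneChildren_length_pos (walkG_mem_backbone β 1 hy'.2 _ 0)
      obtain ⟨a, ha, h1⟩ := stepG_up hβ le_rfl (ρ := 1) (x := v) hlen (U (t + 0)).2.2 hup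
      rw [hu, h1]
      simp only [stepG, rootWeight_one, hw1] at h1 ⊢
      split_ifs at h1 ⊢ with hj
      · simpa using h1
      · exfalso; rw [hv0] at h1; simp at h1
    · simp only [stepG, rootWeight_one, hw1, hu]
      split_ifs with hj
      · simp
      · rw [List.tail_append_of_ne_nil]
        simp [hvi]

lemma measurable_stepG (β ρ : ℝ) (x : Vertex) (L : List ℕ) :
    Measurable fun u : ℝ => stepG β ρ x L u := by
  unfold stepG
  dsimp only
  have hj : Measurable fun u : ℝ => ⌊(1 - u) * (L.length * β + rootWeight ρ x) / β⌋₊ :=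
    Measurable.nat_floor (by fun_prop)
  let g : ℕ → Vertex := fun j => if hj : j < L.length then L[j] :: x else x.tail
  have hg : Measurable g := Measurable.of_discrete
  exact hg.comp hj

lemma measurable_walkG (β ρ : ℝ) (i : ℕ) :
    Measurable fun z : Env × (ℕ → unitInterval) => walkG β ρ z.1 z.2 i := by
  induction i with
  | zero => exact measurable_const
  | succ i ih =>
    simp only [walkG]
    refine measurable_apply_countable (f := fun (z : Env × (ℕ → unitInterval)) x =>
      stepG β ρ x (backboneChildren z.1 x) (z.2 i)) (fun x => ?_) ih
    refine measurable_apply_countable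
      (f := fun (z : Env × (ℕ → unitInterval)) L => stepG β ρ x L (z.2 i)) (fun L => ?_)
      ((measurable_backboneChildren x).comp measurable_fst)
    exact (measurable_stepG β ρ x L).comp
      (measurable_subtype_coe.comp ((measurable_pi_apply i).comp measurable_snd))

lemma measurableSet_walkG_eq (β ρ : ℝ) (i : ℕ) (y : Vertex) :
    MeasurableSet {z : Env × (ℕ → unitInterval) | walkG β ρ z.1 z.2 i = y} :=
  measurable_walkG β ρ i (measurableSet_singleton y)

/-! ### The first big trap and the local picture around it -/

/-- The walk meets at time `i` the root of a trap of height at least `h`. -/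
def MeetsG (β ρ : ℝ) (h : ℕ) (ω : Env) (U : ℕ → unitInterval) (i : ℕ) : Prop :=
  (bigBuds ω h (walkG β ρ ω U i)).Nonempty

lemma meetsG_zero (β : ℝ) (h : ℕ) (ω : Env) (U : ℕ → unitInterval) (i : ℕ) :
    MeetsG β 0 h ω U i ↔ MeetsBigTrap β h ω U i := by
  rw [MeetsG, walkG_zero_eq_walkY, MeetsBigTrap]

/-- The number of visits to `x`. -/
def numVisits (β ρ : ℝ) (ω : Env) (U : ℕ → unitInterval) (x : Vertex) : ℕ :=
  {i | walkG β ρ ω U i = x}.ncard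

/-- A function `Ψ` of the local picture at `x`: the number of visits to `x`, its number of backbone
children and the weight of the edge towards its parent. -/
def localObs (β ρ : ℝ) (Ψ : ℕ → ℕ → ℝ → ENNReal) (ω : Env) (U : ℕ → unitInterval) (x : Vertex) :
    ENNReal :=
  Ψ (numVisits β ρ ω U x) (backboneChildren ω x).length (rootWeight ρ x)

/-- The root of the first big trap met. -/
def trapRootG (β ρ : ℝ) (h : ℕ) (ω : Env) (U : ℕ → unitInterval) : Vertex :=
  walkG β ρ ω U (sInf {i | MeetsG β ρ h ω U i})

open Classical in
/-- The local picture at the root of the first big trap met, `0` if no big trap is met. -/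
def trapObs (β ρ : ℝ) (h : ℕ) (Ψ : ℕ → ℕ → ℝ → ENNReal) (ω : Env) (U : ℕ → unitInterval) :
    ENNReal :=
  if ∃ i, MeetsG β ρ h ω U i then localObs β ρ Ψ ω U (trapRootG β ρ h ω U) else 0

lemma sInf_eq_of_forall_lt {P : ℕ → Prop} {i : ℕ} (hi : P i) (h : ∀ j < i, ¬ P j) :
    sInf {j | P j} = i := by
  refine le_antisymm (Nat.sInf_le hi) (le_csInf ⟨i, hi⟩ fun j hj => ?_)
  by_contra hlt
  exact h j (not_le.1 hlt) hj

lemma trapObs_eq {β ρ : ℝ} {h : ℕ} (Ψ : ℕ → ℕ → ℝ → ENNReal) {ω : Env} {U : ℕ → unitInterval}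
    {i : ℕ} (hi : MeetsG β ρ h ω U i) (hlt : ∀ j < i, ¬ MeetsG β ρ h ω U j) :
    trapObs β ρ h Ψ ω U = localObs β ρ Ψ ω U (walkG β ρ ω U i) := by
  rw [trapObs, if_pos ⟨i, hi⟩, trapRootG, sInf_eq_of_forall_lt hi hlt]

lemma measurable_sInf {α : Type*} [MeasurableSpace α] {P : α → ℕ → Prop}
    (hP : ∀ i, MeasurableSet {a | P a i}) : Measurable fun a => sInf {i | P a i} := by
  refine measurable_to_countable' fun n => ?_
  have : (fun a => sInf {i | P a i}) ⁻¹' {n} =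
      {a | P a n ∧ ∀ m, m < n → ¬ P a m} ∪ {a | n = 0 ∧ ∀ m, ¬ P a m} := by
    ext a
    simp only [Set.mem_preimage, Set.mem_singleton_iff, Set.mem_union, Set.mem_ofPred_eq]
    constructor
    · rintro rfl
      by_cases hne : ∃ i, P a i
      · left
        exact ⟨Nat.sInf_mem hne, fun m hm => Nat.notMem_of_lt_sInf hm⟩
      · right
        push Not at hne
        refine ⟨?_, hne⟩
        rw [Nat.sInf_eq_zero]
        right
        ext i; simp [hne i]
    · rintro (⟨h1, h2⟩ | ⟨rfl, h⟩)
      · exact sInf_eq_of_forall_lt h1 h2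
      · rw [Nat.sInf_eq_zero]
        right
        ext i; simp [h i]
  rw [this]
  exact (measurableSet_and (hP n) (measurableSet_forall fun m => measurableSet_forall fun _ =>
    measurableSet_not (hP m))).union (measurableSet_and (MeasurableSet.const _)
      (measurableSet_forall fun m => measurableSet_not (hP m)))

lemma measurableSet_mem_bigBuds (h : ℕ) (x : Vertex) (i : ℕ) :
    MeasurableSet {ω : Env | i ∈ bigBuds ω h x} := by
  have h1 : MeasurableSet {ω : Env | InTree ω (i :: x) ∧ sub ω (i :: x) ∈ tall h} :=
    measurableSet_and (measurableSet_inTree _) (measurable_sub (i :: x) (measurableSet_tall h))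
  by_cases h0 : h = 0
  · have : {ω : Env | i ∈ bigBuds ω h x} = {ω : Env | i < ω x ∧ i :: x ∉ backbone ω} := by
      ext ω; simp [bigBuds, mem_buds, h0]
    rw [this]
    exact measurableSet_and (measurableSet_lt measurable_const (measurable_pi_apply x))
      (measurableSet_not (measurableSet_mem_backbone _))
  · convert h1 using 1
    ext ω
    simp only [Set.mem_ofPred_eq]
    by_cases hx : InTree ω x
    · rw [mem_bigBuds_iff hx]
      simp [InTree, hx]
    · -- off the tree the set of descendants is empty and the height is `0` by convention
      have he : subtree ω (i :: x) = ∅ := by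
        ext w
        simp only [Set.mem_empty_iff_false, iff_false]
        exact fun hw => hx (hw.1.of_suffix hw.2).1
      have ht : trapHeight ω (i :: x) = 0 := by simp [trapHeight, he]
      simp only [bigBuds, Set.mem_ofPred_eq, ht, InTree, hx, false_and, iff_false, not_and]
      omega

lemma measurableSet_meetsG (β ρ : ℝ) (h i : ℕ) :
    MeasurableSet {z : Env × (ℕ → unitInterval) | MeetsG β ρ h z.1 z.2 i} := by
  have : {z : Env × (ℕ → unitInterval) | MeetsG β ρ h z.1 z.2 i} =
      {z | ∃ x : Vertex, walkG β ρ z.1 z.2 i = x ∧ ∃ j, j ∈ bigBuds z.1 h x} := by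
    ext z; simp [MeetsG, Set.Nonempty]
  rw [this]
  exact measurableSet_exists fun x => measurableSet_and (measurableSet_walkG_eq β ρ i x)
    (measurableSet_exists fun j => measurable_fst (measurableSet_mem_bigBuds h x j))

lemma measurable_numVisits (β ρ : ℝ) (x : Vertex) :
    Measurable fun z : Env × (ℕ → unitInterval) => numVisits β ρ z.1 z.2 x :=
  measurable_ncard fun i => measurableSet_walkG_eq β ρ i x

lemma measurable_localObs (β ρ : ℝ) (Ψ : ℕ → ℕ → ℝ → ENNReal) (x : Vertex) :
    Measurable fun z : Env × (ℕ → unitInterval) => localObs β ρ Ψ z.1 z.2 x := by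
  have h1 : Measurable fun z : Env × (ℕ → unitInterval) =>
      (numVisits β ρ z.1 z.2 x, (backboneChildren z.1 x).length) :=
    (measurable_numVisits β ρ x).prodMk ((Measurable.of_discrete
      (f := fun l : Vertex => l.length)).comp ((measurable_backboneChildren x).comp measurable_fst))
  exact (Measurable.of_discrete (f := fun n : ℕ × ℕ => Ψ n.1 n.2 (rootWeight ρ x))).comp h1

lemma measurable_trapRootG (β ρ : ℝ) (h : ℕ) :
    Measurable fun z : Env × (ℕ → unitInterval) => trapRootG β ρ h z.1 z.2 :=
  measurable_apply_countable (f := fun (z : Env × (ℕ → unitInterval)) i => walkG β ρ z.1 z.2 i)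
    (measurable_walkG β ρ) (measurable_sInf (measurableSet_meetsG β ρ h))

lemma measurable_trapObs (β ρ : ℝ) (h : ℕ) (Ψ : ℕ → ℕ → ℝ → ENNReal) :
    Measurable fun z : Env × (ℕ → unitInterval) => trapObs β ρ h Ψ z.1 z.2 := by
  classical
  refine Measurable.ite (measurableSet_exists fun i => measurableSet_meetsG β ρ h i) ?_
    measurable_const
  exact measurable_apply_countable
    (f := fun (z : Env × (ℕ → unitInterval)) x => localObs β ρ Ψ z.1 z.2 x)
    (measurable_localObs β ρ Ψ) (measurable_trapRootG β ρ h)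

/-! ### The renewal equation at the first super-regeneration time -/

/-- The unconditioned law of the environment and of the variables driving the backbone walk. -/
def baseLaw (p : PMF ℕ) : Measure (Env × (ℕ → unitInterval)) := (offspringLaw p).prod uniformLaw

instance (p : PMF ℕ) : IsProbabilityMeasure (baseLaw p) := by unfold baseLaw; infer_instance

/-- Independence of the environment above `y` and the future of time `t` from the rest. -/
theorem lintegral_baseLaw_mul (p : PMF ℕ) (t : ℕ) (y : Vertex)
    {f G : Env × (ℕ → unitInterval) → ENNReal} (hf : Measurable f) (hG : Measurable G)
    (h1 : ∀ ω η U, f (graft y ω η, U) = f (ω, U))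
    (h2 : ∀ ω U U', f (ω, concat t U U') = f (ω, U)) :
    ∫⁻ z, f z * G (sub z.1 y, shift t z.2) ∂baseLaw p =
      (∫⁻ z, f z ∂baseLaw p) * ∫⁻ z, G z ∂baseLaw p := by
  have hm : Measurable fun z : Env × (ℕ → unitInterval) => G (sub z.1 y, shift t z.2) :=
    hG.comp (((measurable_sub y).comp measurable_fst).prodMk
      ((measurable_shift t).comp measurable_snd))
  have hF : Measurable fun U => ∫⁻ ω, f (ω, U) ∂offspringLaw p := hf.lintegral_prod_left'
  have hGG : Measurable fun U => ∫⁻ ω, G (ω, U) ∂offspringLaw p := hG.lintegral_prod_left'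
  unfold baseLaw
  have hfm : Measurable fun z : Env × (ℕ → unitInterval) => f z * G (sub z.1 y, shift t z.2) :=
    hf.mul hm
  rw [lintegral_prod_symm' _ hfm, lintegral_prod_symm' _ hf, lintegral_prod_symm' _ hG]
  have h3 : ∀ U, ∫⁻ ω, f (ω, U) * G (sub ω y, shift t U) ∂offspringLaw p =
      (∫⁻ ω, f (ω, U) ∂offspringLaw p) * ∫⁻ ω, G (ω, shift t U) ∂offspringLaw p := fun U =>
    lintegral_offspringLaw_mul_sub p y (f := fun ω => f (ω, U)) (g := fun ω => G (ω, shift t U))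
      (hf.comp measurable_prodMk_right) (hG.comp measurable_prodMk_right) fun ω η => h1 ω η U
  have hFm : Measurable fun U => (∫⁻ ω, f (ω, U) ∂offspringLaw p) *
      ∫⁻ ω, G (ω, shift t U) ∂offspringLaw p := hF.mul (hGG.comp (measurable_shift t))
  rw [lintegral_congr h3, lintegral_uniformLaw_concat t hFm]
  simp only [h2, shift_concat]
  rw [lintegral_congr fun U => lintegral_const_mul _ hGG, lintegral_mul_const _ hF]

/-- Survival of the tree, and `0` is a super-regeneration time. -/
def Good (β : ℝ) : Set (Env × (ℕ → unitInterval)) := {z | z.1 ∈ survival ∧ IsSuperRegen β z.2 0}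

lemma measurableSet_good (β : ℝ) : MeasurableSet (Good β) :=
  measurableSet_and (measurable_fst measurableSet_survival)
    (measurable_snd (measurableSet_isSuperRegen β 0))

lemma baseLaw_good (p : PMF ℕ) (β : ℝ) :
    baseLaw p (Good β) = offspringLaw p survival * regenProb β := by
  rw [regenProb, ← Measure.prod_prod]
  rfl

/-- A big trap is met no later than any positive super-regeneration time. -/
def EarlyMeet (β ρ : ℝ) (h : ℕ) : Set (Env × (ℕ → unitInterval)) :=
  {z | ∃ i, NoRegen β z.2 i ∧ MeetsG β ρ h z.1 z.2 i}

lemma measurableSet_earlyMeet (β ρ : ℝ) (h : ℕ) : MeasurableSet (EarlyMeet β ρ h) :=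
  measurableSet_exists fun i => measurableSet_and (measurable_snd (measurableSet_noRegen β i))
    (measurableSet_meetsG β ρ h i)

/-- The first positive super-regeneration time is `t`, the walk is then at `y`, and no big trap
has been met before. -/
def RegenAt (β ρ : ℝ) (h t : ℕ) (y : Vertex) : Set (Env × (ℕ → unitInterval)) :=
  {z | z.1 ∈ survival ∧ IsFirstRegen β z.2 t ∧ walkG β ρ z.1 z.2 t = y ∧
    ∀ s < t, ¬ MeetsG β ρ h z.1 z.2 s}

lemma measurableSet_regenAt (β ρ : ℝ) (h t : ℕ) (y : Vertex) :
    MeasurableSet (RegenAt β ρ h t y) :=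
  measurableSet_and (measurable_fst measurableSet_survival)
    (measurableSet_and (measurable_snd (measurableSet_isFirstRegen β t))
      (measurableSet_and (measurableSet_walkG_eq β ρ t y) (measurableSet_forall fun s =>
        measurableSet_forall fun _ => measurableSet_not (measurableSet_meetsG β ρ h s))))

/-- The environment in which every vertex has one child. -/
def lineEnv : Env := fun _ => 1

lemma lineEnv_mem_survival : lineEnv ∈ survival := by
  have h : ∀ n, InTree lineEnv (List.replicate n 0) := by
    intro n
    induction n with
    | zero => trivial
    | succ n ih => exact ⟨ih, by simp [lineEnv]⟩
  refine Set.infinite_of_injective_forall_mem (f := fun n : ℕ => List.replicate n 0) ?_ h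
  intro a b hab
  simpa using congrArg List.length hab

/-- The part of the event `RegenAt` concerning the environment off the descendants of `y` and the
times up to `t`. -/
def RegenAtPast (β ρ : ℝ) (h t : ℕ) (y : Vertex) : Set (Env × (ℕ → unitInterval)) :=
  {z | z.2 ∈ FirstRegenPast β t ∧ y ∈ backbone (graft y z.1 lineEnv) ∧
    walkG β ρ (graft y z.1 lineEnv) z.2 t = y ∧
    ∀ s < t, ¬ MeetsG β ρ h (graft y z.1 lineEnv) z.2 s}

lemma measurable_graft_const (y : Vertex) (η : Env) :
    Measurable fun z : Env × (ℕ → unitInterval) => (graft y z.1 η, z.2) :=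
  ((measurable_graft y).comp (measurable_fst.prodMk measurable_const)).prodMk measurable_snd

lemma measurableSet_regenAtPast (β ρ : ℝ) (h t : ℕ) (y : Vertex) :
    MeasurableSet (RegenAtPast β ρ h t y) :=
  measurableSet_and (measurable_snd (measurableSet_firstRegenPast β t))
    (measurable_graft_const y lineEnv (measurableSet_and
      (measurable_fst (measurableSet_mem_backbone y))
      (measurableSet_and (measurableSet_walkG_eq β ρ t y) (measurableSet_forall fun s =>
        measurableSet_forall fun _ => measurableSet_not (measurableSet_meetsG β ρ h s)))))

lemma walkG_concat (β ρ : ℝ) (ω : Env) (U U' : ℕ → unitInterval) {s t : ℕ} (hs : s ≤ t) :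
    walkG β ρ ω (concat t U U') s = walkG β ρ ω U s := by
  induction s with
  | zero => rfl
  | succ s ih => rw [walkG, walkG, ih (by omega), concat_of_lt (by omega)]

/-- Whether the walk regenerates at `y` at time `t` is decided by `RegenAtPast` together with
`Good` for the environment above `y` and the future of `t`. -/
lemma mem_regenAt_iff {β ρ : ℝ} (hβ : 1 < β) (hρ : ρ ≤ 1) (h t : ℕ) (y : Vertex)
    (z : Env × (ℕ → unitInterval)) :
    z ∈ RegenAt β ρ h t y ↔ z ∈ RegenAtPast β ρ h t y ∧ (sub z.1 y, shift t z.2) ∈ Good β := by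
  obtain ⟨ω, U⟩ := z
  set g := graft y ω lineEnv with hg
  have hag : AgreeOff y ω g := (agreeOff_graft y ω lineEnv).symm
  have hTree : InTree ω y ↔ InTree g y := inTree_congr hag (Or.inr rfl)
  have hgy : y ∈ backbone g ↔ InTree ω y := by
    rw [mem_backbone_iff, hg, sub_graft, ← hg, ← hTree]
    simp [lineEnv_mem_survival]
  -- off the descendants of `y` the two environments show the same path and the same traps
  have key : ∀ ω ω' : Env, AgreeOff y ω ω' → y ∈ backbone ω → y ∈ backbone ω' →
      IsLadder β U t → walkG β ρ ω U t = y → (∀ s < t, ¬ MeetsG β ρ h ω U s) →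
      walkG β ρ ω' U t = y ∧ ∀ s < t, ¬ MeetsG β ρ h ω' U s := by
    intro ω ω' hag hb hb' hl ht hs
    have h0 : ω ∈ survival := nil_mem_backbone.1 (mem_backbone_of_suffix hb List.nil_suffix)
    have hns : ∀ s < t, ¬ y <:+ walkG β ρ ω U s := fun s hst =>
      ht ▸ not_suffix_of_ladder hβ hρ h0 hl hst
    have hw := walkG_congr (U' := U) hag (iff_of_true hb hb') (fun _ _ => rfl) hns
    refine ⟨(hw t le_rfl).trans ht, fun s hst => ?_⟩
    have := hs s hst
    rwa [MeetsG, bigBuds_congr hag hb hb' (hns s hst), ← hw s hst.le] at this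
  simp only [RegenAt, RegenAtPast, Good, Set.mem_ofPred_eq, isFirstRegen_iff]
  constructor
  · rintro ⟨h0, ⟨hp, hr⟩, ht, hs⟩
    have hb : y ∈ backbone ω := ht ▸ walkG_mem_backbone β ρ h0 U t
    have hb2 := mem_backbone_iff.1 hb
    obtain ⟨k1, k2⟩ := key ω g hag hb (hgy.2 hb2.1) hp.2.2.1 ht hs
    exact ⟨⟨hp, hgy.2 hb2.1, k1, k2⟩, hb2.2, hr⟩
  · rintro ⟨⟨hp, hb, ht, hs⟩, h2, hr⟩
    have hb2 : y ∈ backbone ω := mem_backbone_iff.2 ⟨hgy.1 hb, h2⟩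
    obtain ⟨k1, k2⟩ := key g ω hag.symm hb hb2 hp.2.2.1 ht hs
    exact ⟨nil_mem_backbone.1 (mem_backbone_of_suffix hb2 List.nil_suffix), ⟨hp, hr⟩, k1, k2⟩

/-- The probability of meeting no big trap before the first super-regeneration time, up to the
factor `baseLaw p (Good β)`. -/
def lateProb (p : PMF ℕ) (β ρ : ℝ) (h : ℕ) : ENNReal :=
  ∑' ty : ℕ × Vertex, baseLaw p (RegenAtPast β ρ h ty.1 ty.2)

lemma setLIntegral_regenAt {β ρ : ℝ} (hβ : 1 < β) (hρ : ρ ≤ 1) (p : PMF ℕ) (h t : ℕ) (y : Vertex)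
    {Θ Θ' : Env × (ℕ → unitInterval) → ENNReal} (hΘ' : Measurable Θ')
    (hreg : ∀ z ∈ RegenAt β ρ h t y, Θ z = Θ' (sub z.1 y, shift t z.2)) :
    ∫⁻ z in RegenAt β ρ h t y, Θ z ∂baseLaw p =
      baseLaw p (RegenAtPast β ρ h t y) * ∫⁻ z in Good β, Θ' z ∂baseLaw p := by
  have hP := measurableSet_regenAtPast β ρ h t y
  rw [← lintegral_indicator (measurableSet_regenAt β ρ h t y),
    ← lintegral_indicator (measurableSet_good β), ← lintegral_indicator_one hP,
    ← lintegral_baseLaw_mul p t y (measurable_one.indicator hP)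
      (hΘ'.indicator (measurableSet_good β))]
  · refine lintegral_congr fun z => ?_
    have hiff := mem_regenAt_iff hβ hρ h t y z
    by_cases hz : z ∈ RegenAt β ρ h t y
    · obtain ⟨h1, h2⟩ := hiff.1 hz
      simp [hz, h1, h2, hreg z hz]
    · by_cases h1 : z ∈ RegenAtPast β ρ h t y
      · have h2 : (sub z.1 y, shift t z.2) ∉ Good β := fun h2 => hz (hiff.2 ⟨h1, h2⟩)
        simp [hz, h2]
      · simp [hz, h1]
  · intro ω η U
    have : (graft y ω η, U) ∈ RegenAtPast β ρ h t y ↔ (ω, U) ∈ RegenAtPast β ρ h t y := by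
      simp only [RegenAtPast, Set.mem_ofPred_eq, graft_graft]
    by_cases hz : (ω, U) ∈ RegenAtPast β ρ h t y
    · simp [hz, this.2 hz]
    · simp [hz, mt this.1 hz]
  · intro ω U U'
    have : (ω, concat t U U') ∈ RegenAtPast β ρ h t y ↔ (ω, U) ∈ RegenAtPast β ρ h t y := by
      simp only [RegenAtPast, Set.mem_ofPred_eq, concat_mem_firstRegenPast, walkG_concat _ _ _ _ _
        le_rfl]
      refine and_congr_right fun _ => and_congr_right fun _ => and_congr_right fun _ =>
        forall₂_congr fun s hs => ?_
      rw [MeetsG, MeetsG, walkG_concat _ _ _ _ _ hs.le]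
    by_cases hz : (ω, U) ∈ RegenAtPast β ρ h t y
    · simp [hz, this.2 hz]
    · simp [hz, mt this.1 hz]

lemma ae_mem_good_diff {β : ℝ} (hβ : 1 < β) (ρ : ℝ) (p : PMF ℕ) (h : ℕ) :
    (Good β \ EarlyMeet β ρ h : Set _) =ᵐ[baseLaw p]
      ⋃ ty : ℕ × Vertex, RegenAt β ρ h ty.1 ty.2 := by
  have hae : ∀ᵐ z ∂baseLaw p, IsSuperRegen β z.2 0 → ∀ n, ∃ s, n ≤ s ∧ IsSuperRegen β z.2 s :=
    Measure.quasiMeasurePreserving_snd.ae (ae_exists_regen_ge hβ)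
  filter_upwards [hae] with z hz
  refine propext ?_
  change (z ∈ Good β \ EarlyMeet β ρ h) ↔ (z ∈ ⋃ ty : ℕ × Vertex, RegenAt β ρ h ty.1 ty.2)
  simp only [Set.mem_sdiff, Set.mem_iUnion, Prod.exists]
  constructor
  · rintro ⟨⟨h0, hr⟩, he⟩
    obtain ⟨s, hs, hsr⟩ := hz hr 1
    obtain ⟨t, ht⟩ := exists_isFirstRegen hr ⟨s, hs, hsr⟩
    exact ⟨t, _, h0, ht, rfl, fun s hst hm => he ⟨s, (ht.noRegen_iff s).2 hst, hm⟩⟩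
  · rintro ⟨t, y, h0, ht, -, hs⟩
    refine ⟨⟨h0, ht.1⟩, ?_⟩
    rintro ⟨i, hi, hm⟩
    exact hs i ((ht.noRegen_iff i).1 hi) hm

/-- The renewal equation. -/
theorem setLIntegral_renewal {β ρ : ℝ} (hβ : 1 < β) (hρ : ρ ≤ 1) (p : PMF ℕ) (h : ℕ)
    {Θ Θ' : Env × (ℕ → unitInterval) → ENNReal} (hΘ' : Measurable Θ')
    (hreg : ∀ t y, ∀ z ∈ RegenAt β ρ h t y, Θ z = Θ' (sub z.1 y, shift t z.2)) :
    ∫⁻ z in Good β, Θ z ∂baseLaw p = ∫⁻ z in Good β ∩ EarlyMeet β ρ h, Θ z ∂baseLaw p +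
      lateProb p β ρ h * ∫⁻ z in Good β, Θ' z ∂baseLaw p := by
  rw [← lintegral_inter_add_sdiff Θ (Good β) (measurableSet_earlyMeet β ρ h)]
  congr 1
  rw [setLIntegral_congr (ae_mem_good_diff hβ ρ p h), lintegral_iUnion
    (s := fun ty : ℕ × Vertex => RegenAt β ρ h ty.1 ty.2)
    (fun ty => measurableSet_regenAt β ρ h ty.1 ty.2) ?_, lateProb, ← ENNReal.tsum_mul_right]
  · exact tsum_congr fun ty => setLIntegral_regenAt hβ hρ p h ty.1 ty.2 hΘ' (hreg ty.1 ty.2)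
  · rintro ⟨t, y⟩ ⟨t', y'⟩ hne
    refine Set.disjoint_left.2 ?_
    rintro z ⟨-, h1, h2, -⟩ ⟨-, h3, h4, -⟩
    dsimp only at h1 h2 h3 h4
    have := h1.unique h3
    subst this
    exact hne (Prod.ext rfl (h2.symm.trans h4))

lemma RegenAt.ne_nil {β ρ : ℝ} (hβ : 1 < β) (hρ : ρ ≤ 1) {h t : ℕ} {y : Vertex}
    {z : Env × (ℕ → unitInterval)} (hz : z ∈ RegenAt β ρ h t y) : y ≠ [] := by
  obtain ⟨h0, ht, hy, -⟩ := hz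
  have := length_lt_of_walkZ_lt (ρ := ρ) hβ hρ h0 z.2 (Nat.zero_le t) (ht.1.2 t ht.2.1)
  rintro rfl
  rw [hy] at this
  simp at this

/-- The first big trap met after a regeneration, and the local picture around it. -/
lemma trapObs_regen {β ρ : ℝ} (hβ : 1 < β) (hρ : ρ ≤ 1) (Ψ : ℕ → ℕ → ℝ → ENNReal) {h t : ℕ}
    {y : Vertex} {z : Env × (ℕ → unitInterval)} (hz : z ∈ RegenAt β ρ h t y) :
    trapObs β ρ h Ψ z.1 z.2 = trapObs β 1 h Ψ (sub z.1 y) (shift t z.2) := by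
  classical
  have hne := RegenAt.ne_nil hβ hρ hz
  obtain ⟨ω, U⟩ := z
  obtain ⟨h0, ht, hy, hs⟩ := hz
  dsimp only at h0 ht hy hs ⊢
  have hb : y ∈ backbone ω := hy ▸ walkG_mem_backbone β ρ h0 U t
  have hT := (mem_backbone_iff.1 hb).1
  have hr : IsSuperRegen β (shift t U) 0 := ((isFirstRegen_iff β U t).1 ht).2
  have hw := walkG_regen hβ hr hb hne hy
  have hmeet : ∀ s, MeetsG β ρ h ω U (t + s) ↔ MeetsG β 1 h (sub ω y) (shift t U) s := by
    intro s
    have hmem := walkG_mem_backbone β ρ h0 U (t + s)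
    rw [MeetsG, MeetsG, hw s]
    rw [hw s] at hmem
    rw [bigBuds_append hmem.1]
  by_cases hex : ∃ s, MeetsG β 1 h (sub ω y) (shift t U) s
  · have h1 := Nat.find_spec hex
    have h2 : ∀ j < Nat.find hex, ¬ MeetsG β 1 h (sub ω y) (shift t U) j :=
      fun j hj => Nat.find_min hex hj
    have h3 : ∀ j < t + Nat.find hex, ¬ MeetsG β ρ h ω U j := by
      intro j hj
      rcases lt_or_ge j t with hjt | hjt
      · exact hs j hjt
      · obtain ⟨s, rfl⟩ := Nat.exists_eq_add_of_le hjt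
        rw [hmeet]
        exact h2 s (by omega)
    rw [trapObs_eq Ψ h1 h2, trapObs_eq Ψ ((hmeet _).2 h1) h3, hw]
    set v := walkG β 1 (sub ω y) (shift t U) (Nat.find hex)
    unfold localObs
    have hN : numVisits β ρ ω U (v ++ y) = numVisits β 1 (sub ω y) (shift t U) v := by
      unfold numVisits
      have : {i | walkG β ρ ω U i = v ++ y} =
          (fun s => t + s) '' {s | walkG β 1 (sub ω y) (shift t U) s = v} := by
        ext i
        simp only [Set.mem_ofPred_eq, Set.mem_image]
        constructor
        · intro hi
          rcases lt_or_ge i t with hit | hit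
          · exfalso
            refine not_suffix_of_ladder hβ hρ h0 ht.2.2.1.1 hit ?_
            rw [hi, hy]
            exact List.suffix_append v y
          · obtain ⟨s, rfl⟩ := Nat.exists_eq_add_of_le hit
            rw [hw s] at hi
            exact ⟨s, List.append_cancel_right hi, rfl⟩
        · rintro ⟨s, hs', rfl⟩
          rw [hw s, hs']
      rw [this, Set.ncard_image_of_injective _ (add_right_injective t)]
    rw [hN, backboneChildren_append hT, rootWeight_one, rootWeight_of_ne_nil ρ (by simp [hne])]
  · have hex2 : ¬ ∃ i, MeetsG β ρ h ω U i := by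
      rintro ⟨i, hi⟩
      rcases lt_or_ge i t with hit | hit
      · exact hs i hit hi
      · obtain ⟨s, rfl⟩ := Nat.exists_eq_add_of_le hit
        exact hex ⟨s, (hmeet s).1 hi⟩
    rw [trapObs, trapObs, if_neg hex, if_neg hex2]

theorem trapObs_renewal {β ρ : ℝ} (hβ : 1 < β) (hρ : ρ ≤ 1) (p : PMF ℕ) (h : ℕ)
    (Ψ : ℕ → ℕ → ℝ → ENNReal) :
    ∫⁻ z in Good β, trapObs β ρ h Ψ z.1 z.2 ∂baseLaw p =
      ∫⁻ z in Good β ∩ EarlyMeet β ρ h, trapObs β ρ h Ψ z.1 z.2 ∂baseLaw p +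
      lateProb p β ρ h * ∫⁻ z in Good β, trapObs β 1 h Ψ z.1 z.2 ∂baseLaw p :=
  setLIntegral_renewal hβ hρ p h (Θ := fun z => trapObs β ρ h Ψ z.1 z.2)
    (Θ' := fun z => trapObs β 1 h Ψ z.1 z.2) (measurable_trapObs β 1 h Ψ)
    fun _ _ _ hz => trapObs_regen hβ hρ Ψ hz

theorem measure_good_renewal {β ρ : ℝ} (hβ : 1 < β) (hρ : ρ ≤ 1) (p : PMF ℕ) (h : ℕ) :
    baseLaw p (Good β) = baseLaw p (Good β ∩ EarlyMeet β ρ h) +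
      lateProb p β ρ h * baseLaw p (Good β) := by
  have := setLIntegral_renewal hβ hρ p h (Θ := fun _ => 1) (Θ' := fun _ => 1) measurable_const
    fun _ _ _ _ => rfl
  simpa using this

/-! ### Separating the first big trap from its surroundings -/

/-- The environment without any child. -/
def leafEnv : Env := fun _ => 0

lemma leafEnv_not_mem_survival : leafEnv ∉ survival :=
  not_survival_iff.2 fun i hi => absurd hi (by simp [leafEnv])

/-- The first big trap is met at time `i` at the vertex `y`, and the leftmost one rooted there has
the bud `j :: y`. -/
def FirstTrapAt (β ρ : ℝ) (h i : ℕ) (y : Vertex) (j : ℕ) : Set (Env × (ℕ → unitInterval)) :=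
  {z | z.1 ∈ survival ∧ walkG β ρ z.1 z.2 i = y ∧ (∀ i' < i, ¬ MeetsG β ρ h z.1 z.2 i') ∧
    j ∈ bigBuds z.1 h y ∧ ∀ j' < j, j' ∉ bigBuds z.1 h y}

/-- What `FirstTrapAt` says about the environment with the trap at `j :: y` reduced to its bud. -/
def TrapPast (β ρ : ℝ) (h i : ℕ) (y : Vertex) (j : ℕ) : Set (Env × (ℕ → unitInterval)) :=
  {z | y ∈ backbone z.1 ∧ walkG β ρ z.1 z.2 i = y ∧
    (∀ i' < i, walkG β ρ z.1 z.2 i' ≠ y ∧ ¬ MeetsG β ρ h z.1 z.2 i') ∧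
    j < z.1 y ∧ ∀ j' < j, j' ∉ bigBuds z.1 h y}

/-- The limit of `TrapPast` for high traps: `y` is visited first at time `i`, and has a child
`j`. -/
def FirstVisit (β ρ : ℝ) (i : ℕ) (y : Vertex) (j : ℕ) : Set (Env × (ℕ → unitInterval)) :=
  {z | y ∈ backbone z.1 ∧ walkG β ρ z.1 z.2 i = y ∧ (∀ i' < i, walkG β ρ z.1 z.2 i' ≠ y) ∧
    j < z.1 y}

/-- The environment in which `b` and all its descendants have no children, so that `b` becomes a
leaf. -/
def prune (b : Vertex) (z : Env × (ℕ → unitInterval)) : Env × (ℕ → unitInterval) :=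
  (graft b z.1 leafEnv, z.2)

lemma measurable_prune (b : Vertex) : Measurable (prune b) := measurable_graft_const b leafEnv

lemma not_mem_backbone_prune (b : Vertex) (z : Env × (ℕ → unitInterval)) :
    b ∉ backbone (prune b z).1 := by
  intro h
  have := (mem_backbone_iff.1 h).2
  rw [prune, sub_graft] at this
  exact leafEnv_not_mem_survival this

lemma agreeOff_prune (b : Vertex) (z : Env × (ℕ → unitInterval)) : AgreeOff b z.1 (prune b z).1 :=
  (agreeOff_graft b z.1 leafEnv).symm

lemma mem_firstTrapAt_iff (β ρ : ℝ) (h i : ℕ) (y : Vertex) (j : ℕ)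
    (z : Env × (ℕ → unitInterval)) :
    z ∈ FirstTrapAt β ρ h i y j ↔
      prune (j :: y) z ∈ TrapPast β ρ h i y j ∧ sub z.1 (j :: y) ∈ tall h := by
  have hag := agreeOff_prune (j :: y) z
  have hb' := not_mem_backbone_prune (j :: y) z
  have h2 : (prune (j :: y) z).2 = z.2 := rfl
  obtain ⟨ω, U⟩ := z
  generalize prune (j :: y) (ω, U) = z' at hag hb' h2 ⊢
  obtain ⟨ω', U'⟩ := z'
  dsimp only at hag hb' h2
  subst h2
  simp only [FirstTrapAt, TrapPast, Set.mem_ofPred_eq]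
  have hys : ¬ (j :: y) <:+ y := not_cons_suffix_self j y
  -- transfer of the path and of the earlier traps between the two environments
  have key : ∀ ω ω' : Env, AgreeOff (j :: y) ω ω' → y ∈ backbone ω → j :: y ∉ backbone ω →
      j :: y ∉ backbone ω' → (∀ i, walkG β ρ ω' U' i = walkG β ρ ω U' i) ∧
      (∀ i, walkG β ρ ω U' i ≠ y → MeetsG β ρ h ω' U' i → MeetsG β ρ h ω U' i) ∧
      (∀ j' < j, j' ∈ bigBuds ω' h y → j' ∈ bigBuds ω h y) := by
    intro ω ω' hag hy hb hb'
    have h0 : ω ∈ survival := nil_mem_backbone.1 (mem_backbone_of_suffix hy List.nil_suffix)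
    have hw := walkG_congr_bud (β := β) (ρ := ρ) hag h0 hb hb' U'
    refine ⟨hw, fun i hi => ?_, fun j' hj' => ?_⟩
    · rw [MeetsG, hw, MeetsG]
      rintro ⟨k, hk⟩
      refine ⟨k, (mem_bigBuds_congr hag hy hb hb' (fun hs => hb ?_) ?_ h).2 hk⟩
      · exact mem_backbone_of_suffix (walkG_mem_backbone β ρ h0 U' i) hs
      · rintro ⟨⟩; exact hi rfl
    · refine (mem_bigBuds_congr hag hy hb hb' hys ?_ h).2
      rintro ⟨⟩; omega
  constructor
  · rintro ⟨h0, hi, hlt, hj, hlj⟩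
    have hy : y ∈ backbone ω := hi ▸ walkG_mem_backbone β ρ h0 U' i
    have hj2 := (mem_bigBuds_iff hy.1).1 hj
    have hb : j :: y ∉ backbone ω := (mem_buds.1 hj.1).2
    obtain ⟨k1, k2, k3⟩ := key ω ω' hag hy hb hb'
    have hne : ∀ i' < i, walkG β ρ ω U' i' ≠ y := by
      rintro i' hi' rfl
      exact hlt i' hi' ⟨j, hj⟩
    refine ⟨⟨(backbone_congr hag (iff_of_false hb hb') hys).1 hy, (k1 i).trans hi,
      fun i' hi' => ⟨by rw [k1]; exact hne i' hi', fun hm => hlt i' hi' (k2 i' (hne i' hi') hm)⟩,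
      ?_, fun j' hj' hm => hlj j' hj' (k3 j' hj' hm)⟩, hj2.2⟩
    rw [← hag y hys]
    exact hj2.1
  · rintro ⟨⟨hy', hi, hlt, hj, hlj⟩, ht⟩
    have hb : j :: y ∉ backbone ω := fun hb => ht.1 (mem_backbone_iff.1 hb).2
    have hy : y ∈ backbone ω := (backbone_congr hag (iff_of_false hb hb') hys).2 hy'
    obtain ⟨k1, k2, k3⟩ := key ω' ω hag.symm hy' hb' hb
    refine ⟨nil_mem_backbone.1 (mem_backbone_of_suffix hy List.nil_suffix), (k1 i).trans hi,
      fun i' hi' hm => (hlt i' hi').2 (k2 i' (hlt i' hi').1 hm), ?_,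
      fun j' hj' hm => hlj j' hj' (k3 j' hj' hm)⟩
    rw [mem_bigBuds_iff hy.1, hag y hys]
    exact ⟨hj, ht⟩

lemma localObs_prune {β ρ : ℝ} (Ψ : ℕ → ℕ → ℝ → ENNReal) {y : Vertex} {j : ℕ}
    {z : Env × (ℕ → unitInterval)} (h0 : z.1 ∈ survival) (hb : j :: y ∉ backbone z.1) :
    localObs β ρ Ψ z.1 z.2 y = localObs β ρ Ψ (prune (j :: y) z).1 (prune (j :: y) z).2 y := by
  have hag := agreeOff_prune (j :: y) z
  have hb' := not_mem_backbone_prune (j :: y) z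
  have hw := walkG_congr_bud (β := β) (ρ := ρ) hag h0 hb hb' z.2
  have h2 : (prune (j :: y) z).2 = z.2 := rfl
  unfold localObs numVisits
  rw [h2, backboneChildren_congr hag (iff_of_false hb hb') (not_cons_suffix_self j y)]
  simp only [hw]

lemma measurableSet_trapPast (β ρ : ℝ) (h i : ℕ) (y : Vertex) (j : ℕ) :
    MeasurableSet (TrapPast β ρ h i y j) :=
  measurableSet_and (measurable_fst (measurableSet_mem_backbone y)) (measurableSet_and
    (measurableSet_walkG_eq β ρ i y) (measurableSet_and (measurableSet_forall fun i' =>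
      measurableSet_forall fun _ => measurableSet_and
        (measurableSet_not (measurableSet_walkG_eq β ρ i' y))
        (measurableSet_not (measurableSet_meetsG β ρ h i')))
      (measurableSet_and (measurableSet_lt measurable_const
        ((measurable_pi_apply y).comp measurable_fst)) (measurableSet_forall fun j' =>
        measurableSet_forall fun _ => measurableSet_not
          (measurable_fst (measurableSet_mem_bigBuds h y j'))))))

lemma measurableSet_firstVisit (β ρ : ℝ) (i : ℕ) (y : Vertex) (j : ℕ) :
    MeasurableSet (FirstVisit β ρ i y j) :=
  measurableSet_and (measurable_fst (measurableSet_mem_backbone y)) (measurableSet_and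
    (measurableSet_walkG_eq β ρ i y) (measurableSet_and (measurableSet_forall fun i' =>
      measurableSet_forall fun _ => measurableSet_not (measurableSet_walkG_eq β ρ i' y))
      (measurableSet_lt measurable_const ((measurable_pi_apply y).comp measurable_fst))))

lemma measurableSet_firstTrapAt (β ρ : ℝ) (h i : ℕ) (y : Vertex) (j : ℕ) :
    MeasurableSet (FirstTrapAt β ρ h i y j) :=
  measurableSet_and (measurable_fst measurableSet_survival) (measurableSet_and
    (measurableSet_walkG_eq β ρ i y) (measurableSet_and (measurableSet_forall fun i' =>
      measurableSet_forall fun _ => measurableSet_not (measurableSet_meetsG β ρ h i'))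
      (measurableSet_and (measurable_fst (measurableSet_mem_bigBuds h y j))
        (measurableSet_forall fun j' => measurableSet_forall fun _ => measurableSet_not
          (measurable_fst (measurableSet_mem_bigBuds h y j'))))))

/-- `0` is a super-regeneration time and there is none in `(0, i]`. -/
def NotYet (β : ℝ) (i : ℕ) : Set (ℕ → unitInterval) := {U | IsSuperRegen β U 0 ∧ NoRegen β U i}

lemma measurableSet_notYet (β : ℝ) (i : ℕ) : MeasurableSet (NotYet β i) :=
  measurableSet_and (measurableSet_isSuperRegen β 0) (measurableSet_noRegen β i)

lemma good_inter_earlyMeet (β ρ : ℝ) (h : ℕ) :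
    Good β ∩ EarlyMeet β ρ h =
      ⋃ x : ℕ × Vertex × ℕ, Prod.snd ⁻¹' NotYet β x.1 ∩ FirstTrapAt β ρ h x.1 x.2.1 x.2.2 := by
  classical
  ext z
  simp only [Set.mem_inter_iff, Set.mem_iUnion, Prod.exists]
  constructor
  · rintro ⟨⟨h0, hr⟩, i, hi, hm⟩
    have hex : ∃ i, MeetsG β ρ h z.1 z.2 i := ⟨i, hm⟩
    have hex2 : ∃ j, j ∈ bigBuds z.1 h (walkG β ρ z.1 z.2 (Nat.find hex)) := Nat.find_spec hex
    refine ⟨Nat.find hex, _, Nat.find hex2, ⟨hr, fun s hs hsi => hi s hs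
      (hsi.trans (Nat.find_min' hex hm))⟩, h0, rfl, fun i' hi' => Nat.find_min hex hi',
      Nat.find_spec hex2, fun j' hj' => Nat.find_min hex2 hj'⟩
  · rintro ⟨i, y, j, ⟨hr, hn⟩, h0, hi, -, hj, -⟩
    exact ⟨⟨h0, hr⟩, i, hn, ⟨j, hi ▸ hj⟩⟩

lemma FirstTrapAt.unique {β ρ : ℝ} {h i i' j j' : ℕ} {y y' : Vertex}
    {z : Env × (ℕ → unitInterval)} (h1 : z ∈ FirstTrapAt β ρ h i y j)
    (h2 : z ∈ FirstTrapAt β ρ h i' y' j') : (i, y, j) = (i', y', j') := by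
  obtain ⟨-, a1, a2, a3, a4⟩ := h1
  obtain ⟨-, b1, b2, b3, b4⟩ := h2
  have hi : i = i' := by
    rcases lt_trichotomy i i' with hlt | rfl | hlt
    · exact absurd ⟨j, a1 ▸ a3⟩ (b2 i hlt)
    · rfl
    · exact absurd ⟨j', b1 ▸ b3⟩ (a2 i' hlt)
  subst hi
  have hy : y = y' := a1.symm.trans b1
  subst hy
  have hj : j = j' := by
    rcases lt_trichotomy j j' with hlt | rfl | hlt
    · exact absurd a3 (b4 j hlt)
    · rfl
    · exact absurd b3 (a4 j' hlt)
  rw [hj]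

/-- The integrals of the local picture over the events that the trap at `j :: y`, seen first at
time `i`, is the first big one, once the factor for its height is taken out. -/
def trapTerm (p : PMF ℕ) (β ρ : ℝ) (Ψ : ℕ → ℕ → ℝ → ENNReal) (h : ℕ) (x : ℕ × Vertex × ℕ) :
    ENNReal :=
  ∫⁻ z in Prod.snd ⁻¹' NotYet β x.1 ∩ prune (x.2.2 :: x.2.1) ⁻¹' TrapPast β ρ h x.1 x.2.1 x.2.2,
    localObs β ρ Ψ (prune (x.2.2 :: x.2.1) z).1 (prune (x.2.2 :: x.2.1) z).2 x.2.1 ∂baseLaw p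

/-- The limit of `trapTerm` for high traps. -/
def trapTermLim (p : PMF ℕ) (β ρ : ℝ) (Ψ : ℕ → ℕ → ℝ → ENNReal) (x : ℕ × Vertex × ℕ) :
    ENNReal :=
  ∫⁻ z in Prod.snd ⁻¹' NotYet β x.1 ∩ prune (x.2.2 :: x.2.1) ⁻¹' FirstVisit β ρ x.1 x.2.1 x.2.2,
    localObs β ρ Ψ (prune (x.2.2 :: x.2.1) z).1 (prune (x.2.2 :: x.2.1) z).2 x.2.1 ∂baseLaw p

/-- Independence of the environment above `b`, integrated over the driving variables. -/
theorem lintegral_baseLaw_mul_sub (p : PMF ℕ) (b : Vertex)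
    {f : Env × (ℕ → unitInterval) → ENNReal} {g : Env → ENNReal} (hf : Measurable f)
    (hg : Measurable g) (h1 : ∀ ω η U, f (graft b ω η, U) = f (ω, U)) :
    ∫⁻ z, f z * g (sub z.1 b) ∂baseLaw p =
      (∫⁻ z, f z ∂baseLaw p) * ∫⁻ ω, g ω ∂offspringLaw p := by
  have hm : Measurable fun z : Env × (ℕ → unitInterval) => f z * g (sub z.1 b) :=
    hf.mul (hg.comp ((measurable_sub b).comp measurable_fst))
  unfold baseLaw
  rw [lintegral_prod_symm' _ hm, lintegral_prod_symm' _ hf,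
    ← lintegral_mul_const _ hf.lintegral_prod_left']
  exact lintegral_congr fun U => lintegral_offspringLaw_mul_sub p b (f := fun ω => f (ω, U))
    (hf.comp measurable_prodMk_right) hg fun ω η => h1 ω η U

lemma prune_graft (b : Vertex) (ω η : Env) (U : ℕ → unitInterval) :
    prune b (graft b ω η, U) = prune b (ω, U) := by
  simp only [prune, graft_graft]

lemma setLIntegral_firstTrapAt (p : PMF ℕ) (β ρ : ℝ) (Ψ : ℕ → ℕ → ℝ → ENNReal) (h : ℕ)
    (x : ℕ × Vertex × ℕ) :
    ∫⁻ z in Prod.snd ⁻¹' NotYet β x.1 ∩ FirstTrapAt β ρ h x.1 x.2.1 x.2.2,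
      trapObs β ρ h Ψ z.1 z.2 ∂baseLaw p =
    offspringLaw p (tall h) * trapTerm p β ρ Ψ h x := by
  obtain ⟨i, y, j⟩ := x
  dsimp only [trapTerm]
  set A : Set (Env × (ℕ → unitInterval)) :=
    Prod.snd ⁻¹' NotYet β i ∩ prune (j :: y) ⁻¹' TrapPast β ρ h i y j with hA
  have hN : MeasurableSet (Prod.snd ⁻¹' NotYet β i : Set (Env × (ℕ → unitInterval))) :=
    measurable_snd (measurableSet_notYet β i)
  have hAm : MeasurableSet A :=
    hN.inter (measurable_prune _ (measurableSet_trapPast β ρ h i y j))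
  have hobs : Measurable fun z => localObs β ρ Ψ (prune (j :: y) z).1 (prune (j :: y) z).2 y :=
    (measurable_localObs β ρ Ψ y).comp (measurable_prune (j :: y))
  rw [← lintegral_indicator (hN.inter (measurableSet_firstTrapAt β ρ h i y j)),
    ← lintegral_indicator hAm, ← lintegral_indicator_one (measurableSet_tall h), mul_comm,
    ← lintegral_baseLaw_mul_sub p (j :: y) (hobs.indicator hAm)
      (measurable_one.indicator (measurableSet_tall h))]
  · refine lintegral_congr fun z => ?_
    have hiff := mem_firstTrapAt_iff β ρ h i y j z
    by_cases hzN : z ∈ (Prod.snd ⁻¹' NotYet β i : Set (Env × (ℕ → unitInterval)))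
    · by_cases hz : z ∈ FirstTrapAt β ρ h i y j
      · obtain ⟨h1, h2⟩ := hiff.1 hz
        have hzA : z ∈ A := ⟨hzN, h1⟩
        rw [Set.indicator_of_mem (show z ∈ _ ∩ _ from ⟨hzN, hz⟩), Set.indicator_of_mem hzA,
          Set.indicator_of_mem h2, Pi.one_apply, mul_one]
        have hj := hz.2.2.2.1
        rw [trapObs_eq Ψ (i := i) ⟨j, by rw [hz.2.1]; exact hj⟩ hz.2.2.1, hz.2.1]
        exact localObs_prune Ψ hz.1 (mem_buds.1 hj.1).2
      · rw [Set.indicator_of_notMem fun hh => hz hh.2]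
        by_cases hzA : z ∈ A
        · have h2 : sub z.1 (j :: y) ∉ tall h := fun h2 => hz (hiff.2 ⟨hzA.2, h2⟩)
          simp [h2]
        · simp [hzA]
    · rw [Set.indicator_of_notMem fun hh => hzN hh.1,
        Set.indicator_of_notMem (s := A) fun hh => hzN hh.1, zero_mul]
  · intro ω η U
    have hp := prune_graft (j :: y) ω η U
    have hmem : (graft (j :: y) ω η, U) ∈ A ↔ (ω, U) ∈ A := by
      simp only [hA, Set.mem_inter_iff, Set.mem_preimage, hp]
    by_cases hz : (ω, U) ∈ A
    · rw [Set.indicator_of_mem hz, Set.indicator_of_mem (hmem.2 hz), hp]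
    · rw [Set.indicator_of_notMem hz, Set.indicator_of_notMem (mt hmem.1 hz)]

/-- The height of the first big trap contributes the factor `offspringLaw p (tall h)`. -/
theorem setLIntegral_earlyMeet (p : PMF ℕ) (β ρ : ℝ) (Ψ : ℕ → ℕ → ℝ → ENNReal) (h : ℕ) :
    ∫⁻ z in Good β ∩ EarlyMeet β ρ h, trapObs β ρ h Ψ z.1 z.2 ∂baseLaw p =
      offspringLaw p (tall h) * ∑' x, trapTerm p β ρ Ψ h x := by
  rw [good_inter_earlyMeet, lintegral_iUnion
    (s := fun x : ℕ × Vertex × ℕ =>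
      Prod.snd ⁻¹' NotYet β x.1 ∩ FirstTrapAt β ρ h x.1 x.2.1 x.2.2)
    (fun x => (measurable_snd (measurableSet_notYet β x.1)).inter
      (measurableSet_firstTrapAt β ρ h x.1 x.2.1 x.2.2)), ← ENNReal.tsum_mul_left]
  · exact tsum_congr fun x => setLIntegral_firstTrapAt p β ρ Ψ h x
  · rintro ⟨i, y, j⟩ ⟨i', y', j'⟩ hne
    exact Set.disjoint_left.2 fun z h1 h2 => hne (FirstTrapAt.unique h1.2 h2.2)

/-! ### High traps -/

lemma bigBuds_antitone (ω : Env) (x : Vertex) : Antitone fun h => bigBuds ω h x :=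
  fun _ _ hab _ hi => ⟨hi.1, hab.trans hi.2⟩

lemma trapPast_mono (β ρ : ℝ) (i : ℕ) (y : Vertex) (j : ℕ) :
    Monotone fun h => TrapPast β ρ h i y j := by
  rintro a b hab z ⟨h1, h2, h3, h4, h5⟩
  refine ⟨h1, h2, fun i' hi' => ⟨(h3 i' hi').1, fun hm => (h3 i' hi').2 ?_⟩, h4,
    fun j' hj' hm => h5 j' hj' (bigBuds_antitone _ _ hab hm)⟩
  exact hm.mono (bigBuds_antitone _ _ hab)

lemma exists_bigBuds_eq_empty (ω : Env) (x : Vertex) : ∃ h, bigBuds ω h x = ∅ := by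
  classical
  refine ⟨(Finset.range (ω x)).sup (fun i => trapHeight ω (i :: x)) + 1, ?_⟩
  ext i
  simp only [Set.mem_empty_iff_false, iff_false]
  rintro ⟨hi, hh⟩
  have := Finset.le_sup (f := fun i => trapHeight ω (i :: x))
    (Finset.mem_range.2 (mem_buds.1 hi).1)
  omega

/-- For any fixed vertices, sufficiently high traps are not rooted at them. -/
lemma iUnion_trapPast (β ρ : ℝ) (i : ℕ) (y : Vertex) (j : ℕ) :
    ⋃ h, TrapPast β ρ h i y j = FirstVisit β ρ i y j := by
  ext z
  simp only [Set.mem_iUnion]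
  constructor
  · rintro ⟨h, h1, h2, h3, h4, -⟩
    exact ⟨h1, h2, fun i' hi' => (h3 i' hi').1, h4⟩
  · rintro ⟨h1, h2, h3, h4⟩
    choose H hH using fun x => exists_bigBuds_eq_empty z.1 x
    have hbig : ∀ x h, H x ≤ h → bigBuds z.1 h x = ∅ := fun x h hh =>
      Set.subset_eq_empty (bigBuds_antitone z.1 x hh) (hH x)
    refine ⟨(Finset.range (i + 1)).sup fun i' => H (walkG β ρ z.1 z.2 i'), h1, h2,
      fun i' hi' => ⟨h3 i' hi', ?_⟩, h4, ?_⟩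
    · rw [MeetsG, hbig]
      · simp
      · exact Finset.le_sup (f := fun i' => H (walkG β ρ z.1 z.2 i'))
          (Finset.mem_range.2 (by omega))
    · intro j' _
      rw [hbig]
      · simp
      · have := Finset.le_sup (f := fun i' => H (walkG β ρ z.1 z.2 i'))
          (Finset.mem_range.2 (Nat.lt_succ_self i))
        rwa [h2] at this

lemma trapTerm_mono (p : PMF ℕ) (β ρ : ℝ) (Ψ : ℕ → ℕ → ℝ → ENNReal) (x : ℕ × Vertex × ℕ) :
    Monotone fun h => trapTerm p β ρ Ψ h x := fun _ _ hab =>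
  lintegral_mono_set (Set.inter_subset_inter_right _
    (Set.preimage_mono (trapPast_mono β ρ _ _ _ hab)))

lemma iSup_trapTerm (p : PMF ℕ) (β ρ : ℝ) (Ψ : ℕ → ℕ → ℝ → ENNReal) (x : ℕ × Vertex × ℕ) :
    ⨆ h, trapTerm p β ρ Ψ h x = trapTermLim p β ρ Ψ x := by
  unfold trapTerm trapTermLim
  rw [← iUnion_trapPast, Set.preimage_iUnion, Set.inter_iUnion, setLIntegral_iUnion_of_directed]
  refine Monotone.directed_le fun a b hab => Set.inter_subset_inter_right _
    (Set.preimage_mono (trapPast_mono β ρ _ _ _ hab))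

/-- Monotone convergence for high traps. -/
theorem tendsto_tsum_trapTerm (p : PMF ℕ) (β ρ : ℝ) (Ψ : ℕ → ℕ → ℝ → ENNReal) :
    Tendsto (fun h => ∑' x, trapTerm p β ρ Ψ h x) atTop (𝓝 (∑' x, trapTermLim p β ρ Ψ x)) := by
  have hmono : Monotone fun h => ∑' x, trapTerm p β ρ Ψ h x := fun a b hab =>
    ENNReal.tsum_le_tsum fun x => trapTerm_mono p β ρ Ψ x hab
  have h := tendsto_atTop_iSup hmono
  convert h using 2
  simp only [← lintegral_count, ← iSup_trapTerm]
  exact lintegral_iSup (fun h => Measurable.of_discrete)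
    fun a b hab x => trapTerm_mono p β ρ Ψ x hab

/-! ### Finiteness and positivity of the limit -/

/-- The part of the event that `y` is visited first at time `i` which concerns the environment off
the descendants of `y`. -/
def FirstVisitPast (β ρ : ℝ) (i : ℕ) (y : Vertex) : Set (Env × (ℕ → unitInterval)) :=
  {z | y ∈ backbone (graft y z.1 lineEnv) ∧ walkG β ρ (graft y z.1 lineEnv) z.2 i = y ∧
    ∀ i' < i, walkG β ρ (graft y z.1 lineEnv) z.2 i' ≠ y}

lemma measurableSet_firstVisitPast (β ρ : ℝ) (i : ℕ) (y : Vertex) :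
    MeasurableSet (FirstVisitPast β ρ i y) :=
  measurable_graft_const y lineEnv (measurableSet_and
    (measurable_fst (measurableSet_mem_backbone y)) (measurableSet_and
    (measurableSet_walkG_eq β ρ i y) (measurableSet_forall fun i' =>
      measurableSet_forall fun _ => measurableSet_not (measurableSet_walkG_eq β ρ i' y))))

lemma walkG_congr_firstVisit {β ρ : ℝ} {y : Vertex} {ω ω' : Env} (hag : AgreeOff y ω ω')
    (hy : y ∈ backbone ω) (hy' : y ∈ backbone ω') {U : ℕ → unitInterval} {i : ℕ}
    (hi : walkG β ρ ω U i = y) (hlt : ∀ i' < i, walkG β ρ ω U i' ≠ y) :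
    ∀ i' ≤ i, walkG β ρ ω' U i' = walkG β ρ ω U i' := by
  by_cases hne : y = []
  · have h0 : i = 0 := by
      by_contra h0
      exact hlt 0 (by omega) hne.symm
    subst h0
    intro i' hi'
    rw [Nat.le_zero.1 hi']
    rfl
  · exact walkG_congr hag (iff_of_true hy hy') (fun _ _ => rfl)
      (not_suffix_of_not_visited hne hlt)

lemma prune_firstVisit {β ρ : ℝ} {i j : ℕ} {y : Vertex} {z : Env × (ℕ → unitInterval)}
    (hz : prune (j :: y) z ∈ FirstVisit β ρ i y j) : j < z.1 y ∧ z ∈ FirstVisitPast β ρ i y := by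
  obtain ⟨h1, h2, h3, h4⟩ := hz
  have hag := agreeOff_prune (j :: y) z
  have hys : ¬ (j :: y) <:+ y := not_cons_suffix_self j y
  refine ⟨by rw [hag y hys]; exact h4, ?_⟩
  have hag' : AgreeOff y (prune (j :: y) z).1 (graft y z.1 lineEnv) := fun v hv => by
    rw [graft_of_not_suffix hv, ← hag v fun hs => hv ((List.suffix_cons j y).trans hs)]
  have hyg : y ∈ backbone (graft y z.1 lineEnv) := by
    rw [mem_backbone_iff, sub_graft, ← inTree_congr hag' (Or.inr rfl)]
    exact ⟨h1.1, lineEnv_mem_survival⟩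
  have hw := walkG_congr_firstVisit hag' h1 hyg h2 h3
  refine ⟨hyg, (hw i le_rfl).trans h2, fun i' hi' => ?_⟩
  exact (hw i' hi'.le).symm ▸ h3 i' hi'

lemma firstVisitPast_walkG {β ρ : ℝ} {i : ℕ} {y : Vertex} {z : Env × (ℕ → unitInterval)}
    (hz : z ∈ FirstVisitPast β ρ i y) (hs : sub z.1 y ∈ survival) : walkG β ρ z.1 z.2 i = y := by
  obtain ⟨h1, h2, h3⟩ := hz
  have hag := agreeOff_graft y z.1 lineEnv
  have hy : y ∈ backbone z.1 :=
    mem_backbone_iff.2 ⟨(inTree_congr hag (Or.inr rfl)).1 h1.1, hs⟩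
  rw [walkG_congr_firstVisit hag h1 hy h2 h3 i le_rfl, h2]

lemma graft_firstVisitPast (β ρ : ℝ) (i : ℕ) (y : Vertex) (ω η : Env) (U : ℕ → unitInterval) :
    (graft y ω η, U) ∈ FirstVisitPast β ρ i y ↔ (ω, U) ∈ FirstVisitPast β ρ i y := by
  simp only [FirstVisitPast, Set.mem_ofPred_eq, graft_graft]

lemma lintegral_firstVisitPast_mul (p : PMF ℕ) (β ρ : ℝ) (i : ℕ) (y : Vertex) {g : Env → ENNReal}
    (hg : Measurable g) :
    ∫⁻ z in Prod.snd ⁻¹' NotYet β i ∩ FirstVisitPast β ρ i y, g (sub z.1 y) ∂baseLaw p =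
      baseLaw p (Prod.snd ⁻¹' NotYet β i ∩ FirstVisitPast β ρ i y) *
        ∫⁻ ω, g ω ∂offspringLaw p := by
  set B : Set (Env × (ℕ → unitInterval)) :=
    Prod.snd ⁻¹' NotYet β i ∩ FirstVisitPast β ρ i y with hB
  have hBm : MeasurableSet B := (measurable_snd (measurableSet_notYet β i)).inter
    (measurableSet_firstVisitPast β ρ i y)
  rw [← lintegral_indicator hBm, ← lintegral_indicator_one hBm,
    ← lintegral_baseLaw_mul_sub p y (measurable_one.indicator hBm) hg]
  · refine lintegral_congr fun z => ?_
    by_cases hz : z ∈ B <;> simp [hz]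
  · intro ω η U
    have hmem : (graft y ω η, U) ∈ B ↔ (ω, U) ∈ B :=
      and_congr Iff.rfl (graft_firstVisitPast β ρ i y ω η U)
    by_cases hz : (ω, U) ∈ B
    · rw [Set.indicator_of_mem hz, Set.indicator_of_mem (hmem.2 hz), Pi.one_apply, Pi.one_apply]
    · rw [Set.indicator_of_notMem hz, Set.indicator_of_notMem (mt hmem.1 hz)]

lemma tsum_lt_indicator (n : ℕ) : ∑' j : ℕ, (if j < n then (1 : ENNReal) else 0) = n := by
  rw [tsum_eq_sum (s := Finset.range n) (fun j hj => by simpa using hj)]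
  rw [Finset.sum_congr rfl fun j hj => if_pos (Finset.mem_range.1 hj)]
  simp

/-- Summing over the children `j` brings in the mean number of children of `y`. -/
lemma tsum_trapTermLim_le (p : PMF ℕ) (β ρ : ℝ) (i : ℕ) (y : Vertex) :
    ∑' j, trapTermLim p β ρ (fun _ _ _ => 1) (i, y, j) ≤
      baseLaw p (Prod.snd ⁻¹' NotYet β i ∩ FirstVisitPast β ρ i y) *
        ∫⁻ ω, (ω [] : ENNReal) ∂offspringLaw p := by
  have hg : Measurable fun ω : Env => (ω [] : ENNReal) :=
    (Measurable.of_discrete (f := fun n : ℕ => (n : ENNReal))).comp (measurable_pi_apply [])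
  rw [← lintegral_firstVisitPast_mul p β ρ i y hg]
  have hle : ∀ j, trapTermLim p β ρ (fun _ _ _ => 1) (i, y, j) ≤
      ∫⁻ z in Prod.snd ⁻¹' NotYet β i ∩ FirstVisitPast β ρ i y,
        (if j < z.1 y then (1 : ENNReal) else 0) ∂baseLaw p := by
    intro j
    have hm : MeasurableSet (Prod.snd ⁻¹' NotYet β i ∩
        prune (j :: y) ⁻¹' FirstVisit β ρ i y j : Set (Env × (ℕ → unitInterval))) :=
      (measurable_snd (measurableSet_notYet β i)).inter
        (measurable_prune _ (measurableSet_firstVisit β ρ i y j))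
    have hm' : MeasurableSet (Prod.snd ⁻¹' NotYet β i ∩ FirstVisitPast β ρ i y) :=
      (measurable_snd (measurableSet_notYet β i)).inter (measurableSet_firstVisitPast β ρ i y)
    dsimp only [trapTermLim, localObs]
    rw [← lintegral_indicator hm, ← lintegral_indicator hm']
    refine lintegral_mono fun z => ?_
    by_cases hz : z ∈ (Prod.snd ⁻¹' NotYet β i ∩
        prune (j :: y) ⁻¹' FirstVisit β ρ i y j : Set (Env × (ℕ → unitInterval)))
    · obtain ⟨h1, h2⟩ := prune_firstVisit hz.2
      have hz' : z ∈ Prod.snd ⁻¹' NotYet β i ∩ FirstVisitPast β ρ i y := ⟨hz.1, h2⟩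
      rw [Set.indicator_of_mem hz, Set.indicator_of_mem hz', if_pos h1]
    · rw [Set.indicator_of_notMem hz]
      exact zero_le
  refine (ENNReal.tsum_le_tsum hle).trans (le_of_eq ?_)
  rw [← lintegral_tsum]
  · exact lintegral_congr fun z => tsum_lt_indicator (z.1 y)
  · intro j
    exact (Measurable.ite (measurableSet_lt measurable_const
      ((measurable_pi_apply y).comp measurable_fst)) measurable_const measurable_const).aemeasurable

/-- Given the environment off the descendants of `y` and a first visit to `y` at time `i`, the tree of
descendants of `y` survives with its unconditional probability. The events that `Y` is at `y` at time
`i` are disjoint for different `y`. -/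
lemma baseLaw_firstVisitPast_mul_le (p : PMF ℕ) (β ρ : ℝ) (i : ℕ) :
    (∑' y, baseLaw p (Prod.snd ⁻¹' NotYet β i ∩ FirstVisitPast β ρ i y)) *
      offspringLaw p survival ≤ uniformLaw (NotYet β i) := by
  rw [← ENNReal.tsum_mul_right]
  have h1 : ∀ y, baseLaw p (Prod.snd ⁻¹' NotYet β i ∩ FirstVisitPast β ρ i y) *
      offspringLaw p survival ≤
      baseLaw p (Prod.snd ⁻¹' NotYet β i ∩ {z | walkG β ρ z.1 z.2 i = y}) := by
    intro y
    have hm : MeasurableSet (Prod.snd ⁻¹' NotYet β i ∩ FirstVisitPast β ρ i y) :=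
      (measurable_snd (measurableSet_notYet β i)).inter (measurableSet_firstVisitPast β ρ i y)
    have hm' : MeasurableSet (Prod.snd ⁻¹' NotYet β i ∩
        {z : Env × (ℕ → unitInterval) | walkG β ρ z.1 z.2 i = y}) :=
      (measurable_snd (measurableSet_notYet β i)).inter (measurableSet_walkG_eq β ρ i y)
    rw [← lintegral_indicator_one measurableSet_survival,
      ← lintegral_firstVisitPast_mul p β ρ i y (measurable_one.indicator measurableSet_survival),
      ← lintegral_indicator hm, ← lintegral_indicator_one hm']
    refine lintegral_mono fun z => ?_
    by_cases hz : z ∈ Prod.snd ⁻¹' NotYet β i ∩ FirstVisitPast β ρ i y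
    · rw [Set.indicator_of_mem hz]
      by_cases hs : sub z.1 y ∈ survival
      · have hz' : z ∈ (Prod.snd ⁻¹' NotYet β i ∩
            {z : Env × (ℕ → unitInterval) | walkG β ρ z.1 z.2 i = y}) :=
          ⟨hz.1, firstVisitPast_walkG hz.2 hs⟩
        rw [Set.indicator_of_mem hs, Set.indicator_of_mem hz', Pi.one_apply, Pi.one_apply]
      · rw [Set.indicator_of_notMem hs]
        exact zero_le
    · rw [Set.indicator_of_notMem hz]
      exact zero_le
  refine (ENNReal.tsum_le_tsum h1).trans ?_
  rw [← measure_iUnion]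
  · have h2 : baseLaw p (Prod.snd ⁻¹' NotYet β i) = uniformLaw (NotYet β i) := by
      have := Measure.prod_prod (μ := offspringLaw p) (ν := uniformLaw) Set.univ (NotYet β i)
      rw [measure_univ, one_mul, Set.univ_prod] at this
      exact this
    rw [← h2]
    exact measure_mono (Set.iUnion_subset fun y => Set.inter_subset_left)
  · intro y y' hne
    exact Set.disjoint_left.2 fun z h1 h2 => hne (h1.2.symm.trans h2.2)
  · intro y
    exact (measurable_snd (measurableSet_notYet β i)).inter (measurableSet_walkG_eq β ρ i y)

lemma trapTermLim_le_one (p : PMF ℕ) (β ρ : ℝ) {Ψ : ℕ → ℕ → ℝ → ENNReal}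
    (hΨ : ∀ n k w, Ψ n k w ≤ 1) (x : ℕ × Vertex × ℕ) :
    trapTermLim p β ρ Ψ x ≤ trapTermLim p β ρ (fun _ _ _ => 1) x :=
  lintegral_mono fun _ => hΨ _ _ _

lemma tsum_trapTerm_le_lim (p : PMF ℕ) (β ρ : ℝ) (Ψ : ℕ → ℕ → ℝ → ENNReal) (h : ℕ) :
    ∑' x, trapTerm p β ρ Ψ h x ≤ ∑' x, trapTermLim p β ρ Ψ x :=
  ENNReal.tsum_le_tsum fun x => by
    rw [← iSup_trapTerm]
    exact le_iSup (fun h => trapTerm p β ρ Ψ h x) h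

section

variable {p : PMF ℕ} (hm : 1 < ∑' k : ℕ, (k : ℝ) * (p k).toReal) {β : ℝ} (hβ : 1 < β) (ρ : ℝ)
include hm hβ

/-- The expected number of children seen before the first regeneration is finite. -/
theorem tsum_trapTermLim_ne_top : ∑' x, trapTermLim p β ρ (fun _ _ _ => 1) x ≠ ⊤ := by
  have hs := offspringLaw_survival_ne_zero p hm
  set m := ∫⁻ ω, (ω [] : ENNReal) ∂offspringLaw p with hmdef
  have hmt : m ≠ ⊤ := lintegral_children_ne_top p hm []
  have h1 : ∑' x, trapTermLim p β ρ (fun _ _ _ => 1) x ≤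
      ∑' i, (∑' y, baseLaw p (Prod.snd ⁻¹' NotYet β i ∩ FirstVisitPast β ρ i y)) * m := by
    rw [ENNReal.tsum_prod']
    refine ENNReal.tsum_le_tsum fun i => ?_
    rw [ENNReal.tsum_prod', ← ENNReal.tsum_mul_right]
    exact ENNReal.tsum_le_tsum fun y => tsum_trapTermLim_le p β ρ i y
  have h2 : (∑' i, (∑' y, baseLaw p (Prod.snd ⁻¹' NotYet β i ∩ FirstVisitPast β ρ i y)) * m) *
      offspringLaw p survival ≤ (∑' i, uniformLaw (NotYet β i)) * m := by
    rw [← ENNReal.tsum_mul_right, ← ENNReal.tsum_mul_right]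
    refine ENNReal.tsum_le_tsum fun i => ?_
    rw [mul_right_comm]
    gcongr
    exact baseLaw_firstVisitPast_mul_le p β ρ i
  intro htop
  rw [htop, top_le_iff] at h1
  rw [h1, ENNReal.top_mul hs, top_le_iff] at h2
  exact ENNReal.mul_ne_top (tsum_noRegen_ne_top hβ) hmt h2

variable (hp0 : p 0 ≠ 0)
include hp0

/-- With positive probability the root itself carries a big trap. -/
theorem baseLaw_earlyMeet_ne_zero (h : ℕ) : baseLaw p (Good β ∩ EarlyMeet β ρ h) ≠ 0 := by
  obtain ⟨k, hk, hpk⟩ := exists_two_le p hm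
  have hpk' : p k ≠ 0 := fun h0 => by simp [h0] at hpk
  let A : ℕ → Set Env := fun i => if i = 0 then survival else if i = 1 then tall h else Set.univ
  have hA : ∀ i, MeasurableSet (A i) := by
    intro i
    dsimp only [A]
    split_ifs
    · exact measurableSet_survival
    · exact measurableSet_tall h
    · exact MeasurableSet.univ
  have hb := offspringLaw_branching p k hA k
  have hpos : p k * ∏ i ∈ Finset.range k, offspringLaw p (A i) ≠ 0 := by
    refine mul_ne_zero hpk' (Finset.prod_ne_zero_iff.2 fun i _ => ?_)
    dsimp only [A]
    split_ifs
    · exact offspringLaw_survival_ne_zero p hm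
    · exact offspringLaw_tall_ne_zero p hm hp0 h
    · simp
  rw [← hb] at hpos
  have hprod := Measure.prod_prod (μ := offspringLaw p) (ν := uniformLaw)
    {ω | ω [] = k ∧ ∀ i < k, sub ω [i] ∈ A i} {U | IsSuperRegen β U 0}
  have hne : baseLaw p ({ω | ω [] = k ∧ ∀ i < k, sub ω [i] ∈ A i} ×ˢ
      {U | IsSuperRegen β U 0}) ≠ 0 := by
    unfold baseLaw
    rw [hprod]
    exact mul_ne_zero hpos (regenProb_ne_zero hβ)
  refine fun h0 => hne (measure_mono_null ?_ h0)
  rintro ⟨ω, U⟩ ⟨⟨h1, h2⟩, h3⟩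
  dsimp only at h1
  have h4 : ω ∈ survival := by
    by_contra hs
    exact not_survival_iff.1 hs 0 (by omega) (by simpa [A] using h2 0 (by omega))
  refine ⟨⟨h4, h3⟩, 0, fun s hs hs0 => absurd hs0 (by omega), 1, ?_⟩
  refine (mem_bigBuds_iff (by simp [walkG, InTree])).2 ⟨by simp only [walkG]; omega, ?_⟩
  simpa [A, walkG] using h2 1 (by omega)

omit hm hβ hp0 in
lemma setLIntegral_earlyMeet_one (h : ℕ) :
    ∫⁻ z in Good β ∩ EarlyMeet β ρ h, trapObs β ρ h (fun _ _ _ => 1) z.1 z.2 ∂baseLaw p =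
      baseLaw p (Good β ∩ EarlyMeet β ρ h) := by
  rw [← setLIntegral_one]
  refine setLIntegral_congr_fun ((measurableSet_good β).inter (measurableSet_earlyMeet β ρ h)) ?_
  rintro z ⟨-, i, -, hi⟩
  dsimp only [trapObs, localObs]
  rw [if_pos ⟨i, hi⟩]

lemma tsum_trapTerm_ne_zero (h : ℕ) : ∑' x, trapTerm p β ρ (fun _ _ _ => 1) h x ≠ 0 := by
  intro h0
  have := setLIntegral_earlyMeet p β ρ (fun _ _ _ => 1) h
  rw [setLIntegral_earlyMeet_one, h0, mul_zero] at this
  exact baseLaw_earlyMeet_ne_zero hm hβ ρ hp0 h this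

lemma tsum_trapTermLim_ne_zero : ∑' x, trapTermLim p β ρ (fun _ _ _ => 1) x ≠ 0 := by
  intro h0
  have := tsum_trapTerm_le_lim p β ρ (fun _ _ _ => 1) 0
  rw [h0] at this
  exact tsum_trapTerm_ne_zero hm hβ ρ hp0 0 (le_antisymm this zero_le)

end

/-! ### The limit of the local picture at the first big trap -/

/-- The expectation of a function of the local picture in the limit of high traps. -/
def limitObs (p : PMF ℕ) (β : ℝ) (Ψ : ℕ → ℕ → ℝ → ENNReal) : ENNReal :=
  (∑' x, trapTermLim p β 1 Ψ x) / ∑' x, trapTermLim p β 1 (fun _ _ _ => 1) x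

lemma setLIntegral_trapObs_le (p : PMF ℕ) (β ρ : ℝ) {Ψ : ℕ → ℕ → ℝ → ENNReal}
    (hΨ : ∀ n k w, Ψ n k w ≤ 1) (h : ℕ) :
    ∫⁻ z in Good β, trapObs β ρ h Ψ z.1 z.2 ∂baseLaw p ≤ baseLaw p (Good β) := by
  rw [← setLIntegral_one]
  refine lintegral_mono fun z => ?_
  dsimp only [trapObs]
  split_ifs
  · exact hΨ _ _ _
  · exact zero_le

section

variable {p : PMF ℕ} (hm : 1 < ∑' k : ℕ, (k : ℝ) * (p k).toReal) (hp0 : p 0 ≠ 0) {β : ℝ}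
  (hβ : 1 < β)
include hm hp0 hβ

/-- After a regeneration, the first big trap is distributed as the first big trap of a
regeneration block, given that there is one. -/
lemma trapObs_one_mul {Ψ : ℕ → ℕ → ℝ → ENNReal} (hΨ : ∀ n k w, Ψ n k w ≤ 1) (h : ℕ) :
    (∫⁻ z in Good β, trapObs β 1 h Ψ z.1 z.2 ∂baseLaw p) *
        ∑' x, trapTerm p β 1 (fun _ _ _ => 1) h x =
      baseLaw p (Good β) * ∑' x, trapTerm p β 1 Ψ h x := by
  set F := ∫⁻ z in Good β, trapObs β 1 h Ψ z.1 z.2 ∂baseLaw p with hF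
  set C := baseLaw p (Good β) with hC
  have hCt : C ≠ ⊤ := measure_ne_top _ _
  have hFt : F ≠ ⊤ := ne_top_of_le_ne_top hCt (setLIntegral_trapObs_le p β 1 hΨ h)
  have h1 := trapObs_renewal hβ le_rfl p h Ψ
  have h2 := measure_good_renewal hβ le_rfl p h (ρ := 1)
  rw [← setLIntegral_earlyMeet_one, setLIntegral_earlyMeet] at h2
  rw [setLIntegral_earlyMeet] at h1
  rw [← hF] at h1
  rw [← hC] at h2
  set e := offspringLaw p (tall h)
  have he0 : e ≠ 0 := offspringLaw_tall_ne_zero p hm hp0 h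
  have het : e ≠ ⊤ := measure_ne_top _ _
  set S := ∑' x, trapTerm p β 1 Ψ h x
  set S1 := ∑' x, trapTerm p β 1 (fun _ _ _ => 1) h x
  set Q := lateProb p β 1 h
  have hQC : Q * C ≠ ⊤ := ne_top_of_le_ne_top hCt (le_add_self.trans h2.symm.le)
  have h3 : F * (e * S1) + Q * C * F = C * (e * S) + Q * C * F := by
    calc F * (e * S1) + Q * C * F = F * (e * S1 + Q * C) := by ring
      _ = C * F := by rw [← h2, mul_comm]
      _ = C * (e * S + Q * F) := by rw [← h1]
      _ = C * (e * S) + Q * C * F := by ring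
  have h4 := (ENNReal.add_left_inj (ENNReal.mul_ne_top hQC hFt)).1 h3
  rw [mul_left_comm, mul_left_comm C] at h4
  exact (ENNReal.mul_right_inj he0 het).1 h4

omit hp0 in
lemma tsum_trapTerm_ne_top (h : ℕ) (ρ : ℝ) : ∑' x, trapTerm p β ρ (fun _ _ _ => 1) h x ≠ ⊤ :=
  ne_top_of_le_ne_top (tsum_trapTermLim_ne_top hm hβ ρ) (tsum_trapTerm_le_lim p β ρ _ h)

lemma tendsto_trapObs_one {Ψ : ℕ → ℕ → ℝ → ENNReal} (hΨ : ∀ n k w, Ψ n k w ≤ 1) :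
    Tendsto (fun h => ∫⁻ z in Good β, trapObs β 1 h Ψ z.1 z.2 ∂baseLaw p) atTop
      (𝓝 (baseLaw p (Good β) * limitObs p β Ψ)) := by
  have h1 : ∀ h, ∫⁻ z in Good β, trapObs β 1 h Ψ z.1 z.2 ∂baseLaw p =
      baseLaw p (Good β) * ((∑' x, trapTerm p β 1 Ψ h x) /
        ∑' x, trapTerm p β 1 (fun _ _ _ => 1) h x) := by
    intro h
    rw [← mul_div_assoc, ENNReal.eq_div_iff (tsum_trapTerm_ne_zero hm hβ 1 hp0 h)
      (tsum_trapTerm_ne_top hm hβ h 1), mul_comm]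
    exact trapObs_one_mul hm hp0 hβ hΨ h
  simp_rw [h1]
  refine ENNReal.Tendsto.const_mul ?_ (Or.inr (measure_ne_top _ _))
  refine ENNReal.Tendsto.div (tendsto_tsum_trapTerm p β 1 Ψ) (Or.inr
    (tsum_trapTermLim_ne_zero hm hβ 1 hp0)) (tendsto_tsum_trapTerm p β 1 _) (Or.inr ?_)
  exact ne_top_of_le_ne_top (tsum_trapTermLim_ne_top hm hβ 1)
    (ENNReal.tsum_le_tsum fun x => trapTermLim_le_one p β 1 hΨ x)

/-- The root having no parent is irrelevant in the limit, as the first block is unlikely to contain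
a high trap. -/
theorem tendsto_trapObs_zero {Ψ : ℕ → ℕ → ℝ → ENNReal} (hΨ : ∀ n k w, Ψ n k w ≤ 1) :
    Tendsto (fun h => ∫⁻ z in Good β, trapObs β 0 h Ψ z.1 z.2 ∂baseLaw p) atTop
      (𝓝 (baseLaw p (Good β) * limitObs p β Ψ)) := by
  set C := baseLaw p (Good β) with hC
  have hCt : C ≠ ⊤ := measure_ne_top _ _
  have hC0 : C ≠ 0 := fun h0 =>
    baseLaw_earlyMeet_ne_zero hm hβ 0 hp0 0 (measure_mono_null Set.inter_subset_left h0)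
  have h1 := tendsto_trapObs_one hm hp0 hβ hΨ
  set F0 := fun h => ∫⁻ z in Good β, trapObs β 0 h Ψ z.1 z.2 ∂baseLaw p with hF0
  set F1 := fun h => ∫⁻ z in Good β, trapObs β 1 h Ψ z.1 z.2 ∂baseLaw p with hF1
  have hF1C : ∀ h, F1 h ≤ C := setLIntegral_trapObs_le p β 1 hΨ
  have hzero : ∀ Ψ' : ℕ → ℕ → ℝ → ENNReal, (∀ n k w, Ψ' n k w ≤ 1) →
      Tendsto (fun h => offspringLaw p (tall h) * ∑' x, trapTerm p β 0 Ψ' h x) atTop (𝓝 0) := by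
    intro Ψ' hΨ'
    have h2 := ENNReal.Tendsto.mul_const (b := ∑' x, trapTermLim p β 0 (fun _ _ _ => 1) x)
      (tendsto_offspringLaw_tall p) (Or.inr (tsum_trapTermLim_ne_top hm hβ 0))
    rw [zero_mul] at h2
    refine tendsto_of_tendsto_of_tendsto_of_le_of_le tendsto_const_nhds h2
      (fun h => zero_le) fun h => ?_
    refine mul_le_mul_right ((tsum_trapTerm_le_lim p β 0 _ h).trans ?_) _
    exact ENNReal.tsum_le_tsum fun x => trapTermLim_le_one p β 0 hΨ' x
  -- `C F⁰ + n⁰ F¹ = C N⁰ + C F¹`, where `n⁰` and `N⁰` are the contributions of the first block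
  set N := fun h => offspringLaw p (tall h) * ∑' x, trapTerm p β 0 Ψ h x with hN
  set n := fun h => offspringLaw p (tall h) * ∑' x, trapTerm p β 0 (fun _ _ _ => 1) h x with hn
  have hid : ∀ h, C * F0 h + n h * F1 h = C * N h + C * F1 h := by
    intro h
    have h2 : F0 h = N h + lateProb p β 0 h * F1 h := by
      have := trapObs_renewal hβ zero_le_one p h Ψ (ρ := 0)
      rwa [setLIntegral_earlyMeet] at this
    have h3 : C = n h + lateProb p β 0 h * C := by
      have := measure_good_renewal hβ zero_le_one p h (ρ := 0)
      rwa [← setLIntegral_earlyMeet_one, setLIntegral_earlyMeet] at this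
    calc C * F0 h + n h * F1 h = C * N h + (n h + lateProb p β 0 h * C) * F1 h := by
          rw [h2]; ring
      _ = C * N h + C * F1 h := by rw [← h3]
  have hn0 : Tendsto (fun h => n h * F1 h) atTop (𝓝 0) := by
    have h2 := ENNReal.Tendsto.mul_const (b := C) (hzero (fun _ _ _ => 1) fun _ _ _ => le_rfl)
      (Or.inr hCt)
    rw [zero_mul] at h2
    exact tendsto_of_tendsto_of_tendsto_of_le_of_le tendsto_const_nhds h2 (fun h => zero_le)
      fun h => mul_le_mul_right (hF1C h) _
  have hCF : Tendsto (fun h => C * F0 h) atTop (𝓝 (C * (C * limitObs p β Ψ))) := by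
    have h2 : ∀ h, C * F0 h = C * N h + C * F1 h - n h * F1 h := by
      intro h
      refine ENNReal.eq_sub_of_add_eq ?_ (hid h)
      refine ENNReal.mul_ne_top ?_ (ne_top_of_le_ne_top hCt (hF1C h))
      exact ENNReal.mul_ne_top (measure_ne_top _ _) (tsum_trapTerm_ne_top hm hβ h 0)
    simp_rw [h2]
    have h3 := ((ENNReal.Tendsto.const_mul (hzero Ψ hΨ) (Or.inr hCt)).add
      (ENNReal.Tendsto.const_mul h1 (Or.inr hCt)))
    have h4 := ENNReal.Tendsto.sub h3 hn0 (Or.inr ENNReal.zero_ne_top)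
    rwa [mul_zero, zero_add, tsub_zero] at h4
  have h5 := ENNReal.Tendsto.const_mul (a := C⁻¹) hCF (Or.inr (ENNReal.inv_ne_top.2 hC0))
  simp_rw [← mul_assoc, ENNReal.inv_mul_cancel hC0 hCt, one_mul] at h5
  exact h5

omit hm hp0 hβ in
lemma setLIntegral_trapObs_const (p : PMF ℕ) (β ρ : ℝ) (h : ℕ) :
    ∫⁻ z in Good β, trapObs β ρ h (fun _ _ _ => 1) z.1 z.2 ∂baseLaw p =
      baseLaw p (Good β ∩ {z | ∃ i, MeetsG β ρ h z.1 z.2 i}) := by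
  have hmeas : MeasurableSet {z : Env × (ℕ → unitInterval) | ∃ i, MeetsG β ρ h z.1 z.2 i} :=
    measurableSet_exists fun i => measurableSet_meetsG β ρ h i
  have : (fun z : Env × (ℕ → unitInterval) => trapObs β ρ h (fun _ _ _ => 1) z.1 z.2) =
      {z : Env × (ℕ → unitInterval) | ∃ i, MeetsG β ρ h z.1 z.2 i}.indicator 1 := by
    ext z
    by_cases hz : ∃ i, MeetsG β ρ h z.1 z.2 i
    · rw [Set.indicator_of_mem (by exact hz), trapObs, if_pos hz]; rfl
    · rw [Set.indicator_of_notMem (by exact hz), trapObs, if_neg hz]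
  rw [this, lintegral_indicator_one hmeas, Measure.restrict_apply hmeas, Set.inter_comm]

/-- Almost surely on `Good` a big trap is met. -/
theorem baseLaw_good_not_meet (h : ℕ) :
    baseLaw p (Good β \ {z | ∃ i, MeetsG β 0 h z.1 z.2 i}) = 0 := by
  set C := baseLaw p (Good β) with hC
  have hCt : C ≠ ⊤ := measure_ne_top _ _
  have h1 : ∫⁻ z in Good β, trapObs β 1 h (fun _ _ _ => 1) z.1 z.2 ∂baseLaw p = C :=
    (ENNReal.mul_left_inj (tsum_trapTerm_ne_zero hm hβ 1 hp0 h)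
      (tsum_trapTerm_ne_top hm hβ h 1)).1 (trapObs_one_mul hm hp0 hβ (fun _ _ _ => le_rfl) h)
  have h2 := trapObs_renewal hβ zero_le_one p h (fun _ _ _ => 1) (ρ := 0)
  rw [h1, setLIntegral_earlyMeet_one, ← measure_good_renewal hβ zero_le_one p h,
    setLIntegral_trapObs_const] at h2
  have hmeas : MeasurableSet {z : Env × (ℕ → unitInterval) | ∃ i, MeetsG β 0 h z.1 z.2 i} :=
    measurableSet_exists fun i => measurableSet_meetsG β 0 h i
  have h3 := measure_inter_add_sdiff (μ := baseLaw p) (Good β) hmeas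
  rw [h2] at h3
  exact (ENNReal.add_right_inj hCt).1 (h3.trans (add_zero _).symm)

end

/-! ### The walk on the whole tree, given the environment and the backbone walk -/

open Classical in
/-- One step of the walk on the tree, from the state `s` and driven by `v`. -/
def stepState (β : ℝ) (ω : Env) (U : ℕ → unitInterval) (s : Vertex × ℕ) (v : unitInterval) :
    Vertex × ℕ :=
  if s.1 ∈ backbone ω then
    let j := ⌊(v : ℝ) * (ω s.1 * β + parentWeight s.1) / β⌋₊
    if hj : j < (buds ω s.1).length then ((buds ω s.1)[j] :: s.1, s.2)
    else (biasedStep β s.1 (backboneChildren ω s.1) (U s.2), s.2 + 1)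
  else (biasedStep β s.1 (List.range (ω s.1)) v, s.2)

lemma walkState_succ (β : ℝ) (ω : Env) (U V : ℕ → unitInterval) (m : ℕ) :
    walkState β ω U V (m + 1) = stepState β ω U (walkState β ω U V m) (V m) := by
  rw [walkState, stepState]

lemma walkState_update (β : ℝ) (ω : Env) (U V : ℕ → unitInterval) {m n : ℕ} (hmn : m ≤ n)
    (v : unitInterval) :
    walkState β ω U (Function.update V n v) m = walkState β ω U V m := by
  induction m with
  | zero => rfl
  | succ m ih =>
    rw [walkState_succ, walkState_succ, ih (by omega), Function.update_of_ne (by omega)]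

lemma measurable_biasedStep (β : ℝ) (x : Vertex) (L : List ℕ) :
    Measurable fun u : unitInterval => biasedStep β x L u :=
  (measurable_stepG β 0 x L).comp measurable_subtype_coe

lemma measurable_budIndex (β D : ℝ) : Measurable fun v : unitInterval => ⌊(v : ℝ) * D / β⌋₊ :=
  Measurable.nat_floor ((measurable_subtype_coe.mul_const D).div_const β)

lemma measurable_stepState_aux (β : ℝ) (s : Vertex × ℕ) :
    Measurable fun z : (Env × (ℕ → unitInterval)) × unitInterval =>
      stepState β z.1.1 z.1.2 s z.2 := by
  classical
  obtain ⟨x, c⟩ := s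
  unfold stepState
  refine Measurable.ite (measurable_fst.comp measurable_fst (measurableSet_mem_backbone x)) ?_ ?_
  · let S : Vertex → Vertex × ℕ → ℕ → Vertex × ℕ := fun B nb j =>
      if hj : j < B.length then (B[j] :: x, c) else nb
    have hS : ∀ B nb, Measurable (S B nb) := fun _ _ => Measurable.of_discrete
    have hB : Measurable fun z : (Env × (ℕ → unitInterval)) × unitInterval =>
        (buds z.1.1 x : Vertex) := (measurable_buds x).comp (measurable_fst.comp measurable_fst)
    have hnb : Measurable fun z : (Env × (ℕ → unitInterval)) × unitInterval =>
        (biasedStep β x (backboneChildren z.1.1 x) (z.1.2 c), c + 1) := by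
      refine Measurable.prodMk ?_ measurable_const
      refine measurable_apply_countable (f := fun (z : (Env × (ℕ → unitInterval)) × unitInterval)
        (L : Vertex) => biasedStep β x L (z.1.2 c)) (fun L => ?_)
        ((measurable_backboneChildren x).comp (measurable_fst.comp measurable_fst))
      exact (measurable_biasedStep β x L).comp
        ((measurable_pi_apply c).comp (measurable_snd.comp measurable_fst))
    have hj : Measurable fun z : (Env × (ℕ → unitInterval)) × unitInterval =>
        ⌊(z.2 : ℝ) * (z.1.1 x * β + parentWeight x) / β⌋₊ := by
      refine measurable_apply_countable (f := fun (z : (Env × (ℕ → unitInterval)) × unitInterval)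
        (d : ℕ) => ⌊(z.2 : ℝ) * (d * β + parentWeight x) / β⌋₊) (fun d => ?_)
        ((measurable_pi_apply x).comp (measurable_fst.comp measurable_fst))
      exact (measurable_budIndex β _).comp measurable_snd
    have h1 : Measurable fun z : (Env × (ℕ → unitInterval)) × unitInterval =>
        S (buds z.1.1 x) (biasedStep β x (backboneChildren z.1.1 x) (z.1.2 c), c + 1)
          ⌊(z.2 : ℝ) * (z.1.1 x * β + parentWeight x) / β⌋₊ := by
      refine measurable_apply_countable (f := fun (z : (Env × (ℕ → unitInterval)) × unitInterval)
        (B : Vertex) => S B (biasedStep β x (backboneChildren z.1.1 x) (z.1.2 c), c + 1)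
          ⌊(z.2 : ℝ) * (z.1.1 x * β + parentWeight x) / β⌋₊) (fun B => ?_) hB
      refine measurable_apply_countable (f := fun (z : (Env × (ℕ → unitInterval)) × unitInterval)
        (nb : Vertex × ℕ) => S B nb
          ⌊(z.2 : ℝ) * (z.1.1 x * β + parentWeight x) / β⌋₊) (fun nb => ?_) hnb
      exact (hS B nb).comp hj
    exact h1
  · refine Measurable.prodMk ?_ measurable_const
    refine measurable_apply_countable (f := fun (z : (Env × (ℕ → unitInterval)) × unitInterval)
      (d : ℕ) => biasedStep β x (List.range d) z.2) (fun d => ?_)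
      ((measurable_pi_apply x).comp (measurable_fst.comp measurable_fst))
    exact (measurable_biasedStep β x _).comp measurable_snd

lemma measurable_walkState_aux (β : ℝ) (m : ℕ) :
    Measurable fun d : Env × (ℕ → unitInterval) × (ℕ → unitInterval) =>
      walkState β d.1 d.2.1 d.2.2 m := by
  induction m with
  | zero => exact measurable_const
  | succ m ih =>
    simp only [walkState_succ]
    refine measurable_apply_countable
      (f := fun (d : Env × (ℕ → unitInterval) × (ℕ → unitInterval)) s =>
        stepState β d.1 d.2.1 s (d.2.2 m)) (fun s => ?_) ih
    exact (measurable_stepState_aux β s).comp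
      ((measurable_fst.prodMk (measurable_fst.comp measurable_snd)).prodMk
        ((measurable_pi_apply m).comp (measurable_snd.comp measurable_snd)))

lemma measurable_walkState (β : ℝ) (ω : Env) (U : ℕ → unitInterval) (m : ℕ) :
    Measurable fun V => walkState β ω U V m :=
  (measurable_walkState_aux β m).comp (measurable_const.prodMk (measurable_const.prodMk
    measurable_id))

lemma volume_unitInterval_Ico {a b : ℝ} (ha : 0 ≤ a) (hab : a ≤ b) (hb : b ≤ 1) :
    volume {v : unitInterval | a ≤ v ∧ (v : ℝ) < b} = ENNReal.ofReal (b - a) := by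
  have := unitInterval.volume_Ico ⟨a, ha, hab.trans hb⟩ ⟨b, ha.trans hab, hb⟩
  exact this

lemma volume_unitInterval_Ici {a : ℝ} (ha : 0 ≤ a) (ha1 : a ≤ 1) :
    volume {v : unitInterval | a ≤ v} = ENNReal.ofReal (1 - a) := by
  have := unitInterval.volume_Ici ⟨a, ha, ha1⟩
  exact this

lemma volume_unitInterval_Iic {a : ℝ} (ha : 0 ≤ a) (ha1 : a ≤ 1) :
    volume {v : unitInterval | (v : ℝ) ≤ a} = ENNReal.ofReal a := by
  have := unitInterval.volume_Iic ⟨a, ha, ha1⟩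
  exact this

section

variable {β : ℝ} (hβ : 1 < β) {ω : Env} (h0 : ω ∈ survival) (U : ℕ → unitInterval)
include hβ h0

omit hβ h0 in
lemma inTree_walkState (V : ℕ → unitInterval) (m : ℕ) : InTree ω (walkState β ω U V m).1 := by
  induction m with
  | zero => trivial
  | succ m ih =>
    rw [walkState_succ, stepState]
    dsimp only
    split_ifs with hb hj
    · exact ⟨ih, (mem_buds.1 (List.getElem_mem hj)).1⟩
    · exact (biasedStep_mem_backbone β hb _).1
    · rcases biasedStep_eq β (walkState β ω U V m).1 (List.range (ω (walkState β ω U V m).1)) (V m)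
        with ⟨i, hi, h⟩ | h
      · rw [h]; exact ⟨ih, List.mem_range.1 hi⟩
      · rw [h]; exact ih.of_suffix (List.tail_suffix _)

omit hβ in
lemma walkState_eq_walkY (V : ℕ → unitInterval) (m : ℕ)
    (hm : (walkState β ω U V m).1 ∈ backbone ω) :
    (walkState β ω U V m).1 = walkY β ω U (walkState β ω U V m).2 :=
  walkX_eq_walkY β (nil_mem_backbone.2 h0) U V m hm

omit hβ in
/-- The positions with a given value of the clock form a finite set. -/
lemma finite_positions (c : ℕ) :
    {x | ∃ V m, walkState β ω U V m = (x, c)}.Finite := by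
  classical
  set y := walkY β ω U c with hy
  -- At clock value `c` the position is `Y c` or lies in the tree of one of its buds.
  have hsub : {x | ∃ V m, walkState β ω U V m = (x, c)} ⊆
      {y} ∪ ⋃ i ∈ {i ∈ Finset.range (ω y) | i :: y ∉ backbone ω}, subtree ω (i :: y) := by
    rintro x ⟨V, m, hs⟩
    have hinv := walkState_invariant β (nil_mem_backbone.2 h0) U V m
    have hT := inTree_walkState (β := β) (ω := ω) U V m
    rw [hs] at hinv hT
    dsimp only at hinv hT
    rw [← hy] at hinv
    obtain ⟨-, ⟨a, ha⟩, hl⟩ := hinv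
    subst ha
    rcases List.eq_nil_or_concat' a with rfl | ⟨b, i, rfl⟩
    · left; simp
    · right
      have hsuf : (i :: y) <:+ (b ++ [i] ++ y) := ⟨b, by simp⟩
      simp only [Set.mem_iUnion]
      refine ⟨i, ?_, hT, hsuf⟩
      simp only [Finset.mem_filter, Finset.mem_range]
      exact ⟨(hT.of_suffix hsuf).2, fun hb => not_cons_suffix_self i y (hl _ hsuf hb)⟩
  refine Set.Finite.subset ((Set.finite_singleton y).union (Set.Finite.biUnion
    (Finset.finite_toSet _) fun i hi => ?_)) hsub
  simp only [Finset.coe_filter, Finset.mem_range, Set.mem_ofPred_eq] at hi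
  by_contra hinf
  have hyb := walkG_mem_backbone β 0 h0 U c
  rw [walkG_zero_eq_walkY] at hyb
  have hyT : InTree ω y := hyb.1
  exact hi.2 ⟨⟨hyT, hi.1⟩, hinf⟩

omit h0 in
/-- Total weight of the edges at a vertex with at least one child. -/
lemma weight_pos {x : Vertex} (hx : 0 < ω x) : 0 < ω x * β + parentWeight x := by
  have h1 : (1 : ℝ) ≤ ω x := by exact_mod_cast hx
  have h2 : 0 ≤ parentWeight x := by unfold parentWeight; split_ifs <;> norm_num
  nlinarith

omit hβ h0 in
lemma children_pos_of_backbone {x : Vertex} (hx : x ∈ backbone ω) : 0 < ω x := by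
  have h1 := backboneChildren_length_pos hx
  have h2 := length_buds_add ω x
  omega

omit h0 in
lemma budIndex_ge_iff {x : Vertex} (hx : 0 < ω x) (n : ℕ) (v : ℝ) :
    n ≤ ⌊v * (ω x * β + parentWeight x) / β⌋₊ ↔ n = 0 ∨ n * β / (ω x * β + parentWeight x) ≤ v := by
  have hD := weight_pos hβ hx
  rcases Nat.eq_zero_or_pos n with rfl | hn
  · simp
  · rw [Nat.le_floor_iff' hn.ne', le_div_iff₀ (by linarith), div_le_iff₀ hD]
    simp [hn.ne']

omit h0 in
/-- The probability that the next move at a backbone vertex is along the backbone. -/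
lemma volume_budIndex_ge {x : Vertex} (hx : x ∈ backbone ω) :
    volume {v : unitInterval | (buds ω x).length ≤
        ⌊(v : ℝ) * (ω x * β + parentWeight x) / β⌋₊} =
      ENNReal.ofReal (((backboneChildren ω x).length * β + parentWeight x) /
        (ω x * β + parentWeight x)) := by
  have hd := children_pos_of_backbone hx
  have hD := weight_pos hβ hd
  have hlen : ((backboneChildren ω x).length : ℝ) + (buds ω x).length = ω x := by
    exact_mod_cast length_buds_add ω x
  have h2 : 0 ≤ parentWeight x := by unfold parentWeight; split_ifs <;> norm_num
  have hset : {v : unitInterval | (buds ω x).length ≤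
      ⌊(v : ℝ) * (ω x * β + parentWeight x) / β⌋₊} =
      {v : unitInterval | (buds ω x).length * β / (ω x * β + parentWeight x) ≤ v} := by
    ext v
    simp only [Set.mem_ofPred_eq]
    rw [budIndex_ge_iff hβ hd]
    constructor
    · rintro (h | h)
      · rw [h]; simpa using v.2.1
      · exact h
    · exact Or.inr
  rw [hset, volume_unitInterval_Ici (by positivity)]
  · congr 1
    rw [eq_div_iff hD.ne', sub_mul, div_mul_cancel₀ _ hD.ne', ← hlen]
    ring
  · rw [div_le_one hD, ← hlen]
    nlinarith [Nat.cast_nonneg (α := ℝ) (backboneChildren ω x).length]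

omit h0 in
/-- The probability that the walk enters the `n`-th bud. -/
lemma volume_budIndex_eq {x : Vertex} {n : ℕ} (hn : n < (buds ω x).length) :
    volume {v : unitInterval | ⌊(v : ℝ) * (ω x * β + parentWeight x) / β⌋₊ = n} =
      ENNReal.ofReal (β / (ω x * β + parentWeight x)) := by
  have hle : (buds ω x).length ≤ ω x := by have := length_buds_add ω x; omega
  have hd : 0 < ω x := by omega
  have hD := weight_pos hβ hd
  have h2 : 0 ≤ parentWeight x := by unfold parentWeight; split_ifs <;> norm_num
  have hset : {v : unitInterval | ⌊(v : ℝ) * (ω x * β + parentWeight x) / β⌋₊ = n} =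
      {v : unitInterval | n * β / (ω x * β + parentWeight x) ≤ v ∧
        (v : ℝ) < (n + 1 : ℕ) * β / (ω x * β + parentWeight x)} := by
    ext v
    simp only [Set.mem_ofPred_eq]
    have h3 := budIndex_ge_iff hβ hd n v
    have h4 := budIndex_ge_iff hβ hd (n + 1) v
    have h5 : n ≤ ⌊(v : ℝ) * (ω x * β + parentWeight x) / β⌋₊ ↔
        n * β / (ω x * β + parentWeight x) ≤ v := by
      rw [h3]
      refine ⟨?_, Or.inr⟩
      rintro (h | h)
      · rw [h]; simpa using v.2.1
      · exact h
    rw [or_iff_right (Nat.succ_ne_zero n)] at h4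
    rw [← h5, ← not_le, ← h4]
    omega
  rw [hset, volume_unitInterval_Ico (by positivity)]
  · congr 1
    push_cast
    field_simp
    ring
  · push_cast
    gcongr
    linarith
  · rw [div_le_one hD]
    have : ((n + 1 : ℕ) : ℝ) ≤ ω x := by exact_mod_cast (by omega : n + 1 ≤ ω x)
    nlinarith

/-! ### The walk leaves every trap -/

omit hβ h0 in
/-- The state at time `m` and the variable driving the next step are independent. -/
lemma uniformLaw_state_step (m : ℕ) (s : Vertex × ℕ) {A : Set unitInterval}
    (hA : MeasurableSet A) :
    uniformLaw {V | walkState β ω U V m = s ∧ V m ∈ A} =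
      uniformLaw {V | walkState β ω U V m = s} * volume A := by
  have h1 : MeasurableSet {V | walkState β ω U V m = s} :=
    measurable_walkState β ω U m (measurableSet_singleton s)
  have h2 : MeasurableSet {V : ℕ → unitInterval | walkState β ω U V m = s ∧ V m ∈ A} :=
    measurableSet_and h1 (measurable_pi_apply m hA)
  rw [← lintegral_indicator_one h2, lintegral_uniformLaw_update m (measurable_one.indicator h2),
    ← lintegral_indicator_one h1, ← lintegral_mul_const _ (measurable_one.indicator h1)]
  refine lintegral_congr fun V => ?_
  rw [← lintegral_indicator_one hA, ← lintegral_const_mul _ (measurable_one.indicator hA)]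
  refine lintegral_congr fun v => ?_
  have hiff : Function.update V m v ∈ {V : ℕ → unitInterval | walkState β ω U V m = s ∧ V m ∈ A} ↔
      walkState β ω U V m = s ∧ v ∈ A := by
    simp only [Set.mem_ofPred_eq, walkState_update β ω U V le_rfl, Function.update_self]
  by_cases h3 : walkState β ω U V m = s <;> by_cases h4 : v ∈ A <;> simp [hiff, h3, h4]

omit hβ h0 in
lemma walkState_snd_le_succ (V : ℕ → unitInterval) (m : ℕ) :
    (walkState β ω U V m).2 ≤ (walkState β ω U V (m + 1)).2 := by
  rw [walkState_succ, stepState]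
  dsimp only
  split_ifs <;> simp

omit hβ h0 in
lemma walkState_snd_mono (V : ℕ → unitInterval) : Monotone fun m => (walkState β ω U V m).2 :=
  monotone_nat_of_le_succ fun m => walkState_snd_le_succ U V m

omit h0 in
/-- The expected time spent at a backbone vertex with a given value of the clock is finite: each
visit makes the clock tick with the same positive probability. -/
lemma tsum_occupation_backbone {x : Vertex} (hx : x ∈ backbone ω) (c : ℕ) :
    ∑' m, uniformLaw {V | walkState β ω U V m = (x, c)} ≠ ⊤ := by
  set A := {v : unitInterval | (buds ω x).length ≤
      ⌊(v : ℝ) * (ω x * β + parentWeight x) / β⌋₊} with hA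
  have hAm : MeasurableSet A := measurableSet_le measurable_const (measurable_budIndex β _)
  have hA0 : volume A ≠ 0 := by
    rw [hA, volume_budIndex_ge hβ hx]
    have h1 : (1 : ℝ) ≤ (backboneChildren ω x).length := by
      exact_mod_cast backboneChildren_length_pos hx
    have h2 : 0 ≤ parentWeight x := by unfold parentWeight; split_ifs <;> norm_num
    refine (ENNReal.ofReal_pos.2 (div_pos (by nlinarith) ?_)).ne'
    exact weight_pos hβ (children_pos_of_backbone hx)
  have htick : ∀ V m, walkState β ω U V m = (x, c) → V m ∈ A →
      (walkState β ω U V (m + 1)).2 = c + 1 := by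
    intro V m hs hv
    rw [walkState_succ, hs, stepState]
    dsimp only
    rw [if_pos hx, dif_neg (not_lt.2 hv)]
  have hdisj : Pairwise fun m n => Disjoint {V | walkState β ω U V m = (x, c) ∧ V m ∈ A}
      {V | walkState β ω U V n = (x, c) ∧ V n ∈ A} := by
    have haux : ∀ m n, m < n → Disjoint {V | walkState β ω U V m = (x, c) ∧ V m ∈ A}
        {V | walkState β ω U V n = (x, c) ∧ V n ∈ A} := by
      intro m n hmn
      refine Set.disjoint_left.2 ?_
      rintro V ⟨h1, h2⟩ ⟨h3, -⟩
      have h4 := htick V m h1 h2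
      have h5 : (walkState β ω U V (m + 1)).2 ≤ (walkState β ω U V n).2 :=
        walkState_snd_mono U V (by omega : m + 1 ≤ n)
      rw [h4, h3] at h5
      simp at h5
    intro m n hne
    rcases lt_or_gt_of_ne hne with h | h
    · exact haux m n h
    · exact (haux n m h).symm
  have hsum : (∑' m, uniformLaw {V | walkState β ω U V m = (x, c)}) * volume A ≤ 1 := by
    rw [← ENNReal.tsum_mul_right]
    simp_rw [← uniformLaw_state_step U _ (x, c) hAm]
    rw [← measure_iUnion hdisj]
    · exact prob_le_one
    · exact fun m => measurableSet_and
        (measurable_walkState β ω U m (measurableSet_singleton (x, c))) (measurable_pi_apply m hAm)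
  intro htop
  rw [htop, ENNReal.top_mul hA0] at hsum
  simp at hsum

/-- The expected time spent at any vertex with a given value of the clock is finite: from a vertex
of a trap the walk moves to the parent with positive probability. -/
lemma tsum_occupation (x : Vertex) (c : ℕ) :
    ∑' m, uniformLaw {V | walkState β ω U V m = (x, c)} ≠ ⊤ := by
  induction x with
  | nil => exact tsum_occupation_backbone hβ U (nil_mem_backbone.2 h0) c
  | cons i v ih =>
    by_cases hx : i :: v ∈ backbone ω
    · exact tsum_occupation_backbone hβ U hx c
    set d : ℝ := ω (i :: v) * β + 1 with hd
    have hd1 : 1 ≤ d := by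
      have : 0 ≤ (ω (i :: v) : ℝ) * β := by positivity
      linarith
    set A := {u : unitInterval | (u : ℝ) ≤ 1 / d} with hA
    have hAm : MeasurableSet A := measurableSet_le measurable_subtype_coe measurable_const
    have hA0 : volume A ≠ 0 := by
      rw [hA, volume_unitInterval_Iic (by positivity) (by rw [div_le_one (by linarith)]; exact hd1)]
      exact (ENNReal.ofReal_pos.2 (by positivity)).ne'
    have hup : ∀ V m, walkState β ω U V m = (i :: v, c) → V m ∈ A →
        walkState β ω U V (m + 1) = (v, c) := by
      intro V m hs hu
      have hu' : (V m : ℝ) ≤ 1 / d := hu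
      rw [walkState_succ, hs, stepState]
      dsimp only
      rw [if_neg hx, biasedStep, dif_neg]
      · rfl
      · rw [not_lt, List.length_range]
        refine Nat.le_floor ?_
        have hw : parentWeight (i :: v) = 1 := by simp [parentWeight]
        rw [hw, ← hd, le_div_iff₀ (by linarith)]
        rw [le_div_iff₀ (by linarith)] at hu'
        nlinarith
    have hle : (∑' m, uniformLaw {V | walkState β ω U V m = (i :: v, c)}) * volume A ≤
        ∑' m, uniformLaw {V | walkState β ω U V m = (v, c)} := by
      rw [← ENNReal.tsum_mul_right]
      simp_rw [← uniformLaw_state_step U _ (i :: v, c) hAm]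
      refine le_trans (ENNReal.tsum_le_tsum fun m => measure_mono fun V hV => hup V m hV.1 hV.2) ?_
      exact ENNReal.tsum_comp_le_tsum_of_injective (add_left_injective 1)
        fun m => uniformLaw {V | walkState β ω U V m = (v, c)}
    intro htop
    rw [htop, ENNReal.top_mul hA0] at hle
    exact ih (top_le_iff.1 hle)

/-- Almost surely the walk makes infinitely many steps along the backbone. -/
theorem ae_tendsto_clock :
    ∀ᵐ V ∂uniformLaw, Tendsto (fun m => (walkState β ω U V m).2) atTop atTop := by
  have h1 : ∀ᵐ V ∂uniformLaw, ∀ s : Vertex × ℕ, ∀ᶠ m in atTop, walkState β ω U V m ≠ s := by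
    rw [ae_all_iff]
    rintro ⟨x, c⟩
    exact ae_eventually_notMem (tsum_occupation hβ h0 U x c)
  filter_upwards [h1] with V hV
  have h2 : ∀ c, ∀ᶠ m in atTop, (walkState β ω U V m).2 ≠ c := by
    intro c
    have h3 := ((finite_positions (β := β) h0 U c).eventually_all
      (l := atTop) (p := fun x m => walkState β ω U V m ≠ (x, c))).2 fun x _ => hV (x, c)
    filter_upwards [h3] with m hm hc
    exact hm (walkState β ω U V m).1 ⟨V, m, Prod.ext rfl hc⟩ (Prod.ext rfl hc)
  rw [tendsto_atTop]
  intro C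
  have h4 := ((Finset.range C).eventually_all (l := atTop)
    (p := fun c m => (walkState β ω U V m).2 ≠ c)).2 fun c _ => h2 c
  filter_upwards [h4] with m hm
  by_contra hlt
  exact hm _ (Finset.mem_range.2 (not_le.1 hlt)) rfl

end

/-! ### The number of entries into a trap, given the environment and the backbone walk -/

/-- The probability that the sum of `n` independent variables, each with
`P[at least j] = r ^ j`, is at least `k`. -/
def nbTail (r : ℝ) : ℕ → ℕ → ℝ
  | 0, _ => 1
  | _ + 1, 0 => 0
  | k + 1, n + 1 => r * nbTail r k (n + 1) + (1 - r) * nbTail r (k + 1) n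

lemma nbTail_zero_left (r : ℝ) (n : ℕ) : nbTail r 0 n = 1 := by
  rw [nbTail]

lemma nbTail_mem_Icc {r : ℝ} (h0 : 0 ≤ r) (h1 : r ≤ 1) (k n : ℕ) :
    0 ≤ nbTail r k n ∧ nbTail r k n ≤ 1 := by
  induction k generalizing n with
  | zero => simp [nbTail]
  | succ k ihk =>
    induction n with
    | zero => simp [nbTail]
    | succ n ihn =>
      rw [nbTail]
      have := ihk (n + 1)
      constructor
      · exact add_nonneg (mul_nonneg h0 this.1) (mul_nonneg (by linarith) ihn.1)
      · nlinarith

/-- The probability that the walk at a vertex with `κ` backbone children and parent weight `w`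
enters a given bud before it moves along the backbone. -/
def entryProb (β : ℝ) (κ : ℕ) (w : ℝ) : ℝ := β / ((κ + 1) * β + w)

lemma entryProb_mem_Icc {β : ℝ} (hβ : 1 < β) (κ : ℕ) {w : ℝ} (hw : 0 ≤ w) :
    0 ≤ entryProb β κ w ∧ entryProb β κ w ≤ 1 := by
  have hκ : (0 : ℝ) ≤ κ := Nat.cast_nonneg κ
  have h : β ≤ (κ + 1) * β + w := by nlinarith
  exact ⟨div_nonneg (by linarith) (by linarith), div_le_one_of_le₀ h (by linarith)⟩

lemma parentWeight_nonneg (x : Vertex) : 0 ≤ parentWeight x := by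
  unfold parentWeight; split_ifs <;> norm_num

/-- The times at which the walk enters `j :: x` from `x`. -/
def entryTimes (β : ℝ) (ω : Env) (U V : ℕ → unitInterval) (x : Vertex) (j : ℕ) : Set ℕ :=
  {i | walkX β ω U V i = x ∧ walkX β ω U V (i + 1) = j :: x}

/-- The number of entries into `j :: x` before time `m`. -/
def entriesBefore (β : ℝ) (ω : Env) (U V : ℕ → unitInterval) (x : Vertex) (j m : ℕ) : ℕ :=
  ∑ i ∈ Finset.range m,
    if walkX β ω U V i = x ∧ walkX β ω U V (i + 1) = j :: x then 1 else 0

/-- The number of visits of the backbone walk to `x` from time `c` on. -/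
def visitsFrom (β : ℝ) (ω : Env) (U : ℕ → unitInterval) (x : Vertex) (c : ℕ) : ℕ :=
  {i | c ≤ i ∧ walkY β ω U i = x}.ncard

lemma visitsFrom_succ_of_ne {β : ℝ} {ω : Env} {U : ℕ → unitInterval} {x : Vertex} {c : ℕ}
    (h : walkY β ω U c ≠ x) : visitsFrom β ω U x (c + 1) = visitsFrom β ω U x c := by
  unfold visitsFrom
  congr 1
  ext i
  simp only [Set.mem_ofPred_eq]
  constructor
  · rintro ⟨h1, h2⟩; exact ⟨by omega, h2⟩
  · rintro ⟨h1, h2⟩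
    refine ⟨?_, h2⟩
    rcases h1.eq_or_lt with rfl | h3
    · exact absurd h2 h
    · exact h3

lemma visitsFrom_of_eq {β : ℝ} {ω : Env} {U : ℕ → unitInterval} {x : Vertex} {c : ℕ}
    (hfin : {i | walkY β ω U i = x}.Finite) (h : walkY β ω U c = x) :
    visitsFrom β ω U x c = visitsFrom β ω U x (c + 1) + 1 := by
  unfold visitsFrom
  have : {i | c ≤ i ∧ walkY β ω U i = x} = insert c {i | c + 1 ≤ i ∧ walkY β ω U i = x} := by
    ext i
    simp only [Set.mem_ofPred_eq, Set.mem_insert_iff]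
    constructor
    · rintro ⟨h1, h2⟩
      rcases h1.eq_or_lt with rfl | h3
      · exact Or.inl rfl
      · exact Or.inr ⟨h3, h2⟩
    · rintro (rfl | ⟨h1, h2⟩)
      · exact ⟨le_rfl, h⟩
      · exact ⟨by omega, h2⟩
  rw [this, Set.ncard_insert_of_notMem (by simp) (hfin.subset fun i hi => hi.2)]

lemma entriesBefore_update (β : ℝ) (ω : Env) (U V : ℕ → unitInterval) (x : Vertex) (j : ℕ) {m n : ℕ}
    (hmn : m ≤ n) (v : unitInterval) :
    entriesBefore β ω U (Function.update V n v) x j m = entriesBefore β ω U V x j m := by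
  refine Finset.sum_congr rfl fun i hi => ?_
  have := Finset.mem_range.1 hi
  rw [walkX, walkX, walkX, walkX, walkState_update β ω U V (by omega),
    walkState_update β ω U V (by omega)]

lemma measurable_entriesBefore (β : ℝ) (ω : Env) (U : ℕ → unitInterval) (x : Vertex) (j m : ℕ) :
    Measurable fun V => entriesBefore β ω U V x j m := by
  unfold entriesBefore
  refine Finset.measurable_sum _ fun i _ => Measurable.ite (measurableSet_and ?_ ?_)
    measurable_const measurable_const
  · exact (measurable_fst.comp (measurable_walkState β ω U i)) (measurableSet_singleton x)
  · exact (measurable_fst.comp (measurable_walkState β ω U (i + 1)))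
      (measurableSet_singleton (j :: x))

section

variable {β : ℝ} (hβ : 1 < β) {ω : Env} (h0 : ω ∈ survival) (U : ℕ → unitInterval) {x : Vertex}
  (hx : x ∈ backbone ω) {j : ℕ} (hj : j ∈ buds ω x) (hfin : {i | walkY β ω U i = x}.Finite)

/-- The conditional probability of at least `k` entries into `j :: x`, given the walk up to
time `m`. -/
def entryMart (β : ℝ) (ω : Env) (U V : ℕ → unitInterval) (x : Vertex) (j k m : ℕ) : ENNReal :=
  ENNReal.ofReal (nbTail (entryProb β (backboneChildren ω x).length (parentWeight x))
    (k - entriesBefore β ω U V x j m) (visitsFrom β ω U x (walkState β ω U V m).2))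

lemma measurable_entryMart (k m : ℕ) : Measurable fun V => entryMart β ω U V x j k m := by
  have h1 : Measurable fun V => (entriesBefore β ω U V x j m, (walkState β ω U V m).2) :=
    (measurable_entriesBefore β ω U x j m).prodMk
      (measurable_snd.comp (measurable_walkState β ω U m))
  exact (Measurable.of_discrete (f := fun n : ℕ × ℕ => ENNReal.ofReal
    (nbTail (entryProb β (backboneChildren ω x).length (parentWeight x))
    (k - n.1) (visitsFrom β ω U x n.2)))).comp h1

/-- The integral of a function with the values `a`, `b` and `c`, where `c` is the mean of `a` and `b`
weighted by the probabilities of the first two values. -/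
lemma lintegral_three_way {A B : Set unitInterval} (hA : MeasurableSet A) (hB : MeasurableSet B)
    (hAB : Disjoint A B) {f : unitInterval → ENNReal} {a b c : ENNReal} (h1 : ∀ v ∈ A, f v = a)
    (h2 : ∀ v ∈ B, f v = b) (h3 : ∀ v, v ∉ A → v ∉ B → f v = c)
    (h : a * volume A + b * volume B = c * (volume A + volume B)) : ∫⁻ v, f v = c := by
  have hf : ∫⁻ v, f v = a * volume A + b * volume B + c * volume (A ∪ B)ᶜ := by
    rw [← lintegral_add_compl f (hA.union hB), lintegral_union hB hAB,
      setLIntegral_congr_fun hA h1, setLIntegral_congr_fun hB h2,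
      setLIntegral_congr_fun (g := fun _ => c) (hA.union hB).compl
        (fun v hv => h3 v (fun h => hv (Or.inl h)) (fun h => hv (Or.inr h)))]
    simp only [setLIntegral_const]
  rw [hf, h, ← mul_add, ← measure_union hAB hB, measure_add_measure_compl (hA.union hB),
    measure_univ, mul_one]

include hβ h0 hx hj hfin

/-- The martingale property: between two backbone steps at `x` only the choice of the bud `j`
matters, and it is made with probability `entryProb`. -/
lemma lintegral_entryMart_update (V : ℕ → unitInterval) (k m : ℕ) :
    ∫⁻ v, entryMart β ω U (Function.update V m v) x j k (m + 1) = entryMart β ω U V x j k m := by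
  have hstep : ∀ v, walkState β ω U (Function.update V m v) (m + 1) =
      stepState β ω U (walkState β ω U V m) v := fun v => by
    rw [walkState_succ, walkState_update β ω U V le_rfl, Function.update_self]
  have hcnt : ∀ v, entriesBefore β ω U (Function.update V m v) x j (m + 1) =
      entriesBefore β ω U V x j m + if (walkState β ω U V m).1 = x ∧
        (stepState β ω U (walkState β ω U V m) v).1 = j :: x then 1 else 0 := fun v => by
    have h1 := entriesBefore_update β ω U V x j (le_refl m) v
    unfold entriesBefore at h1 ⊢
    rw [Finset.sum_range_succ, h1, walkX, walkX, hstep, walkState_update β ω U V le_rfl]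
  simp only [entryMart, hstep, hcnt]
  have hY := walkState_eq_walkY (β := β) h0 U V m
  set n := entriesBefore β ω U V x j m
  generalize walkState β ω U V m = s at hY ⊢
  obtain ⟨y, c⟩ := s
  dsimp only at hY ⊢
  set κ := (backboneChildren ω x).length with hκ
  set r := entryProb β κ (parentWeight x) with hr
  have hr01 := entryProb_mem_Icc hβ κ (parentWeight_nonneg x)
  rw [← hr] at hr01
  by_cases hyx : y = x
  · subst hyx
    have hYc := (hY hx).symm
    have hvis := visitsFrom_of_eq hfin hYc
    set L := buds ω y with hL
    set D : ℝ := ω y * β + parentWeight y with hD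
    have hDpos : 0 < D := weight_pos hβ (children_pos_of_backbone hx)
    set j₀ := L.idxOf j with hj₀
    have hj₀L : j₀ < L.length := List.idxOf_lt_length_of_mem hj
    have hnd : L.Nodup := List.Nodup.filter _ List.nodup_range
    -- On `A` the walk enters the bud `j`, on `B` it moves along the backbone; otherwise it enters
    -- another bud, and the martingale keeps its value.
    set A := {v : unitInterval | ⌊(v : ℝ) * D / β⌋₊ = j₀} with hA
    set B := {v : unitInterval | L.length ≤ ⌊(v : ℝ) * D / β⌋₊} with hB
    have hvA : volume A = ENNReal.ofReal (β / D) := volume_budIndex_eq hβ hj₀L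
    have hvB : volume B = ENNReal.ofReal ((κ * β + parentWeight y) / D) := volume_budIndex_ge hβ hx
    have hsA : ∀ v ∈ A, stepState β ω U (y, c) v = (j :: y, c) := by
      intro v hv
      have hv' : ⌊(v : ℝ) * D / β⌋₊ = j₀ := hv
      rw [stepState]
      dsimp only
      rw [if_pos hx, dif_pos (by rw [← hD, hv']; exact hj₀L)]
      have : (buds ω y)[⌊(v : ℝ) * D / β⌋₊]'(by rw [hv']; exact hj₀L) = j := by
        simp only [hv']
        exact List.getElem_idxOf hj₀L
      rw [this]
    have hsB : ∀ v ∈ B, (stepState β ω U (y, c) v).1 ≠ j :: y ∧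
        (stepState β ω U (y, c) v).2 = c + 1 := by
      intro v hv
      have hv' : L.length ≤ ⌊(v : ℝ) * D / β⌋₊ := hv
      rw [stepState]
      dsimp only
      rw [if_pos hx, dif_neg (not_lt.2 hv')]
      refine ⟨fun h => ?_, rfl⟩
      have h2 := biasedStep_mem_backbone β hx (U c)
      dsimp only at h
      rw [h] at h2
      exact (mem_buds.1 hj).2 h2
    have hsC : ∀ v, v ∉ A → v ∉ B → (stepState β ω U (y, c) v).1 ≠ j :: y ∧
        (stepState β ω U (y, c) v).2 = c := by
      intro v hvA hvB
      have hv' : ⌊(v : ℝ) * D / β⌋₊ < L.length := not_le.1 hvB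
      rw [stepState]
      dsimp only
      rw [if_pos hx, dif_pos (by rw [← hD]; exact hv')]
      refine ⟨fun h => hvA ?_, rfl⟩
      dsimp only at h
      have h2 : L[⌊(v : ℝ) * D / β⌋₊] = j := (List.cons.inj h).1
      show ⌊(v : ℝ) * D / β⌋₊ = j₀
      rw [hj₀, ← h2, hnd.idxOf_getElem]
    have hAB : Disjoint A B := by
      refine Set.disjoint_left.2 fun v hv hv' => ?_
      have h1 : ⌊(v : ℝ) * D / β⌋₊ = j₀ := hv
      have h2 : L.length ≤ ⌊(v : ℝ) * D / β⌋₊ := hv'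
      omega
    refine lintegral_three_way (A := A) (B := B)
      (a := ENNReal.ofReal (nbTail r (k - (n + 1)) (visitsFrom β ω U y c)))
      (b := ENNReal.ofReal (nbTail r (k - n) (visitsFrom β ω U y (c + 1))))
      (measurable_budIndex β D (measurableSet_singleton j₀))
      (measurableSet_le measurable_const (measurable_budIndex β D)) hAB ?_ ?_ ?_ ?_
    · intro v hv
      simp [hsA v hv]
    · intro v hv
      simp [hsB v hv]
    · intro v hv hv'
      simp [hsC v hv hv']
    · rw [hvA, hvB]
      have ha : 0 ≤ β / D := div_nonneg (by linarith) hDpos.le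
      have hκ0 : (0 : ℝ) ≤ κ := Nat.cast_nonneg κ
      have hw := parentWeight_nonneg y
      have hb : 0 ≤ (κ * β + parentWeight y) / D :=
        div_nonneg (add_nonneg (mul_nonneg hκ0 (by linarith)) hw) hDpos.le
      have hΦ := fun k n => (nbTail_mem_Icc hr01.1 hr01.2 k n).1
      rw [← ENNReal.ofReal_mul (hΦ _ _), ← ENNReal.ofReal_mul (hΦ _ _), ← ENNReal.ofReal_add ha hb,
        ← ENNReal.ofReal_mul (hΦ _ _), ← ENNReal.ofReal_add (mul_nonneg (hΦ _ _) ha)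
          (mul_nonneg (hΦ _ _) hb)]
      congr 1
      rw [hvis]
      rcases Nat.eq_zero_or_pos (k - n) with h | h
      · have h' : k - (n + 1) = 0 := by omega
        rw [h, h']
        simp only [nbTail_zero_left]
        ring
      · obtain ⟨k', hk'⟩ : ∃ k', k - n = k' + 1 := ⟨k - n - 1, by omega⟩
        have h' : k - (n + 1) = k' := by omega
        rw [hk', h', nbTail]
        have hE : (κ + 1) * β + parentWeight y ≠ 0 := by
          have : 0 < (κ + 1) * β + parentWeight y := by nlinarith
          exact this.ne'
        rw [hr, entryProb]
        field_simp
        ring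
  -- Away from `x` no entry is made, and the clock passes no visit to `x`.
  · have hconst : ∀ v, visitsFrom β ω U x (stepState β ω U (y, c) v).2 = visitsFrom β ω U x c := by
      intro v
      rw [stepState]
      dsimp only
      split_ifs with hb hjj
      · rfl
      · refine visitsFrom_succ_of_ne ?_
        rw [← hY hb]
        exact hyx
      · rfl
    simp [hyx, hconst]

lemma lintegral_entryMart (k m : ℕ) :
    ∫⁻ V, entryMart β ω U V x j k m ∂uniformLaw = ENNReal.ofReal (nbTail
      (entryProb β (backboneChildren ω x).length (parentWeight x)) k
      {i | walkY β ω U i = x}.ncard) := by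
  induction m with
  | zero => simp [entryMart, entriesBefore, visitsFrom, walkState]
  | succ m ih =>
    rw [lintegral_uniformLaw_update m (measurable_entryMart U k (m + 1)), ← ih]
    exact lintegral_congr fun V => lintegral_entryMart_update hβ h0 U hx hj hfin V k m

omit hβ hx hj in
/-- Once the backbone walk has made its last visit to `x`, the number of entries is known. -/
lemma entries_of_clock {V : ℕ → unitInterval}
    (hV : Tendsto (fun m => (walkState β ω U V m).2) atTop atTop) (hx : x ∈ backbone ω) :
    (entryTimes β ω U V x j).Finite ∧ ∀ᶠ m in atTop,
      entriesBefore β ω U V x j m = (entryTimes β ω U V x j).ncard ∧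
        visitsFrom β ω U x (walkState β ω U V m).2 = 0 := by
  obtain ⟨b, hb⟩ := hfin.bddAbove
  have h1 : ∀ᶠ m in atTop, b + 1 ≤ (walkState β ω U V m).2 := hV.eventually_ge_atTop (b + 1)
  obtain ⟨m₀, hm₀⟩ := h1.exists
  have hlate : ∀ i, m₀ ≤ i → walkX β ω U V i ≠ x := by
    intro i hi h
    have h2 : (walkState β ω U V m₀).2 ≤ (walkState β ω U V i).2 := walkState_snd_mono U V hi
    have h3 := walkState_eq_walkY (β := β) h0 U V i (by rw [walkX] at h; rw [h]; exact hx)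
    have h4 := hb (show (walkState β ω U V i).2 ∈ {i | walkY β ω U i = x} from h3.symm.trans h)
    omega
  have hsub : entryTimes β ω U V x j ⊆ Finset.range m₀ := by
    intro i hi
    by_contra h
    exact hlate i (by simpa using h) hi.1
  refine ⟨(Finset.finite_toSet _).subset hsub, ?_⟩
  filter_upwards [eventually_ge_atTop m₀] with m hm
  constructor
  · rw [entriesBefore, ← Finset.card_filter, ← Set.ncard_coe_finset]
    congr 1
    ext i
    simp only [Finset.coe_filter, Finset.mem_range, Set.mem_ofPred_eq, entryTimes]
    refine ⟨fun h => h.2, fun h => ⟨?_, h⟩⟩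
    have : i < m₀ := by simpa using hsub h
    omega
  · have : {i | (walkState β ω U V m).2 ≤ i ∧ walkY β ω U i = x} = ∅ := by
      ext i
      simp only [Set.mem_ofPred_eq, Set.mem_empty_iff_false, iff_false, not_and]
      intro hi h
      have h2 : (walkState β ω U V m₀).2 ≤ (walkState β ω U V m).2 := walkState_snd_mono U V hm
      have h4 := hb (show i ∈ {i | walkY β ω U i = x} from h)
      omega
    rw [visitsFrom, this, Set.ncard_empty]

omit hj in
lemma ae_finite_entryTimes : ∀ᵐ V ∂uniformLaw, (entryTimes β ω U V x j).Finite := by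
  filter_upwards [ae_tendsto_clock hβ h0 U] with V hV
  exact (entries_of_clock h0 U hfin hV hx).1

/-- The number of entries into a bud at `x` is distributed as the sum of independent geometric
variables, one for each visit of the backbone walk to `x`. -/
theorem uniformLaw_entries_ge (k : ℕ) :
    uniformLaw {V | k ≤ (entryTimes β ω U V x j).ncard} = ENNReal.ofReal (nbTail
      (entryProb β (backboneChildren ω x).length (parentWeight x)) k
      {i | walkY β ω U i = x}.ncard) := by
  have hr01 := entryProb_mem_Icc hβ (backboneChildren ω x).length (parentWeight_nonneg x)
  have hmeas : MeasurableSet {V | k ≤ (entryTimes β ω U V x j).ncard} := by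
    refine measurableSet_le measurable_const (measurable_ncard fun i => measurableSet_and ?_ ?_)
    · exact (measurable_fst.comp (measurable_walkState β ω U i)) (measurableSet_singleton x)
    · exact (measurable_fst.comp (measurable_walkState β ω U (i + 1)))
        (measurableSet_singleton (j :: x))
  have hlim : Tendsto (fun m => ∫⁻ V, entryMart β ω U V x j k m ∂uniformLaw) atTop
      (𝓝 (∫⁻ V, {V | k ≤ (entryTimes β ω U V x j).ncard}.indicator 1 V ∂uniformLaw)) := by
    refine tendsto_lintegral_of_dominated_convergence (fun _ => 1)
      (fun m => measurable_entryMart U k m) (fun m => ae_of_all _ fun V => ?_) (by simp) ?_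
    · exact ENNReal.ofReal_le_one.2 (nbTail_mem_Icc hr01.1 hr01.2 _ _).2
    · filter_upwards [ae_tendsto_clock hβ h0 U] with V hV
      refine tendsto_nhds_of_eventually_eq ?_
      filter_upwards [(entries_of_clock h0 U hfin hV hx (j := j)).2] with m hm
      rw [entryMart, hm.1, hm.2]
      by_cases hk : k ≤ (entryTimes β ω U V x j).ncard
      · rw [Set.indicator_of_mem (show V ∈ {V | k ≤ (entryTimes β ω U V x j).ncard} from hk),
          Nat.sub_eq_zero_of_le hk, nbTail_zero_left]
        simp
      · rw [Set.indicator_of_notMem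
          (show V ∉ {V | k ≤ (entryTimes β ω U V x j).ncard} from hk)]
        obtain ⟨k', hk'⟩ : ∃ k', k - (entryTimes β ω U V x j).ncard = k' + 1 :=
          ⟨k - (entryTimes β ω U V x j).ncard - 1, by omega⟩
        rw [hk', nbTail, ENNReal.ofReal_zero]
  simp only [lintegral_entryMart hβ h0 U hx hj hfin] at hlim
  rw [lintegral_indicator_one hmeas] at hlim
  exact tendsto_nhds_unique hlim tendsto_const_nhds

end

/-! ### The number of visits to the root of the first big trap -/

/-- The increment of the tail `nbTail r k` from `m` to `m + 1` variables. For `m = 0` the subtracted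
term is dropped, so that the increments sum to the tail for `k = 0` as well. -/
def nbIncr (r : ℝ) (k m : ℕ) : ℝ := nbTail r k (m + 1) - if m = 0 then 0 else nbTail r k m

lemma nbIncr_succ_zero (r : ℝ) (k : ℕ) : nbIncr r (k + 1) 0 = r * nbIncr r k 0 := by
  simp [nbIncr, nbTail]

lemma nbIncr_succ_succ (r : ℝ) (k m : ℕ) :
    nbIncr r (k + 1) (m + 1) = r * nbIncr r k (m + 1) + (1 - r) * nbIncr r (k + 1) m := by
  rcases m with _ | m
  · simp only [nbIncr, nbTail]
    norm_num
    ring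
  · simp only [nbIncr, nbTail]
    norm_num
    ring

lemma nbIncr_nonneg {r : ℝ} (h0 : 0 ≤ r) (h1 : r ≤ 1) (k m : ℕ) : 0 ≤ nbIncr r k m := by
  induction k generalizing m with
  | zero => rcases m with _ | m <;> simp [nbIncr, nbTail]
  | succ k ihk =>
    induction m with
    | zero => rw [nbIncr_succ_zero]; exact mul_nonneg h0 (ihk 0)
    | succ m ihm =>
      rw [nbIncr_succ_succ]
      exact add_nonneg (mul_nonneg h0 (ihk _)) (mul_nonneg (by linarith) ihm)

lemma sum_nbIncr (r : ℝ) (k n : ℕ) :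
    ∑ m ∈ Finset.range (n + 1), nbIncr r k m = nbTail r k (n + 1) := by
  induction n with
  | zero => simp [nbIncr]
  | succ n ih => rw [Finset.sum_range_succ, ih, nbIncr, if_neg (by omega)]; ring

/-- The generating function of the increments: a geometric number of visits turns the sum into a
geometric variable. -/
lemma sum_nbIncr_mul_pow_le {r s t : ℝ} (h0 : 0 ≤ r) (h1 : r ≤ 1) (hs0 : 0 ≤ s) (hs1 : s < 1)
    (ht : r ≤ t * (1 - (1 - r) * s)) (k M : ℕ) :
    ∑ m ∈ Finset.range M, nbIncr r k m * s ^ m ≤ t ^ k := by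
  have hpos : 0 < 1 - (1 - r) * s := by nlinarith
  have ht0 : 0 ≤ t := by
    by_contra h
    push Not at h
    nlinarith
  have hterm : ∀ k m, 0 ≤ nbIncr r k m * s ^ m := fun k m =>
    mul_nonneg (nbIncr_nonneg h0 h1 k m) (pow_nonneg hs0 m)
  induction k with
  | zero =>
    rcases M with _ | M
    · simp
    · rw [Finset.sum_range_succ']
      simp [nbIncr, nbTail]
  | succ k ih =>
    set A := ∑ m ∈ Finset.range M, nbIncr r (k + 1) m * s ^ m with hA
    set B := ∑ m ∈ Finset.range M, nbIncr r k m * s ^ m with hB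
    have hrec : A ≤ r * B + (1 - r) * s * A := by
      rcases M with _ | M
      · simp [hA, hB]
      have h2 : A = r * B + (1 - r) * s * ∑ m ∈ Finset.range M, nbIncr r (k + 1) m * s ^ m := by
        rw [hA, hB, Finset.sum_range_succ', Finset.sum_range_succ', mul_add, Finset.mul_sum,
          Finset.mul_sum, nbIncr_succ_zero, add_right_comm, ← Finset.sum_add_distrib]
        congr 1
        · refine Finset.sum_congr rfl fun m _ => ?_
          rw [nbIncr_succ_succ]
          ring
        · ring
      have h3 : ∑ m ∈ Finset.range M, nbIncr r (k + 1) m * s ^ m ≤ A := by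
        rw [hA, Finset.sum_range_succ]
        linarith [hterm (k + 1) M]
      have h4 : 0 ≤ (1 - r) * s := mul_nonneg (by linarith) hs0
      nlinarith
    have hB0 : 0 ≤ B := Finset.sum_nonneg fun m _ => hterm k m
    have h5 : A * (1 - (1 - r) * s) ≤ t * B * (1 - (1 - r) * s) := by nlinarith
    have h6 : A ≤ t * B := le_of_mul_le_mul_right h5 hpos
    rw [pow_succ']
    exact h6.trans (mul_le_mul_of_nonneg_left ih ht0)

/-- The first trap of height at least `h` has been met by time `i`, with root `x`. -/
def RootBy (β : ℝ) (h : ℕ) (ω : Env) (U : ℕ → unitInterval) (x : Vertex) (i : ℕ) : Prop :=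
  ∃ s ≤ i, walkG β 0 ω U s = x ∧ MeetsG β 0 h ω U s ∧ ∀ r < s, ¬ MeetsG β 0 h ω U r

/-- `x` is the root of the first trap of height at least `h` met. -/
def IsTrapRoot (β : ℝ) (h : ℕ) (ω : Env) (U : ℕ → unitInterval) (x : Vertex) : Prop :=
  (∃ i, MeetsG β 0 h ω U i) ∧ trapRootG β 0 h ω U = x

lemma rootBy_iff {β : ℝ} {h : ℕ} {ω : Env} {U : ℕ → unitInterval} {x : Vertex} {i : ℕ}
    (hi : walkG β 0 ω U i = x) (hx : (bigBuds ω h x).Nonempty) :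
    RootBy β h ω U x i ↔ IsTrapRoot β h ω U x := by
  constructor
  · rintro ⟨s, -, h1, h2, h3⟩
    exact ⟨⟨s, h2⟩, by rw [trapRootG, sInf_eq_of_forall_lt h2 h3, h1]⟩
  · rintro ⟨hne, h1⟩
    refine ⟨sInf {i | MeetsG β 0 h ω U i}, Nat.sInf_le ?_, h1, Nat.sInf_mem hne, fun r hr =>
      Nat.notMem_of_lt_sInf hr⟩
    show (bigBuds ω h (walkG β 0 ω U i)).Nonempty
    rwa [hi]

lemma IsTrapRoot.exists_visit {β : ℝ} {h : ℕ} {ω : Env} {U : ℕ → unitInterval} {x : Vertex}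
    (hx : IsTrapRoot β h ω U x) :
    (∃ i, walkG β 0 ω U i = x) ∧ (bigBuds ω h x).Nonempty := by
  obtain ⟨hne, h1⟩ := hx
  have h2 : MeetsG β 0 h ω U (sInf {i | MeetsG β 0 h ω U i}) := Nat.sInf_mem hne
  refine ⟨⟨_, h1⟩, ?_⟩
  rw [← h1]
  exact h2

lemma measurable_walkG_env (β ρ : ℝ) (ω : Env) (i : ℕ) : Measurable fun U => walkG β ρ ω U i :=
  (measurable_walkG β ρ i).comp measurable_prodMk_left

lemma measurableSet_meetsG_env (β : ℝ) (h : ℕ) (ω : Env) (i : ℕ) :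
    MeasurableSet {U | MeetsG β 0 h ω U i} :=
  measurable_prodMk_left (x := ω) (measurableSet_meetsG β 0 h i)

lemma measurableSet_isTrapRoot (β : ℝ) (h : ℕ) (ω : Env) (x : Vertex) :
    MeasurableSet {U | IsTrapRoot β h ω U x} :=
  measurableSet_and (measurableSet_exists fun i => measurableSet_meetsG_env β h ω i)
    (((measurable_trapRootG β 0 h).comp (measurable_prodMk_left (x := ω)))
      (measurableSet_singleton x))

lemma measurable_numVisits_env (β : ℝ) (ω : Env) (x : Vertex) :
    Measurable fun U => numVisits β 0 ω U x :=
  (measurable_numVisits β 0 x).comp (measurable_prodMk_left (x := ω))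

section

variable {β : ℝ} (hβ : 1 < β) {ω : Env} (h0 : ω ∈ survival)
include hβ h0

/-- Each vertex is visited finitely often, as the walk does not return below the level of a
super-regeneration time. -/
lemma ae_finite_visits : ∀ᵐ U ∂uniformLaw, IsSuperRegen β U 0 →
    ∀ x, {i | walkG β 0 ω U i = x}.Finite := by
  filter_upwards [ae_exists_regen_ge hβ] with U hU hr x
  by_cases hv : ∃ a, walkG β 0 ω U a = x
  · obtain ⟨a, ha⟩ := hv
    obtain ⟨s, hs, hrs⟩ := hU hr (a + 1)
    refine (Set.finite_Iic s).subset fun i hi => ?_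
    by_contra hlt
    rw [Set.mem_Iic, not_le] at hlt
    have h1 := length_lt_of_walkZ_lt (ρ := 0) hβ zero_le_one h0 U (by omega : a ≤ s)
      (hrs.1 a (by omega))
    have h2 := length_lt_of_walkZ_lt (ρ := 0) hβ zero_le_one h0 U hlt.le (hrs.2 i hlt)
    have hi' : walkG β 0 ω U i = x := hi
    rw [ha] at h1
    rw [hi'] at h2
    omega
  · push Not at hv
    have : {i | walkG β 0 ω U i = x} = ∅ := by ext i; simp [hv i]
    rw [this]
    exact Set.finite_empty

/-- `x` is the root of the first big trap and is visited at least `n + 1` times. -/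
def ManyVisits (β : ℝ) (h : ℕ) (ω : Env) (x : Vertex) (n : ℕ) : Set (ℕ → unitInterval) :=
  {U | IsSuperRegen β U 0 ∧ IsTrapRoot β h ω U x ∧ n + 1 ≤ numVisits β 0 ω U x}

omit hβ h0 in
lemma measurableSet_manyVisits (β : ℝ) (h : ℕ) (ω : Env) (x : Vertex) (n : ℕ) :
    MeasurableSet (ManyVisits β h ω x n) :=
  measurableSet_and (measurableSet_isSuperRegen β 0)
    (measurableSet_and (measurableSet_isTrapRoot β h ω x)
      (measurableSet_le measurable_const (measurable_numVisits_env β ω x)))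

/-- The walk makes its visit number `n` (counted from `0`) to `x` at time `i`, up to this time it is
compatible with `0` being a super-regeneration time, and `x` is the root of the first big trap. -/
def VisitPast (β : ℝ) (h : ℕ) (ω : Env) (x : Vertex) (n i : ℕ) : Set (ℕ → unitInterval) :=
  {U | (walkG β 0 ω U i = x ∧ Nat.count (fun s => walkG β 0 ω U s = x) i = n) ∧
    RootBy β h ω U x i ∧ ∀ s ≤ i, 0 < s → 0 < walkZ β U s}

omit hβ h0 in
lemma measurableSet_visitPast (β : ℝ) (h : ℕ) (ω : Env) (x : Vertex) (n i : ℕ) :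
    MeasurableSet (VisitPast β h ω x n i) := by
  have hw : ∀ s y, MeasurableSet {U | walkG β 0 ω U s = y} := fun s y =>
    measurable_walkG_env β 0 ω s (measurableSet_singleton y)
  refine measurableSet_and (measurableSet_and (hw i x) ?_) (measurableSet_and ?_ ?_)
  · have : Measurable fun U => Nat.count (fun s => walkG β 0 ω U s = x) i := by
      simp only [Nat.count_eq_card_filter_range, Finset.card_filter]
      exact Finset.measurable_sum _ fun s _ =>
        Measurable.ite (hw s x) measurable_const measurable_const
    exact this (measurableSet_singleton n)
  · exact measurableSet_exists fun s => measurableSet_and (MeasurableSet.const _)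
      (measurableSet_and (hw s x) (measurableSet_and (measurableSet_meetsG_env β h ω s)
        (measurableSet_forall fun r => measurableSet_forall fun _ => measurableSet_not
          (measurableSet_meetsG_env β h ω r))))
  · exact measurableSet_forall fun s => measurableSet_forall fun _ => measurableSet_forall fun _ =>
      measurableSet_walkZ_lt β 0 s

omit hβ h0 in
lemma concat_mem_visitPast (h : ℕ) (x : Vertex) (n i : ℕ) (U U' : ℕ → unitInterval) :
    concat i U U' ∈ VisitPast β h ω x n i ↔ U ∈ VisitPast β h ω x n i := by
  have hw : ∀ s ≤ i, walkG β 0 ω (concat i U U') s = walkG β 0 ω U s := fun s hs =>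
    walkG_concat β 0 ω U U' hs
  have hm : ∀ s ≤ i, MeetsG β 0 h ω (concat i U U') s ↔ MeetsG β 0 h ω U s := fun s hs => by
    rw [MeetsG, MeetsG, hw s hs]
  have h1 : Nat.count (fun s => walkG β 0 ω (concat i U U') s = x) i =
      Nat.count (fun s => walkG β 0 ω U s = x) i := by
    simp only [Nat.count_eq_card_filter_range]
    congr 1
    refine Finset.filter_congr fun s hs => ?_
    rw [hw s (Finset.mem_range.1 hs).le]
  have h2 : RootBy β h ω (concat i U U') x i ↔ RootBy β h ω U x i := by
    refine exists_congr fun s => and_congr_right fun hs => ?_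
    rw [hw s hs, hm s hs]
    refine and_congr_right fun _ => and_congr_right fun _ => forall_congr' fun r =>
      forall_congr' fun hr => ?_
    rw [hm r (by omega)]
  have h3 : (∀ s ≤ i, 0 < s → 0 < walkZ β (concat i U U') s) ↔
      ∀ s ≤ i, 0 < s → 0 < walkZ β U s := by
    refine forall_congr' fun s => forall_congr' fun hs => ?_
    rw [walkZ_concat hs]
  exact and_congr (and_congr (by rw [hw i le_rfl]) (by rw [h1])) (and_congr h2 h3)

omit hβ h0 in
lemma visitPast_disjoint (h : ℕ) (x : Vertex) (n : ℕ) :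
    Pairwise fun i i' => Disjoint (VisitPast β h ω x n i) (VisitPast β h ω x n i') := by
  have haux : ∀ i i', i < i' → Disjoint (VisitPast β h ω x n i) (VisitPast β h ω x n i') := by
    intro i i' hlt
    refine Set.disjoint_left.2 fun U hU hU' => ?_
    have := Nat.count_strict_mono (p := fun s => walkG β 0 ω U s = x) hU.1.1 hlt
    rw [hU.1.2, hU'.1.2] at this
    exact lt_irrefl _ this
  intro i i' hne
  rcases lt_or_gt_of_ne hne with hlt | hlt
  · exact haux i i' hlt
  · exact (haux i' i hlt).symm

omit hβ h0 in
lemma manyVisits_subset (h : ℕ) (x : Vertex) (n : ℕ) :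
    ManyVisits β h ω x n ⊆ ⋃ i, VisitPast β h ω x n i := by
  rintro U ⟨hr, hroot, hn⟩
  have hfin : {i | walkG β 0 ω U i = x}.Finite := Set.finite_of_ncard_pos (by
    rw [numVisits] at hn; omega)
  have hlt : ∀ hf : (Set.ofPred fun i => walkG β 0 ω U i = x).Finite, n < hf.toFinset.card := by
    intro hf
    rw [numVisits, Set.ncard_eq_toFinset_card _ hf] at hn
    exact hn
  refine Set.mem_iUnion.2 ⟨Nat.nth (fun s => walkG β 0 ω U s = x) n, ⟨Nat.nth_mem n hlt, ?_⟩,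
    (rootBy_iff (Nat.nth_mem n hlt) hroot.exists_visit.2).2 hroot, fun s _ hs => hr.2 s hs⟩
  exact Nat.count_nth hlt

/-- The walk that regenerates at a visit to `x` does not come back. -/
lemma visitPast_inter_regen_subset (h : ℕ) {x : Vertex} (hx : (bigBuds ω h x).Nonempty) (n i : ℕ) :
    VisitPast β h ω x n i ∩ shift i ⁻¹' {U | IsSuperRegen β U 0} ⊆
      ManyVisits β h ω x n \ ManyVisits β h ω x (n + 1) := by
  rintro U ⟨⟨⟨hi, hc⟩, hroot, hpos⟩, hfut⟩
  have hfut' : ∀ s, i < s → walkZ β U i < walkZ β U s := by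
    intro s hs
    have h1 := hfut.2 (s - i) (by omega)
    have h2 := walkZ_add β U i (s - i)
    rw [Nat.add_sub_cancel' hs.le] at h2
    simp only [walkZ] at h1
    omega
  have hvis : numVisits β 0 ω U x = n + 1 := by
    have hset : {s | walkG β 0 ω U s = x} =
        ((Finset.range (i + 1)).filter fun s => walkG β 0 ω U s = x) := by
      ext s
      simp only [Set.mem_ofPred_eq, Finset.coe_filter, Finset.mem_range]
      refine ⟨fun hs => ⟨?_, hs⟩, fun hs => hs.2⟩
      by_contra hlt
      have h2 := length_lt_of_walkZ_lt (ρ := 0) hβ zero_le_one h0 U (by omega : i ≤ s)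
        (hfut' s (by omega))
      rw [hi, hs] at h2
      exact lt_irrefl _ h2
    rw [numVisits, hset, Set.ncard_coe_finset, ← Nat.count_eq_card_filter_range, Nat.count_succ,
      if_pos hi, hc]
  have hr : IsSuperRegen β U 0 := by
    refine ⟨fun s hs => absurd hs (Nat.not_lt_zero s), fun s hs => ?_⟩
    rcases le_or_gt s i with hsi | hsi
    · exact hpos s hsi hs
    · have h3 := hfut' s hsi
      rcases Nat.eq_zero_or_pos i with rfl | hi0
      · exact h3
      · exact (hpos i le_rfl hi0).trans h3
  exact ⟨⟨hr, (rootBy_iff hi hx).1 hroot, by omega⟩, fun hU => by have := hU.2.2; omega⟩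

/-- After each visit to `x` the walk does not return with probability at least
`(β - 1) / (β + 1)`. -/
lemma uniformLaw_manyVisits_succ_le (h : ℕ) {x : Vertex} (hx : (bigBuds ω h x).Nonempty) (n : ℕ) :
    uniformLaw (ManyVisits β h ω x (n + 1)) ≤
      ENNReal.ofReal (2 / (β + 1)) * uniformLaw (ManyVisits β h ω x n) := by
  have hsub : ManyVisits β h ω x (n + 1) ⊆ ManyVisits β h ω x n := fun U hU =>
    ⟨hU.1, hU.2.1, by have := hU.2.2; omega⟩
  have h1 : uniformLaw (ManyVisits β h ω x n) ≤ ∑' i, uniformLaw (VisitPast β h ω x n i) :=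
    (measure_mono (manyVisits_subset h x n)).trans (measure_iUnion_le _)
  have h2 : (∑' i, uniformLaw (VisitPast β h ω x n i)) * regenProb β ≤
      uniformLaw (ManyVisits β h ω x n \ ManyVisits β h ω x (n + 1)) := by
    rw [← ENNReal.tsum_mul_right]
    have h3 : ∀ i, uniformLaw (VisitPast β h ω x n i) * regenProb β =
        uniformLaw (VisitPast β h ω x n i ∩ shift i ⁻¹' {U | IsSuperRegen β U 0}) := fun i =>
      (uniformLaw_past_inter_future i (measurableSet_visitPast β h ω x n i)
        (measurableSet_isSuperRegen β 0) (concat_mem_visitPast h x n i)).symm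
    simp_rw [h3]
    rw [← measure_iUnion]
    · exact measure_mono (Set.iUnion_subset fun i =>
        visitPast_inter_regen_subset hβ h0 h hx n i)
    · exact fun i i' hne => (visitPast_disjoint h x n hne).mono Set.inter_subset_left
        Set.inter_subset_left
    · exact fun i => (measurableSet_visitPast β h ω x n i).inter
        (measurable_shift i (measurableSet_isSuperRegen β 0))
  have h4 : ENNReal.ofReal ((β - 1) / (β + 1)) * uniformLaw (ManyVisits β h ω x n) ≤
      uniformLaw (ManyVisits β h ω x n \ ManyVisits β h ω x (n + 1)) := by
    rw [mul_comm]
    exact (mul_le_mul' h1 (le_regenProb hβ)).trans h2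
  have h5 : uniformLaw (ManyVisits β h ω x (n + 1)) +
      uniformLaw (ManyVisits β h ω x n \ ManyVisits β h ω x (n + 1)) =
        uniformLaw (ManyVisits β h ω x n) := by
    have := measure_inter_add_sdiff (μ := uniformLaw) (ManyVisits β h ω x n)
      (measurableSet_manyVisits β h ω x (n + 1))
    rwa [Set.inter_eq_self_of_subset_right hsub] at this
  have h6 : ENNReal.ofReal (2 / (β + 1)) + ENNReal.ofReal ((β - 1) / (β + 1)) = 1 := by
    rw [← ENNReal.ofReal_add (by positivity) (div_nonneg (by linarith) (by linarith)),
      ← add_div, show 2 + (β - 1) = β + 1 by ring, div_self (by linarith), ENNReal.ofReal_one]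
  have hfin : ENNReal.ofReal ((β - 1) / (β + 1)) * uniformLaw (ManyVisits β h ω x n) ≠ ⊤ :=
    ENNReal.mul_ne_top ENNReal.ofReal_ne_top (measure_ne_top _ _)
  refine (ENNReal.add_le_add_iff_right hfin).1 ?_
  rw [← add_mul, h6, one_mul]
  exact (add_le_add le_rfl h4).trans h5.le

lemma uniformLaw_manyVisits_le (h : ℕ) {x : Vertex} (hx : (bigBuds ω h x).Nonempty) (n : ℕ) :
    uniformLaw (ManyVisits β h ω x n) ≤
      ENNReal.ofReal ((2 / (β + 1)) ^ n) * uniformLaw (ManyVisits β h ω x 0) := by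
  induction n with
  | zero => simp
  | succ n ih =>
    refine (uniformLaw_manyVisits_succ_le hβ h0 h hx n).trans ?_
    rw [pow_succ', ENNReal.ofReal_mul (by positivity), mul_assoc]
    gcongr

end

/-- The probability of at least `k` entries into a bud, as a function of the local picture. The
minimum with `1` gives a bound for all real `w`; it has no effect at the weights that occur
(`entryObs_eq`). -/
def entryObs (β : ℝ) (k n κ : ℕ) (w : ℝ) : ENNReal :=
  min 1 (ENNReal.ofReal (nbTail (entryProb β κ w) k n))

lemma entryObs_le_one (β : ℝ) (k n κ : ℕ) (w : ℝ) : entryObs β k n κ w ≤ 1 := min_le_left _ _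

lemma entryObs_eq {β : ℝ} (hβ : 1 < β) (k n κ : ℕ) (x : Vertex) :
    entryObs β k n κ (rootWeight 0 x) =
      ENNReal.ofReal (nbTail (entryProb β κ (parentWeight x)) k n) := by
  have h := entryProb_mem_Icc hβ κ (parentWeight_nonneg x)
  rw [entryObs, rootWeight_zero, min_eq_right]
  exact ENNReal.ofReal_le_one.2 (nbTail_mem_Icc h.1 h.2 k n).2

/-- The bound on the geometric parameter: it uses that the root of a trap has a backbone child, so
that a given bud is entered with probability at most `1 / 2`. -/
lemma entryProb_le {β : ℝ} (hβ : 1 < β) {κ : ℕ} (hκ : 0 < κ) {w : ℝ} (hw : 0 ≤ w) :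
    entryProb β κ w ≤ (1 - (1 - β⁻¹) / 3) * (1 - (1 - entryProb β κ w) * (2 / (β + 1))) := by
  have hr0 := (entryProb_mem_Icc hβ κ hw).1
  have hr : entryProb β κ w ≤ 1 / 2 := by
    have hκ' : (1 : ℝ) ≤ κ := by exact_mod_cast hκ
    rw [entryProb, div_le_div_iff₀ (by nlinarith) (by norm_num)]
    nlinarith
  have hβ0 : 0 < β := by linarith
  generalize entryProb β κ w = r at hr0 hr
  have h1 : (1 - (1 - β⁻¹) / 3) * (1 - (1 - r) * (2 / (β + 1))) - r =
      ((1 - 2 * r) * ((2 * β + 1) * (β - 1)) + r * (β - 1) * β) / (3 * β * (β + 1)) := by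
    field_simp
    ring
  have h2 : 0 ≤ ((1 - 2 * r) * ((2 * β + 1) * (β - 1)) + r * (β - 1) * β) / (3 * β * (β + 1)) := by
    apply div_nonneg _ (by positivity)
    have : 0 ≤ (1 - 2 * r) * ((2 * β + 1) * (β - 1)) :=
      mul_nonneg (by linarith) (mul_nonneg (by linarith) (by linarith))
    have : 0 ≤ r * (β - 1) * β := mul_nonneg (mul_nonneg hr0 (by linarith)) hβ0.le
    linarith
  linarith

/-! ### The geometric bound, averaged over the backbone walk -/

section

variable {β : ℝ} (hβ : 1 < β)
include hβ

lemma geometricRate_mem_Ioo : 0 < 1 - (1 - β⁻¹) / 3 ∧ 1 - (1 - β⁻¹) / 3 < 1 := by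
  have h1 : β⁻¹ < 1 := inv_lt_one_of_one_lt₀ hβ
  have h2 : 0 < β⁻¹ := by positivity
  constructor <;> linarith

/-- The geometric bound in a fixed environment: decompose according to the root of the first big
trap and to the number of its visits by `Y`. -/
lemma setLIntegral_trapObs_env_le {ω : Env} (h0 : ω ∈ survival) (h k : ℕ) :
    ∫⁻ U in {U | IsSuperRegen β U 0}, trapObs β 0 h (entryObs β k) ω U ∂uniformLaw ≤
      ENNReal.ofReal ((1 - (1 - β⁻¹) / 3) ^ k) * regenProb β := by
  set t := 1 - (1 - β⁻¹) / 3 with ht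
  set S := {U : ℕ → unitInterval | IsSuperRegen β U 0} with hS
  have hSm : MeasurableSet S := measurableSet_isSuperRegen β 0
  set r : Vertex → ℝ := fun x => entryProb β (backboneChildren ω x).length (parentWeight x) with hr
  have hr01 : ∀ x, 0 ≤ r x ∧ r x ≤ 1 := fun x => entryProb_mem_Icc hβ _ (parentWeight_nonneg x)
  have hpt : ∀ᵐ U ∂uniformLaw, U ∈ S → trapObs β 0 h (entryObs β k) ω U ≤
      ∑' x : Vertex, ∑' m, ENNReal.ofReal (nbIncr (r x) k m) *
        (ManyVisits β h ω x m).indicator 1 U := by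
    filter_upwards [ae_finite_visits hβ h0] with U hU hUS
    rw [trapObs]
    split_ifs with hmeet
    swap
    · exact zero_le
    set x := trapRootG β 0 h ω U with hx
    have hroot : IsTrapRoot β h ω U x := ⟨hmeet, rfl⟩
    obtain ⟨n, hn⟩ : ∃ n, numVisits β 0 ω U x = n + 1 := by
      refine Nat.exists_eq_succ_of_ne_zero fun h1 => ?_
      rw [numVisits, Set.ncard_eq_zero (hU hUS x)] at h1
      obtain ⟨⟨i, hi⟩, -⟩ := hroot.exists_visit
      have : i ∈ {i | walkG β 0 ω U i = x} := hi
      rw [h1] at this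
      exact this
    rw [localObs, entryObs_eq hβ, hn, ← sum_nbIncr,
      ENNReal.ofReal_sum_of_nonneg fun m _ => nbIncr_nonneg (hr01 x).1 (hr01 x).2 k m]
    refine le_trans ?_ (ENNReal.le_tsum x)
    refine le_trans (Finset.sum_le_sum fun m hm => ?_) (ENNReal.sum_le_tsum (Finset.range (n + 1)))
    have hmem : U ∈ ManyVisits β h ω x m :=
      ⟨hUS, hroot, by have := Finset.mem_range.1 hm; omega⟩
    rw [Set.indicator_of_mem hmem, Pi.one_apply, mul_one]
  have hx : ∀ x, ∑' m, ENNReal.ofReal (nbIncr (r x) k m) * uniformLaw (ManyVisits β h ω x m) ≤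
      ENNReal.ofReal (t ^ k) * uniformLaw (ManyVisits β h ω x 0) := by
    intro x
    by_cases hbig : (bigBuds ω h x).Nonempty ∧ x ∈ backbone ω
    · have hrx : r x ≤ t * (1 - (1 - r x) * (2 / (β + 1))) :=
        entryProb_le hβ (backboneChildren_length_pos hbig.2) (parentWeight_nonneg x)
      have hs1 : 2 / (β + 1) < 1 := by rw [div_lt_one (by linarith)]; linarith
      refine ENNReal.tsum_le_of_sum_range_le fun M => ?_
      calc ∑ m ∈ Finset.range M,
            ENNReal.ofReal (nbIncr (r x) k m) * uniformLaw (ManyVisits β h ω x m)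
          ≤ ∑ m ∈ Finset.range M, ENNReal.ofReal (nbIncr (r x) k m * (2 / (β + 1)) ^ m) *
              uniformLaw (ManyVisits β h ω x 0) := by
            refine Finset.sum_le_sum fun m _ => ?_
            rw [ENNReal.ofReal_mul (nbIncr_nonneg (hr01 x).1 (hr01 x).2 k m), mul_assoc]
            gcongr
            exact uniformLaw_manyVisits_le hβ h0 h hbig.1 m
        _ = ENNReal.ofReal (∑ m ∈ Finset.range M, nbIncr (r x) k m * (2 / (β + 1)) ^ m) *
              uniformLaw (ManyVisits β h ω x 0) := by
            rw [← Finset.sum_mul, ENNReal.ofReal_sum_of_nonneg]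
            exact fun m _ => mul_nonneg (nbIncr_nonneg (hr01 x).1 (hr01 x).2 k m) (by positivity)
        _ ≤ _ := by
            gcongr
            exact sum_nbIncr_mul_pow_le (hr01 x).1 (hr01 x).2 (by positivity) hs1 hrx k M
    · have hempty : ∀ m, ManyVisits β h ω x m = ∅ := by
        intro m
        refine Set.eq_empty_iff_forall_notMem.2 fun U hU => hbig ?_
        obtain ⟨⟨i, hi⟩, hb⟩ := hU.2.1.exists_visit
        exact ⟨hb, hi ▸ walkG_mem_backbone β 0 h0 U i⟩
      simp [hempty]
  calc ∫⁻ U in S, trapObs β 0 h (entryObs β k) ω U ∂uniformLaw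
      ≤ ∫⁻ U in S, ∑' x : Vertex, ∑' m, ENNReal.ofReal (nbIncr (r x) k m) *
          (ManyVisits β h ω x m).indicator 1 U ∂uniformLaw :=
        lintegral_mono_ae ((ae_restrict_iff' hSm).2 hpt)
    _ ≤ ∫⁻ U, ∑' x : Vertex, ∑' m, ENNReal.ofReal (nbIncr (r x) k m) *
          (ManyVisits β h ω x m).indicator 1 U ∂uniformLaw := setLIntegral_le_lintegral _ _
    _ = ∑' x : Vertex, ∑' m, ENNReal.ofReal (nbIncr (r x) k m) *
          uniformLaw (ManyVisits β h ω x m) := by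
        have hm1 : ∀ x m, Measurable fun U => ENNReal.ofReal (nbIncr (r x) k m) *
            (ManyVisits β h ω x m).indicator (1 : (ℕ → unitInterval) → ENNReal) U := fun x m =>
          (measurable_one.indicator (measurableSet_manyVisits β h ω x m)).const_mul _
        rw [lintegral_tsum fun x => (Measurable.tsum (hm1 x)).aemeasurable]
        refine tsum_congr fun x => ?_
        rw [lintegral_tsum fun m => (hm1 x m).aemeasurable]
        refine tsum_congr fun m => ?_
        rw [lintegral_const_mul _ (measurable_one.indicator (measurableSet_manyVisits β h ω x m)),
          lintegral_indicator_one (measurableSet_manyVisits β h ω x m)]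
    _ ≤ ∑' x : Vertex, ENNReal.ofReal (t ^ k) * uniformLaw (ManyVisits β h ω x 0) :=
        ENNReal.tsum_le_tsum hx
    _ ≤ ENNReal.ofReal (t ^ k) * regenProb β := by
        rw [ENNReal.tsum_mul_left]
        gcongr
        rw [← measure_iUnion]
        · exact measure_mono (Set.iUnion_subset fun x U hU => hU.1)
        · intro x y hxy
          refine Set.disjoint_left.2 fun U hU hU' => hxy ?_
          rw [← hU.2.1.2, hU'.2.1.2]
        · exact fun x => measurableSet_manyVisits β h ω x 0

omit hβ in
lemma restrict_baseLaw_good (p : PMF ℕ) (β : ℝ) : (baseLaw p).restrict (Good β) =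
    ((offspringLaw p).restrict survival).prod
      (uniformLaw.restrict {U | IsSuperRegen β U 0}) := by
  rw [Measure.prod_restrict]
  rfl

theorem setLIntegral_trapObs_entryObs_le (p : PMF ℕ) (h k : ℕ) :
    ∫⁻ z in Good β, trapObs β 0 h (entryObs β k) z.1 z.2 ∂baseLaw p ≤
      baseLaw p (Good β) * ENNReal.ofReal ((1 - (1 - β⁻¹) / 3) ^ k) := by
  rw [restrict_baseLaw_good, lintegral_prod _ (measurable_trapObs β 0 h _).aemeasurable,
    baseLaw_good]
  refine (setLIntegral_mono measurable_const fun ω hω =>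
    setLIntegral_trapObs_env_le hβ hω h k).trans ?_
  rw [setLIntegral_const, mul_comm, mul_assoc, mul_comm (regenProb β)]

end

/-! ### The law of the walk conditioned on regeneration at time zero -/

/-- The conditioned law is the base law restricted to `Good` and normalized, with independent
driving variables for the excursions into the traps. -/
theorem lintegral_condLaw (p : PMF ℕ) (β : ℝ)
    {f : Env × (ℕ → unitInterval) × (ℕ → unitInterval) → ENNReal} (hf : Measurable f) :
    ∫⁻ d, f d ∂condLaw p β = (offspringLaw p survival)⁻¹ * ((regenProb β)⁻¹ *
      ∫⁻ z in Good β, ∫⁻ V, f (z.1, z.2, V) ∂uniformLaw ∂baseLaw p) := by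
  have hset : {d : (ℕ → unitInterval) × (ℕ → unitInterval) | IsSuperRegen β d.1 0} =
      {U | IsSuperRegen β U 0} ×ˢ Set.univ := by ext d; simp
  have hdriv : drivingLaw β = (regenProb β)⁻¹ •
      (uniformLaw.restrict {U | IsSuperRegen β U 0}).prod uniformLaw := by
    rw [drivingLaw, ProbabilityTheory.cond, hset, Measure.prod_prod, measure_univ, mul_one,
      ← Measure.prod_restrict, Measure.restrict_univ, regenProb]
  have hg : Measurable fun z : Env × (ℕ → unitInterval) =>
      ∫⁻ V, f (z.1, z.2, V) ∂uniformLaw := by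
    have h1 : Measurable fun q : (Env × (ℕ → unitInterval)) × (ℕ → unitInterval) =>
        f (q.1.1, q.1.2, q.2) := hf.comp ((measurable_fst.comp measurable_fst).prodMk
          ((measurable_snd.comp measurable_fst).prodMk measurable_snd))
    exact h1.lintegral_prod_right'
  have h2 : ∀ ω, ∫⁻ d, f (ω, d) ∂drivingLaw β = (regenProb β)⁻¹ *
      ∫⁻ U in {U | IsSuperRegen β U 0}, ∫⁻ V, f (ω, U, V) ∂uniformLaw ∂uniformLaw := by
    intro ω
    have h3 : Measurable fun d => f (ω, d) := hf.comp measurable_prodMk_left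
    rw [hdriv, lintegral_smul_measure, smul_eq_mul, lintegral_prod _ h3.aemeasurable]
  have : SFinite (drivingLaw β) := by rw [hdriv]; infer_instance
  rw [condLaw, lintegral_prod _ hf.aemeasurable, lintegral_congr h2, treeLaw,
    ProbabilityTheory.cond, lintegral_smul_measure, smul_eq_mul, restrict_baseLaw_good,
    lintegral_prod _ hg.aemeasurable, lintegral_const_mul]
  exact hg.lintegral_prod_right'

/-- The trap root in terms of the walk with parent weight `0` at the root. -/
lemma trapRoot_eq (β : ℝ) (h : ℕ) (ω : Env) (U : ℕ → unitInterval) :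
    trapRoot β h ω U = trapRootG β 0 h ω U := by
  simp only [trapRoot, meetTime, trapRootG, meetsG_zero, walkG_zero_eq_walkY]

lemma measurable_trapRoot (β : ℝ) (h : ℕ) :
    Measurable fun d : Env × (ℕ → unitInterval) × (ℕ → unitInterval) =>
      trapRoot β h d.1 d.2.1 := by
  simp only [trapRoot_eq]
  exact (measurable_trapRootG β 0 h).comp
    (measurable_fst.prodMk (measurable_fst.comp measurable_snd))

lemma measurable_trapBud (β : ℝ) (h : ℕ) :
    Measurable fun d : Env × (ℕ → unitInterval) × (ℕ → unitInterval) =>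
      trapBud β h d.1 d.2.1 := by
  unfold trapBud
  refine measurable_apply_countable
    (f := fun (d : Env × (ℕ → unitInterval) × (ℕ → unitInterval)) x =>
      (sInf (bigBuds d.1 h x) :: x : Vertex)) (fun x => ?_) (measurable_trapRoot β h)
  have h1 : Measurable fun d : Env × (ℕ → unitInterval) × (ℕ → unitInterval) =>
      sInf (bigBuds d.1 h x) := (measurable_sInf fun i => measurableSet_mem_bigBuds h x i).comp
    measurable_fst
  exact (Measurable.of_discrete (f := fun i : ℕ => (i :: x : Vertex))).comp h1

lemma measurableSet_mem_visitTimes (β : ℝ) (h i : ℕ) :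
    MeasurableSet {d : Env × (ℕ → unitInterval) × (ℕ → unitInterval) |
      i ∈ visitTimes β h d} := by
  have hX : ∀ m, Measurable fun d : Env × (ℕ → unitInterval) × (ℕ → unitInterval) =>
      walkX β d.1 d.2.1 d.2.2 m := fun m => measurable_fst.comp (measurable_walkState_aux β m)
  have hd : MeasurableSet {q : Vertex × Vertex | q.1 = q.2} := MeasurableSet.of_discrete
  exact measurableSet_and (((hX i).prodMk (measurable_trapRoot β h)) hd)
    (((hX (i + 1)).prodMk (measurable_trapBud β h)) hd)

lemma measurable_visits (β : ℝ) (h : ℕ) : Measurable (visits β h) :=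
  measurable_ncard fun i => measurableSet_mem_visitTimes β h i

lemma measurableSet_meetsBigTrap (β : ℝ) (h i : ℕ) :
    MeasurableSet {d : Env × (ℕ → unitInterval) × (ℕ → unitInterval) |
      MeetsBigTrap β h d.1 d.2.1 i} := by
  simp only [← meetsG_zero]
  exact (measurable_fst.prodMk (measurable_fst.comp measurable_snd))
    (measurableSet_meetsG β 0 h i)

section

variable {p : PMF ℕ} (hm : 1 < ∑' k : ℕ, (k : ℝ) * (p k).toReal) (hp0 : p 0 ≠ 0)
  {β : ℝ} (hβ : 1 < β)
include hm hp0 hβ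

/-- Almost surely on `Good` a big trap is met, and its root is visited finitely often. -/
lemma ae_good_meets (h : ℕ) : ∀ᵐ z ∂(baseLaw p).restrict (Good β),
    (∃ i, MeetsG β 0 h z.1 z.2 i) ∧ z.1 ∈ survival ∧
      ∀ x, {i | walkY β z.1 z.2 i = x}.Finite := by
  have hgood := measurableSet_good β
  have h1 : ∀ᵐ z ∂baseLaw p, z ∈ Good β → ∃ i, MeetsG β 0 h z.1 z.2 i := by
    refine measure_mono_null (fun z hz => ?_) (baseLaw_good_not_meet hm hp0 hβ h)
    rw [Set.mem_compl_iff, Set.mem_ofPred_eq, Classical.not_imp] at hz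
    exact hz
  have hmeas : MeasurableSet {z : Env × (ℕ → unitInterval) |
      z ∈ Good β ∧ ¬ ∀ x, {i | walkG β 0 z.1 z.2 i = x}.Finite} := by
    refine measurableSet_and hgood (measurableSet_not (measurableSet_forall fun x => ?_))
    simp only [← Set.not_infinite]
    exact measurableSet_not (measurableSet_infinite fun i => measurableSet_walkG_eq β 0 i x)
  have h2 : ∀ᵐ z ∂baseLaw p, z ∈ Good β → ∀ x, {i | walkG β 0 z.1 z.2 i = x}.Finite := by
    have h3 : baseLaw p {z : Env × (ℕ → unitInterval) |
        z ∈ Good β ∧ ¬ ∀ x, {i | walkG β 0 z.1 z.2 i = x}.Finite} = 0 := by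
      rw [baseLaw, Measure.measure_prod_null hmeas]
      refine ae_of_all _ fun ω => ?_
      by_cases hω : ω ∈ survival
      · refine measure_mono_null (fun U hU => ?_) (ae_finite_visits hβ hω)
        rw [Set.mem_compl_iff, Set.mem_ofPred_eq, Classical.not_imp]
        exact ⟨hU.1.2, hU.2⟩
      · refine measure_mono_null (fun U hU => ?_) (measure_empty (μ := uniformLaw))
        exact hω hU.1.1
    refine measure_mono_null (fun z hz => ?_) h3
    rw [Set.mem_compl_iff, Set.mem_ofPred_eq, Classical.not_imp] at hz
    exact hz
  refine (ae_restrict_iff' hgood).2 ?_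
  filter_upwards [h1, h2] with z hz1 hz2 hz
  refine ⟨hz1 hz, hz.1, fun x => ?_⟩
  have := hz2 hz x
  simp only [walkG_zero_eq_walkY] at this
  exact this

omit hm hp0 hβ in
/-- The visits to the first big trap are the entries into the bud of the leftmost big trap at its
root. -/
lemma trapRoot_spec {h : ℕ} {ω : Env} (h0 : ω ∈ survival) {U : ℕ → unitInterval}
    (hmeet : ∃ i, MeetsG β 0 h ω U i) :
    trapRoot β h ω U ∈ backbone ω ∧
      sInf (bigBuds ω h (trapRoot β h ω U)) ∈ buds ω (trapRoot β h ω U) := by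
  have h1 : MeetsG β 0 h ω U (sInf {i | MeetsG β 0 h ω U i}) := Nat.sInf_mem hmeet
  rw [trapRoot_eq]
  exact ⟨walkG_mem_backbone β 0 h0 U _, (Nat.sInf_mem h1).1⟩

omit hp0 in
lemma inv_mul_baseLaw_good :
    (offspringLaw p survival)⁻¹ * ((regenProb β)⁻¹ * baseLaw p (Good β)) = 1 := by
  rw [baseLaw_good, mul_comm (offspringLaw p survival), ← mul_assoc (regenProb β)⁻¹,
    ENNReal.inv_mul_cancel (regenProb_ne_zero hβ) (regenProb_ne_top β), one_mul,
    ENNReal.inv_mul_cancel (offspringLaw_survival_ne_zero p hm) (measure_ne_top _ _)]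

omit hp0 in
lemma isProbabilityMeasure_condLaw : IsProbabilityMeasure (condLaw p β) := by
  constructor
  rw [← lintegral_one, lintegral_condLaw p β measurable_const]
  simp only [lintegral_one, measure_univ, Measure.restrict_apply_univ]
  exact inv_mul_baseLaw_good hm hβ

/-- A big trap is met almost surely, and entered finitely often. -/
theorem ae_condLaw_meets_and_finite (h : ℕ) : ∀ᵐ d ∂condLaw p β,
    (∃ i, MeetsBigTrap β h d.1 d.2.1 i) ∧ (visitTimes β h d).Finite := by
  have hmeas : MeasurableSet {d : Env × (ℕ → unitInterval) × (ℕ → unitInterval) |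
      ¬ ((∃ i, MeetsBigTrap β h d.1 d.2.1 i) ∧ (visitTimes β h d).Finite)} := by
    refine measurableSet_not (measurableSet_and
      (measurableSet_exists fun i => measurableSet_meetsBigTrap β h i) ?_)
    simp only [← Set.not_infinite]
    exact measurableSet_not (measurableSet_infinite fun i => measurableSet_mem_visitTimes β h i)
  rw [ae_iff, ← lintegral_indicator_one hmeas,
    lintegral_condLaw p β (measurable_one.indicator hmeas)]
  refine mul_eq_zero_of_right _ (mul_eq_zero_of_right _ ?_)
  refine lintegral_eq_zero_of_ae_eq_zero ?_
  filter_upwards [ae_good_meets hm hp0 hβ h] with z ⟨hz1, hz2, hz3⟩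
  refine lintegral_eq_zero_of_ae_eq_zero ?_
  obtain ⟨hx, -⟩ := trapRoot_spec hz2 hz1
  filter_upwards [ae_finite_entryTimes hβ hz2 z.2 hx (hz3 _)
    (j := sInf (bigBuds z.1 h (trapRoot β h z.1 z.2)))] with V hV
  refine Set.indicator_of_notMem (fun hbad : ¬ _ => hbad ⟨?_, hV⟩) _
  simpa only [← meetsG_zero] using hz1

/-- The tails of the number of visits to the first big trap. -/
theorem condLaw_visits_ge (h k : ℕ) :
    condLaw p β {d | k ≤ visits β h d} = (offspringLaw p survival)⁻¹ * ((regenProb β)⁻¹ *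
      ∫⁻ z in Good β, trapObs β 0 h (entryObs β k) z.1 z.2 ∂baseLaw p) := by
  have hmeas : MeasurableSet {d : Env × (ℕ → unitInterval) × (ℕ → unitInterval) |
      k ≤ visits β h d} := measurableSet_le measurable_const (measurable_visits β h)
  rw [← lintegral_indicator_one hmeas, lintegral_condLaw p β (measurable_one.indicator hmeas)]
  congr 2
  refine lintegral_congr_ae ?_
  filter_upwards [ae_good_meets hm hp0 hβ h] with z ⟨hz1, hz2, hz3⟩
  obtain ⟨hx, hj⟩ := trapRoot_spec hz2 hz1
  have h1 := uniformLaw_entries_ge hβ hz2 z.2 hx hj (hz3 _) k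
  have h2 : MeasurableSet {V | k ≤ visits β h (z.1, z.2, V)} :=
    ((measurable_prodMk_left (x := z.1)).comp (measurable_prodMk_left (x := z.2))) hmeas
  calc ∫⁻ V, {d | k ≤ visits β h d}.indicator 1 (z.1, z.2, V) ∂uniformLaw
      = ∫⁻ V, {V | k ≤ visits β h (z.1, z.2, V)}.indicator 1 V ∂uniformLaw := rfl
    _ = uniformLaw {V | k ≤ visits β h (z.1, z.2, V)} := lintegral_indicator_one h2
    _ = trapObs β 0 h (entryObs β k) z.1 z.2 := by
      rw [trapObs, if_pos hz1, localObs, entryObs_eq hβ, numVisits, ← trapRoot_eq]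
      simp only [walkG_zero_eq_walkY]
      exact h1

theorem condLaw_visits_ge_le (h k : ℕ) :
    condLaw p β {d | k ≤ visits β h d} ≤ ENNReal.ofReal ((1 - (1 - β⁻¹) / 3) ^ k) := by
  rw [condLaw_visits_ge hm hp0 hβ]
  calc _ ≤ (offspringLaw p survival)⁻¹ * ((regenProb β)⁻¹ *
        (baseLaw p (Good β) * ENNReal.ofReal ((1 - (1 - β⁻¹) / 3) ^ k))) := by
        gcongr
        exact setLIntegral_trapObs_entryObs_le hβ p h k
    _ = _ := by
        rw [← mul_assoc (regenProb β)⁻¹, ← mul_assoc,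
          inv_mul_baseLaw_good hm hβ, one_mul]

theorem tendsto_condLaw_visits_ge (k : ℕ) :
    Tendsto (fun h => condLaw p β {d | k ≤ visits β h d}) atTop
      (𝓝 (limitObs p β (entryObs β k))) := by
  simp only [condLaw_visits_ge hm hp0 hβ]
  have h1 := tendsto_trapObs_zero hm hp0 hβ (entryObs_le_one β k)
  have h2 := ENNReal.Tendsto.const_mul (a := (offspringLaw p survival)⁻¹) (ENNReal.Tendsto.const_mul
    (a := (regenProb β)⁻¹) h1 (Or.inr (ENNReal.inv_ne_top.2 (regenProb_ne_zero hβ))))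
    (Or.inr (ENNReal.inv_ne_top.2 (offspringLaw_survival_ne_zero p hm)))
  rwa [← mul_assoc (regenProb β)⁻¹, ← mul_assoc,
    inv_mul_baseLaw_good hm hβ, one_mul] at h2

end

/-! ### Convergence in distribution from convergence of the tails -/

/-- If the tails of integer-valued variables converge and the limit of the tails tends to `0`, then
the variables converge in distribution. -/
theorem exists_tendstoInDistribution_of_tails {Ω : Type*} [MeasurableSpace Ω] (P : Measure Ω)
    [IsProbabilityMeasure P] {X : ℕ → Ω → ℕ} (hX : ∀ n, Measurable (X n)) {L : ℕ → ENNReal}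
    (hL : ∀ k, Tendsto (fun n => P {x | k ≤ X n x}) atTop (𝓝 (L k)))
    (hL0 : Tendsto L atTop (𝓝 0)) :
    ∃ (μ : Measure ℕ) (_ : IsProbabilityMeasure μ),
      TendstoInDistribution X atTop id (fun _ => P) μ ∧ ∀ k, μ {j | k ≤ j} = L k := by
  have hzero : L 0 = 1 := by
    refine tendsto_nhds_unique (hL 0) ?_
    simp
  have hanti : ∀ k, L (k + 1) ≤ L k := fun k =>
    le_of_tendsto_of_tendsto' (hL (k + 1)) (hL k) fun n =>
      measure_mono fun x (hx : k + 1 ≤ X n x) => (show k ≤ X n x by omega)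
  have hle : ∀ k, L k ≤ 1 := fun k => le_of_tendsto' (hL k) fun n => prob_le_one
  have hfin : ∀ k, L k ≠ ⊤ := fun k => ((hle k).trans_lt ENNReal.one_lt_top).ne
  have hsum : ∀ k, ∑ j ∈ Finset.range k, (L j - L (j + 1)) = 1 - L k := by
    intro k
    induction k with
    | zero => simp [hzero]
    | succ k ih =>
      rw [Finset.sum_range_succ, ih]
      exact tsub_add_tsub_cancel (hle k) (hanti k)
  have htsum : ∑' j, (L j - L (j + 1)) = 1 := by
    refine tendsto_nhds_unique (ENNReal.tendsto_nat_tsum _) ?_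
    simp only [hsum]
    simpa using ENNReal.Tendsto.sub (tendsto_const_nhds (x := (1 : ENNReal))) hL0
      (Or.inl ENNReal.one_ne_top)
  let w : PMF ℕ := ⟨fun j => L j - L (j + 1), htsum ▸ ENNReal.summable.hasSum⟩
  have hw : ∀ j, w.toMeasure {j} = L j - L (j + 1) := fun j =>
    PMF.toMeasure_apply_singleton _ _ (measurableSet_singleton j)
  have hmass : ∀ n j, P {x | X n x = j} = P {x | j ≤ X n x} - P {x | j + 1 ≤ X n x} := by
    intro n j
    have hsub : {x | j + 1 ≤ X n x} ⊆ {x | j ≤ X n x} := fun x (hx : j + 1 ≤ X n x) =>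
      (show j ≤ X n x by omega)
    rw [← measure_sdiff hsub (measurableSet_le measurable_const (hX n)).nullMeasurableSet
      (measure_ne_top _ _)]
    congr 1
    ext x
    simp only [Set.mem_sdiff, Set.mem_ofPred_eq]
    omega
  refine ⟨w.toMeasure, inferInstance, ⟨fun n => (hX n).aemeasurable, aemeasurable_id, ?_⟩, ?_⟩
  · -- on a discrete space it suffices to test the singletons
    refine IsPiSystem.tendsto_probabilityMeasure_of_tendsto_of_mem
      (S := Set.range fun j : ℕ => ({j} : Set ℕ)) ?_ ?_ ?_ ?_
    · rintro _ ⟨i, rfl⟩ _ ⟨j, rfl⟩ ⟨a, ha, hb⟩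
      exact ⟨a, by simp_all⟩
    · rintro _ ⟨j, rfl⟩
      exact measurableSet_singleton j
    · intro u _ j hj
      exact ⟨{j}, ⟨j, rfl⟩, (isOpen_discrete _).mem_nhds rfl, by simpa using hj⟩
    · rintro _ ⟨j, rfl⟩
      refine (ENNReal.tendsto_toNNReal ?_).comp ?_
      · rw [ProbabilityMeasure.coe_mk, Measure.map_id]
        exact measure_ne_top _ _
      · simp only [ProbabilityMeasure.coe_mk, Measure.map_id, hw]
        refine (ENNReal.Tendsto.sub (hL j) (hL (j + 1)) (Or.inl (hfin j))).congr fun n => ?_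
        rw [Measure.map_apply (hX n) (measurableSet_singleton j), ← hmass]
        rfl
  · intro k
    have h1 : w.toMeasure (Finset.range k : Set ℕ) = 1 - L k := by
      rw [PMF.toMeasure_apply_finset, ← hsum k]
      rfl
    have h2 : {j : ℕ | k ≤ j} = (Finset.range k : Set ℕ)ᶜ := by ext j; simp
    rw [h2, prob_compl_eq_one_sub (Finset.measurableSet _), h1,
      ENNReal.sub_sub_cancel ENNReal.one_ne_top (hle k)]

end BiasedGW

end

theorem mainTheorem6 (p : PMF ℕ) (hp0 : p 0 ≠ 0)
    (hm : 1 < ∑' k : ℕ, (k : ℝ) * (p k).toReal)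
    (hp2 : Summable fun k : ℕ => (k : ℝ) ^ 2 * (p k).toReal)
    (β : ℝ) (hβ : 1 / BiasedGW.derivAtExtinction p < β)
    (ε : ℝ) (hε0 : 0 < ε) (hε1 : ε < 1) :
    ∃ _ : IsProbabilityMeasure (BiasedGW.condLaw p β),
      (∀ n : ℕ, ∀ᵐ d ∂BiasedGW.condLaw p β,
        (∃ i, BiasedGW.MeetsBigTrap β (BiasedGW.bigHeight p ε n) d.1 d.2.1 i) ∧
          (BiasedGW.visitTimes β (BiasedGW.bigHeight p ε n) d).Finite) ∧
      ∃ (Ω : Type) (_ : MeasurableSpace Ω) (μ : Measure Ω) (_ : IsProbabilityMeasure μ)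
        (W : Ω → ℕ),
        TendstoInDistribution (fun n : ℕ => BiasedGW.visits β (BiasedGW.bigHeight p ε n)) atTop W
          (fun _ => BiasedGW.condLaw p β) μ ∧
        ∀ k : ℕ, 1 ≤ k → μ.real {x | k ≤ W x} ≤ (1 - (1 - β⁻¹) / 3) ^ (k - 1) := by
  have hf0 := BiasedGW.derivAtExtinction_pos p hm hp0
  have hf1 := BiasedGW.derivAtExtinction_lt_one p hm
  have hβ1 : 1 < β := (one_lt_one_div hf0 hf1).trans hβ
  have ht := BiasedGW.geometricRate_mem_Ioo hβ1
  have hprob : IsProbabilityMeasure (BiasedGW.condLaw p β) :=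
    BiasedGW.isProbabilityMeasure_condLaw hm hβ1
  refine ⟨hprob, fun n => BiasedGW.ae_condLaw_meets_and_finite hm hp0 hβ1 _, ?_⟩
  have hlim : ∀ k, Tendsto (fun n => BiasedGW.condLaw p β
      {d | k ≤ BiasedGW.visits β (BiasedGW.bigHeight p ε n) d}) atTop
      (𝓝 (BiasedGW.limitObs p β (BiasedGW.entryObs β k))) := fun k =>
    (BiasedGW.tendsto_condLaw_visits_ge hm hp0 hβ1 k).comp
      (BiasedGW.tendsto_bigHeight p hf0 hf1 hε1)
  have hbound : ∀ k, BiasedGW.limitObs p β (BiasedGW.entryObs β k) ≤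
      ENNReal.ofReal ((1 - (1 - β⁻¹) / 3) ^ k) := fun k =>
    le_of_tendsto' (hlim k) fun n => BiasedGW.condLaw_visits_ge_le hm hp0 hβ1 _ k
  have hzero : Tendsto (fun k => BiasedGW.limitObs p β (BiasedGW.entryObs β k)) atTop (𝓝 0) := by
    refine tendsto_of_tendsto_of_tendsto_of_le_of_le tendsto_const_nhds ?_ (fun _ => zero_le)
      hbound
    rw [← ENNReal.ofReal_zero]
    exact ENNReal.tendsto_ofReal (tendsto_pow_atTop_nhds_zero_of_lt_one ht.1.le ht.2)
  obtain ⟨μ, hμ, hconv, htail⟩ := BiasedGW.exists_tendstoInDistribution_of_tails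
    (BiasedGW.condLaw p β) (fun n => BiasedGW.measurable_visits β (BiasedGW.bigHeight p ε n))
    hlim hzero
  refine ⟨ℕ, inferInstance, μ, hμ, id, hconv, fun k hk => ?_⟩
  have h1 : μ.real {x | k ≤ id x} ≤ (1 - (1 - β⁻¹) / 3) ^ k :=
    ENNReal.toReal_le_of_le_ofReal (pow_nonneg ht.1.le k) ((htail k).le.trans (hbound k))
  exact h1.trans (pow_le_pow_of_le_one ht.1.le ht.2.le (Nat.sub_le k 1))
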